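/- **Setting.** Let $d\ge 1$. An input consists of integers $k,\ell\ge 1$, a real $\varepsilon\in(0,1)$, and a stream of $n$ points $x_1,\dots,x_n\in\mathbb{R}^d$ with colors $f(1),\dots,f(n)\in\{1,\dots,\ell\}$. A *color constraint* for it is a set $\mathbf K\subseteq\mathbb{N}^{k\times \ell}$ of matrices with $\sum_i K_{ij}=|f^{-1}(j)|$ for all $K\in\mathbf K$ and all $j$. An assignment $\alpha:\{1,\dots,n\}\to\{1,\dots,k\}$ *satisfies* $\mathbf K$ if there is $K\in\mathbf K$ with $|\{p: f(p)=j,\ \alpha(p)=i\}|=K_{ij}$ for all $i,j$. For centers $c=(c_1,\dots,c_k)$ in $\mathbb{R}^d$ put $$\mathrm{cost}_{\mathbf K}(c)=\min_{\alpha\text{ satisfies }\mathbf K}\ \sum_{p=1}^n\|x_p-c_{\alpha(p)}\|^2 .$$ An *optimal assignment algorithm* for $\mathbf K$ gets $k$ centers and a finite family of $m$ colored points with positive integer weights $w$ for which $\mathbf K$ is a color constraint (the weights of the points of color $j$ sum to $\sum_iK_{ij}$ for every $K\in\mathbf K$), and computes an assignment of minimum cost that satisfies $\mathbf K$, where a point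 of weight $w$ counts as $w$ unit points that may go to different clusters. It is *efficient* with exponent $e$ if on every such input, with $N=d+m+k+\ell+(\text{bit length of }\sum w)$, it takes at most $N^e$ steps and uses at most $N^e$ memory cells and integers of size at most $(N+\sum w)^e$. The computational model is the real RAM: memory cells hold reals or non-negative integers; arithmetic operations, comparisons and memory accesses have unit cost; there is no rounding of reals to integers. A *streaming algorithm* is a real-RAM program that reads the stream once, item by item, and does not know $n$ in advance; it accesses $\mathbf K$ only by calling an optimal assignment algorithm for $\mathbf K$ as a subroutine, the steps of which are counted and which works under the same bounds on memory cells and integer size. Put $$B=\ell\,k\,\varepsilon^{-d}\,\log(n+3).$$ **Theorem.** For every $d\ge1$ there is a streaming algorithm such that for every $e$ there is a constant $C$ (depending only on $d$ and $e$) with the following property. For all $k,\ell\ge 1$, all $\varepsilon\in(0,1)$, all $n$, all streams of $n$ colored points, all nonempty color constraints $\mathbf K$ for it, and all optimal assignment algorithms for $\mathbf K$ that are efficient with exponent $e$, the streaming algorithm, run with this subroutine, computes centers $c_1,\dots,c_k\in\mathbb{R}^d$ with $$\mathrm{cost}_{\mathbf K}(c)\ \le\ (1+\varepsilon)\,\mathrm{cost}_{\mathbf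 K}(c')\qquad\text{for all } c'\in(\mathbb{R}^d)^k ,$$ where both minima range over a nonempty set of assignments, and * it uses at most $B^{C}$ memory cells, and integers of size at most $((n+1)B)^{C}$; * it takes at most $(n+1)\,B^{Ck}$ steps up to the end of the pass over the stream, which is polynomial in $n$, $\ell$ and $1/\varepsilon$ for constant $d$ and $k$; * after the pass it takes at most $B^{Ck/\varepsilon}=(\ell k\varepsilon^{-d}\log (n+3))^{O(k/\varepsilon)}$ steps to compute the centers. -/

import Mathlib

/-! ## The machine model: a real RAM with a step count, a memory limit and a word size

A machine has integer cells and real cells.  Its programs are fixed finite texts built from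
assignments, branching, loops and calls of one subroutine.  There is no rounding of reals to
integers, and the only real constants are the ones obtained from integer literals. -/

namespace RealRAM

/-- The memory: cell `a` of the integer memory and cell `a` of the real memory. -/
@[ext] structure State where
  int : ℕ → ℕ
  real : ℕ → ℝ

/-- Integer expressions. `get a` is the content of the integer cell with address `a`. -/
inductive IntExp where
  | lit (c : ℕ)
  | get (a : IntExp)
  | add (a b : IntExp)
  | sub (a b : IntExp)
  | mul (a b : IntExp)

/-- Real expressions. `get a` is the content of the real cell with address `a`. -/
inductive RealExp where
  | ofInt (a : IntExp)
  | get (a : IntExp)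
  | add (x y : RealExp)
  | sub (x y : RealExp)
  | mul (x y : RealExp)
  | div (x y : RealExp)

/-- Tests. -/
inductive Test where
  | intLe (a b : IntExp)
  | realLe (x y : RealExp)
  | not (b : Test)
  | and (b c : Test)

/-- Subtraction of integers is truncated at `0`. -/
def IntExp.eval (s : State) : IntExp → ℕ
  | lit c => c
  | get a => s.int (a.eval s)
  | add a b => a.eval s + b.eval s
  | sub a b => a.eval s - b.eval s
  | mul a b => a.eval s * b.eval s

/-- Division by zero returns `0`. -/
noncomputable def RealExp.eval (s : State) : RealExp → ℝ
  | ofInt a => (a.eval s : ℝ)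
  | get a => s.real (a.eval s)
  | add x y => x.eval s + y.eval s
  | sub x y => x.eval s - y.eval s
  | mul x y => x.eval s * y.eval s
  | div x y => x.eval s / y.eval s

def Test.Holds (s : State) : Test → Prop
  | intLe a b => a.eval s ≤ b.eval s
  | realLe x y => x.eval s ≤ y.eval s
  | not b => ¬ b.Holds s
  | and b c => b.Holds s ∧ c.Holds s

/-- Programs.  `call a p b q o r` runs the subroutine on a separate memory whose first `p` integer
cells and first `q` real cells are copied from the blocks with base addresses `a` and `b`, the other
cells being `0`.  When the subroutine has stopped, its integer cell `0` holds the base address of its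
result, of which `r` cells are copied to the integer cells `o, …, o + r - 1` of the caller. -/
inductive Program where
  | skip
  | setInt (a e : IntExp)
  | setReal (a : IntExp) (e : RealExp)
  | seq (P Q : Program)
  | ite (b : Test) (P Q : Program)
  | while (b : Test) (P : Program)
  | call (a p b q o r : IntExp)

def State.setInt (s : State) (a v : ℕ) : State where
  int := Function.update s.int a v
  real := s.real

noncomputable def State.setReal (s : State) (a : ℕ) (v : ℝ) : State where
  int := s.int
  real := Function.update s.real a v

/-- The memory on which a subroutine starts. -/
noncomputable def State.window (s : State) (a p b q : ℕ) : State where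
  int := fun x => if x < p then s.int (a + x) else 0
  real := fun x => if x < q then s.real (b + x) else 0

/-- The memory of the caller after a call that ended in the memory `s'` of the subroutine. -/
def State.copyBack (s s' : State) (o r : ℕ) : State where
  int := fun x => if o ≤ x ∧ x < o + r then s'.int (s'.int 0 + (x - o)) else s.int x
  real := s.real

/-- `Exec sub M W P s t s'`: started in `s`, the program `P` stops in `s'` after `t` steps, writes
only into cells with addresses below `M`, and writes only integers that are at most `W`.
`sub s t s'` describes the runs of the subroutine.  An assignment and the evaluation of a test are
one step each (the length of an expression is a constant of the program); a call costs the steps of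
the subroutine and one step for each cell that is copied. -/
inductive Exec (sub : State → ℕ → State → Prop) (M W : ℕ) :
    Program → State → ℕ → State → Prop
  | skip (s : State) : Exec sub M W .skip s 1 s
  | setInt (a e : IntExp) (s : State) (ha : a.eval s < M) (he : e.eval s ≤ W) :
      Exec sub M W (.setInt a e) s 1 (s.setInt (a.eval s) (e.eval s))
  | setReal (a : IntExp) (e : RealExp) (s : State) (ha : a.eval s < M) :
      Exec sub M W (.setReal a e) s 1 (s.setReal (a.eval s) (e.eval s))
  | seq {P Q : Program} {s s₁ s₂ : State} {t₁ t₂ : ℕ}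
      (h₁ : Exec sub M W P s t₁ s₁) (h₂ : Exec sub M W Q s₁ t₂ s₂) :
      Exec sub M W (.seq P Q) s (t₁ + t₂) s₂
  | ite_true {b : Test} {P Q : Program} {s s₁ : State} {t : ℕ} (hb : b.Holds s)
      (h : Exec sub M W P s t s₁) : Exec sub M W (.ite b P Q) s (t + 1) s₁
  | ite_false {b : Test} {P Q : Program} {s s₁ : State} {t : ℕ} (hb : ¬ b.Holds s)
      (h : Exec sub M W Q s t s₁) : Exec sub M W (.ite b P Q) s (t + 1) s₁
  | while_false {b : Test} {P : Program} {s : State} (hb : ¬ b.Holds s) :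
      Exec sub M W (.while b P) s 1 s
  | while_true {b : Test} {P : Program} {s s₁ s₂ : State} {t₁ t₂ : ℕ} (hb : b.Holds s)
      (h₁ : Exec sub M W P s t₁ s₁) (h₂ : Exec sub M W (.while b P) s₁ t₂ s₂) :
      Exec sub M W (.while b P) s (t₁ + t₂ + 1) s₂
  | call {a p b q o r : IntExp} {s s' : State} {t : ℕ}
      (hp : p.eval s ≤ M) (hq : q.eval s ≤ M) (ho : o.eval s + r.eval s ≤ M)
      (h : sub (s.window (a.eval s) (p.eval s) (b.eval s) (q.eval s)) t s')
      (hW : ∀ x < r.eval s, s'.int (s'.int 0 + x) ≤ W) :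
      Exec sub M W (.call a p b q o r) s (t + p.eval s + q.eval s + r.eval s + 1)
        (s.copyBack s' (o.eval s) (r.eval s))

/-- Runs of programs without a subroutine (a `call` has no run). -/
def ExecPlain (M W : ℕ) : Program → State → ℕ → State → Prop :=
  Exec (fun _ _ _ => False) M W

/-- Runs of programs that use the program `A` as their subroutine, under the same limits. -/
def ExecWith (A : Program) (M W : ℕ) : Program → State → ℕ → State → Prop :=
  Exec (ExecPlain M W A) M W

/-- A one-pass streaming program: `start` is executed first, `update` once for every item of the
stream, in its order, and `finish` when the stream has ended. -/
structure StreamProgram where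
  start : Program
  update : Program
  finish : Program

/-- The memory in which the next item of the stream has become available: the integer `j` in the
integer cell `2`, the vector `v` in the real cells `1, …, d`. -/
noncomputable def State.load {d : ℕ} (s : State) (v : EuclideanSpace ℝ (Fin d)) (j : ℕ) : State where
  int := Function.update s.int 2 j
  real := fun a => if h : 1 ≤ a ∧ a - 1 < d then v ⟨a - 1, h.2⟩ else s.real a

/-- `StreamRun exec U L s t s'`: reading the items of `L` one after the other and executing `U` after
each of them leads from `s` to `s'` and takes `t` steps in total. -/
def StreamRun {d : ℕ} (exec : Program → State → ℕ → State → Prop) (U : Program) :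
    List (EuclideanSpace ℝ (Fin d) × ℕ) → State → ℕ → State → Prop
  | [], s, t, s' => t = 0 ∧ s' = s
  | p :: L, s, t, s' => ∃ (t₁ t₂ : ℕ) (s₁ : State),
      exec U (s.load p.1 p.2) t₁ s₁ ∧ StreamRun exec U L s₁ t₂ s' ∧ t = t₁ + t₂

end RealRAM

/-! ## Color constrained k-means -/

namespace ColorKMeans

open RealRAM

/-- The set `𝒦` of matrices is a color constraint for `m` points with weights `w` and colors `f`:
the `j`-th column of every matrix in `𝒦` sums up to the total weight of color `j`. -/
def IsColorConstraint {m k l : ℕ} (w : Fin m → ℕ) (f : Fin m → Fin l)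
    (𝒦 : Set (Matrix (Fin k) (Fin l) ℕ)) : Prop :=
  ∀ K ∈ 𝒦, ∀ j, ∑ i, K i j = ∑ p with f p = j, w p

/-- The assignment `α` of the points to the `k` clusters satisfies the color constraint `𝒦`. -/
def Satisfies {n k l : ℕ} (f : Fin n → Fin l) (𝒦 : Set (Matrix (Fin k) (Fin l) ℕ))
    (α : Fin n → Fin k) : Prop :=
  ∃ K ∈ 𝒦, ∀ i j, (Finset.univ.filter fun p => f p = j ∧ α p = i).card = K i j

/-- The k-means cost of the assignment `α` to the centers `c`. -/
noncomputable def cost {n k d : ℕ} (x : Fin n → EuclideanSpace ℝ (Fin d)) (α : Fin n → Fin k)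
    (c : Fin k → EuclideanSpace ℝ (Fin d)) : ℝ :=
  ∑ p, dist (x p) (c (α p)) ^ 2

/-- The color constrained cost of the centers `c`: the minimum of the costs of all assignments that
satisfy the constraint. -/
noncomputable def colorCost {n k l d : ℕ} (x : Fin n → EuclideanSpace ℝ (Fin d))
    (f : Fin n → Fin l) (𝒦 : Set (Matrix (Fin k) (Fin l) ℕ))
    (c : Fin k → EuclideanSpace ℝ (Fin d)) : ℝ :=
  ⨅ α : {α : Fin n → Fin k // Satisfies f 𝒦 α}, cost x α.1 c

/-- An assignment of weighted points, a point of weight `w p` being `w p` points of weight one that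
may go to different clusters: `A p i` is the number of copies of `p` assigned to cluster `i`. -/
def WSatisfies {m k l : ℕ} (w : Fin m → ℕ) (f : Fin m → Fin l)
    (𝒦 : Set (Matrix (Fin k) (Fin l) ℕ)) (A : Fin m → Fin k → ℕ) : Prop :=
  (∀ p, ∑ i, A p i = w p) ∧ ∃ K ∈ 𝒦, ∀ i j, ∑ p with f p = j, A p i = K i j

noncomputable def wcost {m k d : ℕ} (x : Fin m → EuclideanSpace ℝ (Fin d)) (A : Fin m → Fin k → ℕ)
    (c : Fin k → EuclideanSpace ℝ (Fin d)) : ℝ :=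
  ∑ p, ∑ i, (A p i : ℝ) * dist (x p) (c i) ^ 2

def IsOptimalAssignment {m k l d : ℕ} (x : Fin m → EuclideanSpace ℝ (Fin d)) (w : Fin m → ℕ)
    (f : Fin m → Fin l) (𝒦 : Set (Matrix (Fin k) (Fin l) ℕ))
    (c : Fin k → EuclideanSpace ℝ (Fin d)) (A : Fin m → Fin k → ℕ) : Prop :=
  WSatisfies w f 𝒦 A ∧ ∀ A', WSatisfies w f 𝒦 A' → wcost x A c ≤ wcost x A' c

/-- The memory `s` holds exactly a weighted colored point set with `k` centers: `m`, `k`, `l`, the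
`m` colors and the `m` weights in the integer cells; the coordinates of the points and then those of
the centers in the real cells; `0` everywhere else. -/
structure Encodes {m k l d : ℕ} (s : State) (x : Fin m → EuclideanSpace ℝ (Fin d)) (w : Fin m → ℕ)
    (f : Fin m → Fin l) (c : Fin k → EuclideanSpace ℝ (Fin d)) : Prop where
  num : s.int 0 = m
  clusters : s.int 1 = k
  colors : s.int 2 = l
  color : ∀ p : Fin m, s.int (3 + p) = f p
  weight : ∀ p : Fin m, s.int (3 + m + p) = w p
  rest : ∀ a, 3 + 2 * m ≤ a → s.int a = 0
  point : ∀ (p : Fin m) (j : Fin d), s.real (p * d + j) = x p j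
  center : ∀ (i : Fin k) (j : Fin d), s.real ((m + i) * d + j) = c i j
  restReal : ∀ a, (m + k) * d ≤ a → s.real a = 0

/-- The size of an assignment problem: numbers of coordinates, points, clusters and colors, and the
bit length of the total weight. -/
def inputSize (d k l : ℕ) {m : ℕ} (w : Fin m → ℕ) : ℕ :=
  d + m + k + l + Nat.size (∑ p, w p)

/-- The program `A` is an optimal assignment algorithm for the constraint `𝒦` that is polynomial with
exponent `e`: for all positively weighted colored point sets for which `𝒦` is a color constraint and
all `k` centers, it computes an optimal assignment (one integer for each point and cluster), and its
running time, its number of cells and its word length are polynomial. -/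
def IsEfficientAssignment (d : ℕ) {k l : ℕ} (e : ℕ) (𝒦 : Set (Matrix (Fin k) (Fin l) ℕ))
    (A : Program) : Prop :=
  ∀ (m : ℕ) (x : Fin m → EuclideanSpace ℝ (Fin d)) (w : Fin m → ℕ) (f : Fin m → Fin l)
    (c : Fin k → EuclideanSpace ℝ (Fin d)) (s : State),
    (∀ p, 0 < w p) → IsColorConstraint w f 𝒦 → Encodes s x w f c →
    ∃ (t : ℕ) (s' : State),
      ExecPlain (inputSize d k l w ^ e) ((inputSize d k l w + ∑ p, w p) ^ e) A s t s' ∧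
      t ≤ inputSize d k l w ^ e ∧
      IsOptimalAssignment x w f 𝒦 c (fun p i => s'.int (s'.int 0 + (p * k + i)))

/-- The memory before the stream starts: `k` and `l` in the integer cells `0` and `1`, and `ε` in the
real cell `0`. -/
noncomputable def initialState (k l : ℕ) (ε : ℝ) : State where
  int := fun a => if a = 0 then k else if a = 1 then l else 0
  real := fun a => if a = 0 then ε else 0

/-- The stream of colored points (colors are numbered from `0`). -/
def stream {n l d : ℕ} (x : Fin n → EuclideanSpace ℝ (Fin d)) (f : Fin n → Fin l) :
    List (EuclideanSpace ℝ (Fin d) × ℕ) :=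
  List.ofFn fun p => (x p, (f p : ℕ))

/-- The `k` centers that a program has computed: integer cell `0` holds the base address of the
block of real cells with their coordinates. -/
noncomputable def outputCenters (d k : ℕ) (s : State) : Fin k → EuclideanSpace ℝ (Fin d) :=
  fun i => WithLp.toLp 2 fun j => s.real (s.int 0 + (i * d + j))

/-- The base `l k ε⁻ᵈ log (n + 3)` of the bounds; `n + 3` keeps it above `1` for all `n`. -/
noncomputable def base (d k l n : ℕ) (ε : ℝ) : ℝ :=
  (l : ℝ) * k * (ε⁻¹) ^ d * Real.log ((n : ℝ) + 3)

end ColorKMeans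

open RealRAM ColorKMeans

/-!
The streaming algorithm keeps few weighted representatives of the points, and searches for the centers
among the means of few representatives after the pass.

*The summary.*  The stream is divided into epochs of `1, 2, 4, …` points, so that the number of points
need not be known in advance and the number of epochs is logarithmic.  In each epoch the points are
summarized separately, at a threshold `T` that only grows: two representatives of the same color may be
joined if their total weight times their squared distance is at most `T`.  The cost of joining is
charged to the growth of the logarithm of the weight (`Rep.Sound.absorb`), so the points move by a
multiple of `T` only.  Whenever there are more than `capReal` representatives, `T` is raised, to at
least twice its value and to at least the smallest value of a pair, and all of them are inserted anew.
Representatives no two of which may be joined can be close to `k` centers only if they are few, by a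
packing argument with one grid for each order of magnitude of the weights (`card_le_of_separated`).
Hence at a raise every choice of `k` centers is expensive compared with `T` (`Raised.cost_le`), and at
all times the movement is at most `ε² / 144` times the cost of every solution
(`Summary.totalMovement_le`).  This error is small for all assignments at once, and points are joined
with points of their color only, so the constraint `𝒦` plays no role up to here, and feasible
assignments of the points and of the representatives correspond (`Satisfies.induced`,
`WSatisfies.exists_induced`).

*The search.* In every nonempty weighted point set some `q` points, possibly with repetitions, have
a mean that is a center as good as the centroid up to the factor `1 + 1 / q` (`exists_seqMean_le`).
For an optimal assignment, such means exist for all of the clusters. With `q = ⌈8 / ε⌉` it suffices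
to try all families of `k` means of `q` representatives, to let the subroutine compute the best
assignment for each of them, and to keep the best one (`colorCost_le_of_best`). For `m`
representatives these are `m ^ (k * q)` calls, and this is where the exponent of order `k / ε` comes
from.

*The machine.*  `Runs` states that a program stops within a number of steps in a memory with a given
property; the programs are verified with one rule for each construct and invariants for the loops
(`streamRun_update`, `finishProg_runs`).  All bounds are polynomials in one number, `magnitude`, that is
at most a power of the base (`magnitude_le`).
-/


/-! ### Runs of programs with a bound on the number of steps -/

namespace RealRAM

/-- Larger limits on addresses and integers, and a subroutine with more runs, keep every run. -/
theorem Exec.mono {sub sub' : State → ℕ → State → Prop} {M W M' W' : ℕ} (hM : M ≤ M') (hW : W ≤ W')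
    (hsub : ∀ s t s', sub s t s' → sub' s t s') {P : Program} {s s' : State} {t : ℕ}
    (h : Exec sub M W P s t s') : Exec sub' M' W' P s t s' := by
  induction h with
  | skip s => exact .skip s
  | setInt a e s ha he => exact .setInt a e s (ha.trans_le hM) (he.trans hW)
  | setReal a e s ha => exact .setReal a e s (ha.trans_le hM)
  | seq _ _ ih₁ ih₂ => exact .seq ih₁ ih₂
  | ite_true hb _ ih => exact .ite_true hb ih
  | ite_false hb _ ih => exact .ite_false hb ih
  | while_false hb => exact .while_false hb
  | while_true hb _ _ ih₁ ih₂ => exact .while_true hb ih₁ ih₂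
  | call hp hq ho h hw =>
    exact .call (hp.trans hM) (hq.trans hM) (ho.trans hM) (hsub _ _ _ h)
      fun x hx => (hw x hx).trans hW

/-- Started in `s`, the program `P` stops after at most `t` steps, in a memory with property `Q`. -/
def Runs (sub : State → ℕ → State → Prop) (M W : ℕ) (P : Program) (s : State) (t : ℕ)
    (Q : State → Prop) : Prop :=
  ∃ t' s', Exec sub M W P s t' s' ∧ t' ≤ t ∧ Q s'

variable {sub : State → ℕ → State → Prop} {M W : ℕ} {P P' : Program} {s : State} {t t₁ t₂ : ℕ}
  {Q Q' : State → Prop} {b : Test}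

theorem Runs.mono (h : Runs sub M W P s t₁ Q) (ht : t₁ ≤ t) (hQ : ∀ s', Q s' → Q' s') :
    Runs sub M W P s t Q' := by
  obtain ⟨t', s', h, h', h''⟩ := h
  exact ⟨t', s', h, h'.trans ht, hQ _ h''⟩

theorem Runs.skip (h : Q s) : Runs sub M W .skip s 1 Q := ⟨_, _, .skip s, le_rfl, h⟩

theorem Runs.setInt {a e : IntExp} (ha : a.eval s < M) (he : e.eval s ≤ W)
    (h : Q (s.setInt (a.eval s) (e.eval s))) : Runs sub M W (.setInt a e) s 1 Q :=
  ⟨_, _, .setInt a e s ha he, le_rfl, h⟩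

theorem Runs.setReal {a : IntExp} {e : RealExp} (ha : a.eval s < M)
    (h : Q (s.setReal (a.eval s) (e.eval s))) : Runs sub M W (.setReal a e) s 1 Q :=
  ⟨_, _, .setReal a e s ha, le_rfl, h⟩

theorem Runs.seq (h : Runs sub M W P s t₁ fun s' => Runs sub M W P' s' t₂ Q) :
    Runs sub M W (.seq P P') s (t₁ + t₂) Q := by
  obtain ⟨t, s', h, h', t', s'', g, g', hQ⟩ := h
  exact ⟨_, _, .seq h g, by omega, hQ⟩

theorem Runs.ite (h₁ : b.Holds s → Runs sub M W P s t₁ Q)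
    (h₂ : ¬ b.Holds s → Runs sub M W P' s t₂ Q) :
    Runs sub M W (.ite b P P') s (max t₁ t₂ + 1) Q := by
  by_cases hb : b.Holds s
  · obtain ⟨t, s', h, h', hQ⟩ := h₁ hb
    exact ⟨_, _, .ite_true hb h, by omega, hQ⟩
  · obtain ⟨t, s', h, h', hQ⟩ := h₂ hb
    exact ⟨_, _, .ite_false hb h, by omega, hQ⟩

/-- The rule for loops whose invariant `I n` tells that at most `n` iterations are left. -/
theorem Runs.while_index {I : ℕ → State → Prop} {n t : ℕ}
    (h : ∀ n s, I n s → b.Holds s → Runs sub M W P s t fun s' => ∃ n' < n, I n' s') (hs : I n s) :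
    Runs sub M W (.while b P) s (n * (t + 1) + 1) fun s' => ∃ n', I n' s' ∧ ¬ b.Holds s' := by
  induction n using Nat.strong_induction_on generalizing s with
  | _ n ih =>
    by_cases hb : b.Holds s
    · obtain ⟨t₁, s₁, h₁, ht₁, n', hn', hI⟩ := h n s hs hb
      obtain ⟨t₂, s₂, h₂, ht₂, hQ⟩ := ih n' hn' hI
      refine ⟨_, _, .while_true hb h₁ h₂, ?_, hQ⟩
      have : (n' + 1) * (t + 1) ≤ n * (t + 1) := Nat.mul_le_mul_right _ hn'
      rw [add_mul] at this
      omega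
    · exact ⟨_, _, .while_false hb, by omega, n, hs, hb⟩

/-- The rule for loops with an invariant `I` and a variant `v`. -/
theorem Runs.while {I : State → Prop} {v : State → ℕ} {t : ℕ}
    (h : ∀ s, I s → b.Holds s → Runs sub M W P s t fun s' => I s' ∧ v s' < v s) (hs : I s) :
    Runs sub M W (.while b P) s (v s * (t + 1) + 1) fun s' => I s' ∧ ¬ b.Holds s' := by
  refine (Runs.while_index (I := fun n s => I s ∧ v s = n) ?_ ⟨hs, rfl⟩).mono le_rfl ?_
  · rintro n s ⟨hI, rfl⟩ hb
    exact (h s hI hb).mono le_rfl fun s' h' => ⟨_, h'.2, h'.1, rfl⟩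
  · rintro s' ⟨_, ⟨h₁, -⟩, h₂⟩
    exact ⟨h₁, h₂⟩

/-- The content of the integer cell with the fixed address `a`. -/
abbrev IntExp.var (a : ℕ) : IntExp := .get (.lit a)

/-- The content of the real cell with the fixed address `a`. -/
abbrev RealExp.var (a : ℕ) : RealExp := .get (.lit a)

/-- The test `a < b`. -/
abbrev Test.intLt (a b : IntExp) : Test := .not (.intLe b a)

/-- The test `a = b`. -/
abbrev Test.intEq (a b : IntExp) : Test := .and (.intLe a b) (.intLe b a)

/-- The disjunction of two tests. -/
abbrev Test.or (b c : Test) : Test := .not (.and (.not b) (.not c))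

/-- Adds one to the integer cell with the fixed address `a`. -/
abbrev Program.incr (a : ℕ) : Program := .setInt (.lit a) (.add (.var a) (.lit 1))

/-- Executes `P` with the integer cell `c` running from its present content up to `hi`, exclusively. -/
def Program.count (c : ℕ) (hi : IntExp) (P : Program) : Program :=
  .while (.intLt (.var c) hi) (.seq P (.incr c))

/-- The rule for counting loops.  The invariant `I i` holds whenever the counter has the value `i`. -/
theorem Runs.count {c : ℕ} {hi : IntExp} {n i₀ : ℕ} {I : ℕ → State → Prop} (hc : c < M) (hn : n ≤ W)
    (hhi : ∀ i s, I i s → hi.eval s = n) (hi₀ : s.int c = i₀) (hle : i₀ ≤ n) (hs : I i₀ s)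
    (h : ∀ i s, i₀ ≤ i → i < n → s.int c = i → I i s →
      Runs sub M W P s t fun s' => s'.int c = i ∧ I (i + 1) (s'.setInt c (i + 1))) :
    Runs sub M W (.count c hi P) s ((n - i₀) * (t + 2) + 1) fun s' => s'.int c = n ∧ I n s' := by
  have key := Runs.while (sub := sub) (M := M) (W := W) (b := .intLt (.var c) hi)
    (P := .seq P (.incr c)) (s := s) (t := t + 1)
    (I := fun s => i₀ ≤ s.int c ∧ s.int c ≤ n ∧ I (s.int c) s) (v := fun s => n - s.int c) ?_
    ⟨hi₀.ge, hi₀ ▸ hle, hi₀ ▸ hs⟩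
  · refine key.mono (by simp [hi₀]) ?_
    rintro s' ⟨⟨-, h₂, h₃⟩, h₄⟩
    have := hhi _ _ h₃
    simp only [Test.Holds, not_not, IntExp.eval, this] at h₄
    obtain rfl : s'.int c = n := by omega
    exact ⟨rfl, h₃⟩
  · rintro s₁ ⟨h₁, h₂, h₃⟩ hb
    have := hhi _ _ h₃
    simp only [Test.Holds, IntExp.eval, this, not_le] at hb
    refine Runs.seq ((h _ s₁ h₁ hb rfl h₃).mono le_rfl ?_)
    rintro s₂ ⟨h₄, h₅⟩
    refine Runs.setInt (by simpa [IntExp.eval] using hc) (by simp [IntExp.eval, h₄]; omega) ?_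
    have e : (s₂.setInt c (s₁.int c + 1)).int c = s₁.int c + 1 := by simp [State.setInt]
    simp only [IntExp.eval, h₄, e]
    exact ⟨⟨by omega, by omega, h₅⟩, by omega⟩

theorem State.setInt_int (s : State) (a v x : ℕ) :
    (s.setInt a v).int x = if x = a then v else s.int x := by
  simp [State.setInt, Function.update_apply]

@[simp] theorem State.setInt_real (s : State) (a v : ℕ) : (s.setInt a v).real = s.real := rfl

theorem State.setReal_real (s : State) (a x : ℕ) (v : ℝ) :
    (s.setReal a v).real x = if x = a then v else s.real x := by
  simp [State.setReal, Function.update_apply]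

@[simp] theorem State.setReal_int (s : State) (a : ℕ) (v : ℝ) : (s.setReal a v).int = s.int := rfl

@[simp] theorem State.setInt_int_eq (s : State) {a x : ℕ} (v : ℕ) (h : x = a) :
    (s.setInt a v).int x = v := by rw [State.setInt_int, if_pos h]

@[simp] theorem State.setInt_int_ne (s : State) {a x : ℕ} (v : ℕ) (h : x ≠ a) :
    (s.setInt a v).int x = s.int x := by rw [State.setInt_int, if_neg h]

@[simp] theorem State.setReal_real_eq (s : State) {a x : ℕ} (v : ℝ) (h : x = a) :
    (s.setReal a v).real x = v := by rw [State.setReal_real, if_pos h]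

@[simp] theorem State.setReal_real_ne (s : State) {a x : ℕ} (v : ℝ) (h : x ≠ a) :
    (s.setReal a v).real x = s.real x := by rw [State.setReal_real, if_neg h]

attribute [simp] IntExp.eval RealExp.eval Test.Holds

/-! ### Points in the memory -/

/-- The point whose coordinates are in the real cells with addresses `a, …, a + d - 1`. -/
noncomputable def State.vec (d : ℕ) (s : State) (a : ℕ) : EuclideanSpace ℝ (Fin d) :=
  WithLp.toLp 2 fun j => s.real (a + j)

@[simp] theorem State.vec_apply {d : ℕ} (s : State) (a : ℕ) (j : Fin d) :
    s.vec d a j = s.real (a + j) := rfl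

theorem State.vec_congr {d : ℕ} {s s' : State} {a a' : ℕ}
    (h : ∀ j < d, s.real (a + j) = s'.real (a' + j)) : s.vec d a = s'.vec d a' := by
  ext j; exact h j j.2

@[simp] theorem State.vec_setInt {d : ℕ} (s : State) (a v x : ℕ) :
    (s.setInt a v).vec d x = s.vec d x := rfl

/-- The sum of the first `n` squared differences of the coordinates of two points. -/
def sqSumExp (a b : IntExp) : ℕ → RealExp
  | 0 => .ofInt (.lit 0)
  | n + 1 => .add (sqSumExp a b n)
      (.mul (.sub (.get (.add a (.lit n))) (.get (.add b (.lit n))))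
        (.sub (.get (.add a (.lit n))) (.get (.add b (.lit n)))))

theorem sqSumExp_eval (s : State) (a b : IntExp) (n : ℕ) :
    (sqSumExp a b n).eval s =
      ∑ j ∈ Finset.range n, (s.real (a.eval s + j) - s.real (b.eval s + j)) ^ 2 := by
  induction n with
  | zero => simp [sqSumExp, RealExp.eval, IntExp.eval]
  | succ n ih => simp [sqSumExp, RealExp.eval, IntExp.eval, ih, Finset.sum_range_succ]; ring

/-- The squared distance of the points at the addresses `a` and `b`. -/
def sqDistExp (d : ℕ) (a b : IntExp) : RealExp := sqSumExp a b d

@[simp] theorem sqDistExp_eval (d : ℕ) (s : State) (a b : IntExp) :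
    (sqDistExp d a b).eval s = dist (s.vec d (a.eval s)) (s.vec d (b.eval s)) ^ 2 := by
  rw [sqDistExp, sqSumExp_eval, EuclideanSpace.dist_eq, Real.sq_sqrt (by positivity)]
  simp [Real.dist_eq, sq_abs, Finset.sum_range]

/-- The power `x ^ n` with a fixed exponent. -/
def powExp (x : RealExp) : ℕ → RealExp
  | 0 => .ofInt (.lit 1)
  | n + 1 => .mul (powExp x n) x

@[simp] theorem powExp_eval (s : State) (x : RealExp) (n : ℕ) :
    (powExp x n).eval s = x.eval s ^ n := by
  induction n with
  | zero => simp [powExp, RealExp.eval, IntExp.eval]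
  | succ n ih => simp [powExp, RealExp.eval, ih, pow_succ]

/-- Writes the values of `e 0, …, e (n - 1)` into the real cells from address `a` on. -/
def writeVec (a : IntExp) (e : ℕ → RealExp) : ℕ → Program
  | 0 => .skip
  | n + 1 => .seq (writeVec a e n) (.setReal (.add a (.lit n)) (e n))

/-- The expressions `e` may read the cells that are written, but not after they are written. -/
theorem Runs.writeVec {a : IntExp} {e : ℕ → RealExp} {n : ℕ} {v : ℕ → ℝ}
    {A : ℕ} (hM : A + n ≤ M)
    (ha : ∀ s' : State, s'.int = s.int → a.eval s' = A)
    (he : ∀ j < n, ∀ s' : State, s'.int = s.int →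
      (∀ x, (x < A ∨ A + j ≤ x) → s'.real x = s.real x) → (e j).eval s' = v j)
    (h : ∀ s' : State, s'.int = s.int → (∀ j < n, s'.real (A + j) = v j) →
      (∀ x, (x < A ∨ A + n ≤ x) → s'.real x = s.real x) → Q s') :
    Runs sub M W (writeVec a e n) s (n + 1) Q := by
  induction n generalizing Q with
  | zero => exact Runs.skip (h s rfl (by simp) (by simp))
  | succ n ih =>
    rw [RealRAM.writeVec]
    refine Runs.seq (ih (by omega) (fun j hj => he j (by omega)) ?_)
    intro s' h₁ h₂ h₃
    have e₁ := ha s' h₁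
    have e₂ := he n (by omega) s' h₁ h₃
    refine Runs.setReal (by simp [IntExp.eval, e₁]; omega) (h _ h₁ ?_ ?_)
    · intro j hj
      simp only [State.setReal_real, IntExp.eval, e₁, e₂]
      split_ifs with hjn
      · rw [show j = n by omega]
      · exact h₂ j (by omega)
    · intro x hx
      simp only [State.setReal_real, IntExp.eval, e₁]
      rw [if_neg (by omega)]
      exact h₃ x (by omega)

end RealRAM

namespace ColorKMeans

/-! ### Representatives of the points of a stream -/

/-- A representative of some points of the stream: its position, its color and the points `mem` it
stands for.  `slack` is a bookkeeping quantity of the analysis that the program does not store: how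
far the points in `mem` had been moved before the threshold was last changed. -/
structure Rep (ι : Type) (d : ℕ) where
  pos : EuclideanSpace ℝ (Fin d)
  color : ℕ
  mem : List ι
  slack : ℝ

namespace Rep

variable {ι : Type} {d : ℕ}

/-- The number of points that are represented. -/
def weight (g : Rep ι d) : ℕ := g.mem.length

/-- What it costs to join two representatives, up to a factor: the total weight times the squared
distance. -/
noncomputable def value (g h : Rep ι d) : ℝ :=
  ((g.weight + h.weight : ℕ) : ℝ) * dist g.pos h.pos ^ 2

/-- At the threshold `T`, the representatives may be joined. -/
def Mergeable (T : ℝ) (g h : Rep ι d) : Prop := g.color = h.color ∧ g.value h ≤ T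

/-- `g` takes over the points of `h` and keeps its position. -/
noncomputable def absorb (g h : Rep ι d) : Rep ι d :=
  { g with mem := g.mem ++ h.mem, slack := g.slack + h.slack }

/-- The sum of the squared distances by which the points were moved to their representative. -/
noncomputable def movement (x : ι → EuclideanSpace ℝ (Fin d)) (g : Rep ι d) : ℝ :=
  (g.mem.map fun p => dist (x p) g.pos ^ 2).sum

/-- The bookkeeping begins anew: all the movement up to now counts as slack. -/
noncomputable def resetSlack (x : ι → EuclideanSpace ℝ (Fin d)) (g : Rep ι d) : Rep ι d :=
  { g with slack := g.movement x }

/-- A point that represents itself. -/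
noncomputable def single (x : ι → EuclideanSpace ℝ (Fin d)) (f : ι → ℕ) (p : ι) : Rep ι d :=
  ⟨x p, f p, [p], 0⟩

@[simp] theorem absorb_pos (g h : Rep ι d) : (g.absorb h).pos = g.pos := rfl
@[simp] theorem absorb_color (g h : Rep ι d) : (g.absorb h).color = g.color := rfl
@[simp] theorem absorb_mem (g h : Rep ι d) : (g.absorb h).mem = g.mem ++ h.mem := rfl
@[simp] theorem absorb_slack (g h : Rep ι d) : (g.absorb h).slack = g.slack + h.slack := rfl
@[simp] theorem absorb_weight (g h : Rep ι d) : (g.absorb h).weight = g.weight + h.weight := by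
  simp [weight]

theorem value_comm (g h : Rep ι d) : g.value h = h.value g := by
  rw [value, value, dist_comm, add_comm g.weight]

theorem Mergeable.symm {T : ℝ} {g h : Rep ι d} (H : Mergeable T g h) : Mergeable T h g :=
  ⟨H.1.symm, value_comm g h ▸ H.2⟩

theorem value_le_value_absorb (g h r : Rep ι d) : g.value h ≤ (g.absorb r).value h := by
  rw [value, value, absorb_pos, absorb_weight]
  gcongr; omega

theorem Mergeable.of_absorb {T : ℝ} {g h r : Rep ι d} (H : Mergeable T (g.absorb r) h) :
    Mergeable T g h := ⟨H.1, (value_le_value_absorb g h r).trans H.2⟩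

theorem movement_nonneg (x : ι → EuclideanSpace ℝ (Fin d)) (g : Rep ι d) : 0 ≤ g.movement x :=
  List.sum_nonneg (by simp only [List.mem_map]; rintro _ ⟨p, -, rfl⟩; positivity)

end Rep

open Classical in
/-- Inserts `g` into a list of representatives: the first one that may be joined with `g` absorbs it,
and if there is none, `g` is appended. -/
noncomputable def insertRep {ι : Type} {d : ℕ} (T : ℝ) : List (Rep ι d) → Rep ι d → List (Rep ι d)
  | [], g => [g]
  | s :: L, g => if s.Mergeable T g then s.absorb g :: L else s :: insertRep T L g

/-- All representatives in the list are inserted anew, at the threshold `T`. -/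
noncomputable def rebuild {ι : Type} {d : ℕ} (x : ι → EuclideanSpace ℝ (Fin d)) (T : ℝ)
    (L : List (Rep ι d)) : List (Rep ι d) :=
  (L.map (Rep.resetSlack x)).foldl (insertRep T) []

section Insert

variable {ι : Type} {d : ℕ} {T : ℝ} {L : List (Rep ι d)} {g r : Rep ι d}

theorem mem_insertRep (h : r ∈ insertRep T L g) :
    r ∈ L ∨ (∃ s ∈ L, s.Mergeable T g ∧ r = s.absorb g) ∨ r = g := by
  induction L with
  | nil => simp_all [insertRep]
  | cons s L ih =>
    rw [insertRep] at h
    split_ifs at h with hm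
    · rcases List.mem_cons.1 h with rfl | h
      · exact .inr (.inl ⟨s, by simp, hm, rfl⟩)
      · exact .inl (by simp [h])
    · rcases List.mem_cons.1 h with rfl | h
      · exact .inl (by simp)
      · rcases ih h with h | ⟨s', h, h'⟩ | h
        · exact .inl (by simp [h])
        · exact .inr (.inl ⟨s', by simp [h], h'⟩)
        · exact .inr (.inr h)

theorem length_insertRep_le : (insertRep T L g).length ≤ L.length + 1 := by
  induction L with
  | nil => simp [insertRep]
  | cons s L ih => rw [insertRep]; split_ifs <;> simp [ih]

theorem insertRep_eq_append (h : (insertRep T L g).length = L.length + 1) :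
    insertRep T L g = L ++ [g] := by
  induction L with
  | nil => simp [insertRep]
  | cons s L ih =>
    rw [insertRep] at h ⊢
    split_ifs at h ⊢ with hm
    · simp at h
    · simp only [List.length_cons, add_left_inj] at h
      simp [ih h]

theorem insertRep_eq_append_of_not (h : ∀ s ∈ L, ¬ s.Mergeable T g) :
    insertRep T L g = L ++ [g] := by
  induction L with
  | nil => simp [insertRep]
  | cons s L ih =>
    rw [insertRep, if_neg (h s (by simp)), ih fun s hs => h s (by simp [hs])]; rfl

theorem insertRep_eq_set {i : ℕ} (hi : i < L.length) (hm : L[i].Mergeable T g)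
    (h : ∀ (j : ℕ) (hj : j < i), ¬ L[j].Mergeable T g) :
    insertRep T L g = L.set i (L[i].absorb g) := by
  induction L generalizing i with
  | nil => simp at hi
  | cons s L ih =>
    cases i with
    | zero => rw [insertRep, if_pos (by simpa using hm)]; rfl
    | succ i =>
      have h0 := h 0 (by omega)
      rw [insertRep, if_neg (by simpa using h0)]
      simp only [List.set_cons_succ, List.getElem_cons_succ, List.cons.injEq, true_and]
      exact ih (by simpa using hi) (by simpa using hm)
        fun j hj => by simpa using h (j + 1) (by omega)

theorem insertRep_mem_perm :
    ((insertRep T L g).flatMap Rep.mem).Perm (L.flatMap Rep.mem ++ g.mem) := by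
  induction L with
  | nil => simp [insertRep]
  | cons s L ih =>
    rw [insertRep]
    split_ifs
    · simp only [List.flatMap_cons, Rep.absorb_mem, List.append_assoc]
      exact List.Perm.append_left _ List.perm_append_comm
    · simp only [List.flatMap_cons, List.append_assoc]
      exact List.Perm.append_left _ ih

theorem insertRep_slack :
    ((insertRep T L g).map Rep.slack).sum = (L.map Rep.slack).sum + g.slack := by
  induction L with
  | nil => simp [insertRep]
  | cons s L ih => rw [insertRep]; split_ifs <;> simp [ih] <;> ring

theorem insertRep_pairwise (h : L.Pairwise fun a b => ¬ a.Mergeable T b) :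
    (insertRep T L g).Pairwise fun a b => ¬ a.Mergeable T b := by
  induction L with
  | nil => simp [insertRep]
  | cons s L ih =>
    rw [List.pairwise_cons] at h
    rw [insertRep]
    split_ifs with hm
    · exact List.pairwise_cons.2 ⟨fun b hb H => h.1 b hb H.of_absorb, h.2⟩
    · refine List.pairwise_cons.2 ⟨fun b hb H => ?_, ih h.2⟩
      rcases mem_insertRep hb with hb | ⟨s', hs', -, rfl⟩ | rfl
      · exact h.1 b hb H
      · exact h.1 s' hs' H.symm.of_absorb.symm
      · exact hm H

theorem foldl_insertRep_length_le (I : List (Rep ι d)) :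
    (I.foldl (insertRep T) L).length ≤ L.length + I.length := by
  induction I generalizing L with
  | nil => simp
  | cons g I ih =>
    have := ih (L := insertRep T L g)
    have := length_insertRep_le (T := T) (L := L) (g := g)
    simp only [List.foldl_cons, List.length_cons]; omega

/-- If the list is as long as it can be, then nothing was joined. -/
theorem foldl_insertRep_eq_append {I : List (Rep ι d)}
    (h : (I.foldl (insertRep T) L).length = L.length + I.length) :
    I.foldl (insertRep T) L = L ++ I := by
  induction I generalizing L with
  | nil => simp
  | cons g I ih =>
    have h₁ := foldl_insertRep_length_le (T := T) (L := insertRep T L g) I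
    have h₂ := length_insertRep_le (T := T) (L := L) (g := g)
    simp only [List.foldl_cons, List.length_cons] at h ⊢
    rw [ih (by omega), insertRep_eq_append (by omega)]; simp

theorem foldl_insertRep_mem_perm (I : List (Rep ι d)) :
    ((I.foldl (insertRep T) L).flatMap Rep.mem).Perm (L.flatMap Rep.mem ++ I.flatMap Rep.mem) := by
  induction I generalizing L with
  | nil => simp
  | cons g I ih =>
    simp only [List.foldl_cons, List.flatMap_cons]
    refine ih.trans ?_
    rw [← List.append_assoc]
    exact List.Perm.append_right _ insertRep_mem_perm

theorem foldl_insertRep_slack (I : List (Rep ι d)) :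
    ((I.foldl (insertRep T) L).map Rep.slack).sum =
      (L.map Rep.slack).sum + (I.map Rep.slack).sum := by
  induction I generalizing L with
  | nil => simp
  | cons g I ih => simp [ih, insertRep_slack]; ring

theorem foldl_insertRep_pairwise (I : List (Rep ι d))
    (h : L.Pairwise fun a b => ¬ a.Mergeable T b) :
    (I.foldl (insertRep T) L).Pairwise fun a b => ¬ a.Mergeable T b := by
  induction I generalizing L with
  | nil => simpa
  | cons g I ih => exact ih (insertRep_pairwise h)

/-- A representative is sound at the threshold `T`: it stands for at least one point, for points of
its color only, and these were moved not much more than they had been when the threshold was set. -/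
structure Rep.Sound (x : ι → EuclideanSpace ℝ (Fin d)) (f : ι → ℕ) (T : ℝ) (g : Rep ι d) :
    Prop where
  ne_nil : g.mem ≠ []
  color : ∀ p ∈ g.mem, f p = g.color
  slack_nonneg : 0 ≤ g.slack
  movement_le : g.movement x ≤ 3 / 2 * g.slack + 3 * T * Real.log g.weight

/-- A sound representative that has not been touched since the threshold was set. -/
structure Rep.Fresh (x : ι → EuclideanSpace ℝ (Fin d)) (f : ι → ℕ) (g : Rep ι d) : Prop where
  ne_nil : g.mem ≠ []
  color : ∀ p ∈ g.mem, f p = g.color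
  movement_le : g.movement x ≤ g.slack

variable {x : ι → EuclideanSpace ℝ (Fin d)} {f : ι → ℕ}

theorem Rep.Sound.weight_pos (h : g.Sound x f T) : 0 < g.weight :=
  List.length_pos_iff.2 h.ne_nil

theorem Rep.Fresh.sound (hT : 0 ≤ T) (h : g.Fresh x f) : g.Sound x f T where
  ne_nil := h.ne_nil
  color := h.color
  slack_nonneg := (g.movement_nonneg x).trans h.movement_le
  movement_le := by
    have h₁ := (g.movement_nonneg x).trans h.movement_le
    have h₂ : 0 ≤ Real.log g.weight := Real.log_natCast_nonneg _
    have := mul_nonneg hT h₂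
    linarith [h.movement_le]

/-- A triangle inequality for squared distances: `(a + b)² ≤ (1 + τ) a² + (1 + 1/τ) b²`. -/
theorem dist_sq_le_mul (u v w : EuclideanSpace ℝ (Fin d)) {τ : ℝ} (hτ : 0 < τ) :
    dist u w ^ 2 ≤ (1 + τ) * dist u v ^ 2 + (1 + 1 / τ) * dist v w ^ 2 := by
  have h := dist_triangle u v w
  have h1 : dist u w ^ 2 ≤ (dist u v + dist v w) ^ 2 := by gcongr
  have h2 : 0 ≤ (τ * dist u v - dist v w) ^ 2 / τ := by positivity
  have h3 : (τ * dist u v - dist v w) ^ 2 / τ =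
    τ * dist u v ^ 2 - 2 * dist u v * dist v w + 1 / τ * dist v w ^ 2 := by
    have : τ * (1 / τ) = 1 := mul_one_div_cancel hτ.ne'
    rw [div_eq_iff hτ.ne']
    linear_combination (-dist v w ^ 2) * this
  nlinarith

/-- The cost of joining is charged to the growth of the logarithm of the weight: moving the points of
`g` costs about `w_g D² ≤ T w_g / (w_r + w_g)`, and `w_g / (w_r + w_g) ≤ log (w_r + w_g) - log w_r`. -/
theorem Rep.Sound.absorb (hT : 0 ≤ T) (hr : r.Sound x f T) (hg : g.Fresh x f)
    (hm : r.Mergeable T g) : (r.absorb g).Sound x f T where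
  ne_nil := by simp [hr.ne_nil]
  color := by
    intro p hp
    rcases List.mem_append.1 hp with hp | hp
    · exact hr.color p hp
    · exact (hg.color p hp).trans hm.1.symm
  slack_nonneg := add_nonneg hr.slack_nonneg ((g.movement_nonneg x).trans hg.movement_le)
  movement_le := by
    have e : (r.absorb g).movement x =
        r.movement x + (g.mem.map fun p => dist (x p) r.pos ^ 2).sum := by
      simp [Rep.movement]
    -- the points of `g` are moved from the position of `g` to the one of `r`
    have h₁ : (g.mem.map fun p => dist (x p) r.pos ^ 2).sum ≤
        3 / 2 * g.movement x + 3 * (g.weight * dist r.pos g.pos ^ 2) := by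
      have : ∀ M : List ι, (M.map fun p => dist (x p) r.pos ^ 2).sum ≤
          3 / 2 * (M.map fun p => dist (x p) g.pos ^ 2).sum +
            3 * (M.length * dist r.pos g.pos ^ 2) := by
        intro M
        induction M with
        | nil => simp
        | cons p M ih =>
          have := dist_sq_le_mul (x p) g.pos r.pos (τ := 1 / 2) (by norm_num)
          rw [dist_comm g.pos r.pos] at this
          simp only [List.map_cons, List.sum_cons, List.length_cons, Nat.cast_add, Nat.cast_one]
          nlinarith
      exact this g.mem
    have hw : (0 : ℝ) < r.weight := by exact_mod_cast hr.weight_pos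
    have hw' : (0 : ℝ) < g.weight := by
      exact_mod_cast List.length_pos_iff.2 hg.ne_nil
    have h₂ : (g.weight : ℝ) * dist r.pos g.pos ^ 2 ≤
        T * (Real.log (r.weight + g.weight) - Real.log r.weight) := by
      have h₃ := hm.2
      rw [Rep.value, Nat.cast_add] at h₃
      have h₄ : (g.weight : ℝ) / (r.weight + g.weight) ≤
          Real.log (r.weight + g.weight) - Real.log r.weight := by
        rw [← Real.log_div (by positivity) hw.ne']
        have := Real.one_sub_inv_le_log_of_pos
          (show 0 < ((r.weight : ℝ) + g.weight) / r.weight by positivity)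
        refine le_trans (le_of_eq ?_) this
        field_simp; ring
      calc (g.weight : ℝ) * dist r.pos g.pos ^ 2
          = (r.weight + g.weight) * dist r.pos g.pos ^ 2 *
              (g.weight / (r.weight + g.weight)) := by field_simp
        _ ≤ T * (Real.log (r.weight + g.weight) - Real.log r.weight) := by
            gcongr
    rw [e, Rep.absorb_slack, Rep.absorb_weight, Nat.cast_add]
    have := hr.movement_le
    have := hg.movement_le
    nlinarith

theorem insertRep_sound (hT : 0 ≤ T) (hL : ∀ s ∈ L, s.Sound x f T) (hg : g.Fresh x f) :
    ∀ s ∈ insertRep T L g, s.Sound x f T := by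
  intro s hs
  rcases mem_insertRep hs with hs | ⟨s', hs', hm, rfl⟩ | rfl
  · exact hL s hs
  · exact (hL s' hs').absorb hT hg hm
  · exact hg.sound hT

theorem foldl_insertRep_sound (hT : 0 ≤ T) (hL : ∀ s ∈ L, s.Sound x f T) {I : List (Rep ι d)}
    (hI : ∀ g ∈ I, g.Fresh x f) : ∀ s ∈ I.foldl (insertRep T) L, s.Sound x f T := by
  induction I generalizing L with
  | nil => simpa
  | cons g I ih =>
    exact ih (insertRep_sound hT hL (hI g (by simp))) fun g hg => hI g (by simp [hg])

theorem Rep.Sound.resetSlack (h : g.Sound x f T) : (g.resetSlack x).Fresh x f :=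
  ⟨h.ne_nil, h.color, le_rfl⟩

theorem Rep.single_fresh (x : ι → EuclideanSpace ℝ (Fin d)) (f : ι → ℕ) (p : ι) :
    (Rep.single x f p).Fresh x f := ⟨by simp [single], by simp [single], by simp [single, movement]⟩

end Insert

/-! ### The number of representatives that no two of which may be joined -/

open Classical in
/-- Among points of weights between `1` and `2 ^ j` that lie close to `k` centers, relative to their
weight, and of which no two of the same color have a small value, there are only few: points with the
same color, nearest center and order of magnitude of the weight lie in different cells of a grid. -/
theorem card_le_of_separated {ι : Type} {d k l j : ℕ} (hd : 1 ≤ d) (S : Finset ι)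
    (pos : ι → EuclideanSpace ℝ (Fin d)) (color : ι → ℕ) (w : ι → ℕ) (near : ι → Fin k)
    (c : Fin k → EuclideanSpace ℝ (Fin d)) {V Y : ℝ} (hV : 0 < V) (hY : 1 ≤ Y)
    (hcol : ∀ a ∈ S, color a < l) (hw : ∀ a ∈ S, 1 ≤ w a) (hwj : ∀ a ∈ S, w a ≤ 2 ^ j)
    (hsep : ∀ a ∈ S, ∀ b ∈ S, a ≠ b → color a = color b →
      V ≤ ((w a + w b : ℕ) : ℝ) * dist (pos a) (pos b) ^ 2)
    (hclose : ∀ a ∈ S, (w a : ℝ) * dist (pos a) (c (near a)) ^ 2 ≤ Y ^ 2 * V) :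
    (S.card : ℝ) ≤ l * k * (j + 1) * (6 * Y * d) ^ d := by
  have hd' : (0 : ℝ) < d := by exact_mod_cast hd
  have hd1 : (1 : ℝ) ≤ d := by exact_mod_cast hd
  -- the side length of the grid for points with weights in `[2 ^ i, 2 ^ (i + 1))`
  set h : ℕ → ℝ := fun i => √(V / 2 ^ (i + 2)) / d with hdef
  have hpos : ∀ i, 0 < h i := fun i => by positivity
  have hsq : ∀ i, h i ^ 2 = V / 2 ^ (i + 2) / d ^ 2 := fun i => by
    rw [hdef, div_pow, Real.sq_sqrt (by positivity)]
  set cell : ι → Fin d → ℤ := fun a m =>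
    ⌊(pos a m - c (near a) m) / h (Nat.log 2 (w a))⌋ with hcell
  -- the cell numbers that occur: close points are at most `2 * Y * d` side lengths from the center
  set B : Finset ℤ := Finset.Icc ⌊-(2 * Y * d)⌋ ⌊2 * Y * d⌋ with hB
  have hBcard : (B.card : ℝ) ≤ 6 * Y * d := by
    rw [hB, Int.card_Icc]
    have h₀ : (0 : ℝ) ≤ 2 * Y * d := by positivity
    have h₁ : 0 ≤ ⌊2 * Y * d⌋ := Int.floor_nonneg.2 h₀
    have h₂ : ⌊-(2 * Y * d)⌋ ≤ 0 := Int.floor_nonpos (by linarith)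
    have h₃ : ((⌊2 * Y * d⌋ + 1 - ⌊-(2 * Y * d)⌋).toNat : ℝ) =
        ⌊2 * Y * d⌋ + 1 - ⌊-(2 * Y * d)⌋ := by
      have : ((⌊2 * Y * d⌋ + 1 - ⌊-(2 * Y * d)⌋).toNat : ℤ) =
        ⌊2 * Y * d⌋ + 1 - ⌊-(2 * Y * d)⌋ := Int.toNat_of_nonneg (by omega)
      exact_mod_cast this
    rw [h₃]
    have h₄ := Int.floor_le (2 * Y * d)
    have h₅ := Int.lt_floor_add_one (-(2 * Y * d))
    nlinarith [mul_le_mul hY hd1 zero_le_one (by linarith)]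
  have hbound : S.card ≤ (Finset.range l ×ˢ (Finset.univ : Finset (Fin k)) ×ˢ
      Finset.range (j + 1) ×ˢ Fintype.piFinset fun _ : Fin d => B).card := by
    refine Finset.card_le_card_of_injOn
      (fun a => (color a, near a, Nat.log 2 (w a), cell a)) ?_ ?_
    · intro a ha
      have ha : a ∈ S := ha
      have hlog : 2 ^ Nat.log 2 (w a) ≤ w a := Nat.pow_log_le_self 2 (by have := hw a ha; omega)
      simp only [Finset.coe_product, Set.mem_prod, Finset.mem_coe, Finset.mem_range,
        Finset.mem_univ, true_and, Fintype.mem_piFinset]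
      refine ⟨hcol a ha, ?_, fun m => ?_⟩
      · have : Nat.log 2 (w a) ≤ Nat.log 2 (2 ^ j) := Nat.log_mono_right (hwj a ha)
        rw [Nat.log_pow (by norm_num)] at this
        omega
      · set i := Nat.log 2 (w a)
        have h₁ : dist (pos a) (c (near a)) ≤ 2 * Y * d * h i := by
          refine abs_le_of_sq_le_sq' ?_ (by have := hpos i; positivity) |>.2
          have h₂ : (2 : ℝ) ^ i ≤ w a := by exact_mod_cast hlog
          have h₃ : (2 : ℝ) ^ i * dist (pos a) (c (near a)) ^ 2 ≤ Y ^ 2 * V :=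
            le_trans (by gcongr) (hclose a ha)
          rw [mul_pow, hsq, pow_add]
          rw [← le_div_iff₀' (by positivity)] at h₃
          refine h₃.trans (le_of_eq ?_)
          field_simp
        have h₂ : |pos a m - c (near a) m| ≤ dist (pos a) (c (near a)) := by
          rw [EuclideanSpace.dist_eq]
          refine Real.le_sqrt_of_sq_le ?_
          rw [← Real.dist_eq]
          exact Finset.single_le_sum (f := fun m => dist (pos a m) (c (near a) m) ^ 2)
            (fun _ _ => by positivity) (Finset.mem_univ m)
        have h₃ := abs_le.1 (h₂.trans h₁)
        rw [hB, Finset.mem_Icc]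
        constructor
        · refine Int.floor_mono ?_
          rw [le_div_iff₀ (hpos i)]; linarith
        · refine Int.floor_mono ?_
          rw [div_le_iff₀ (hpos i)]; linarith
    · -- two points in the same cell, of weights below `2 ^ (i + 1)`, would have a value below `V`
      intro a ha b hb hab
      have ha : a ∈ S := ha
      have hb : b ∈ S := hb
      simp only [Prod.mk.injEq] at hab
      obtain ⟨h₁, h₂, h₃, h₄⟩ := hab
      by_contra hne
      have hs := hsep a ha b hb hne h₁
      set i := Nat.log 2 (w a) with hi
      have hwa : w a < 2 ^ (i + 1) := Nat.lt_pow_succ_log_self (by norm_num) _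
      have hwb : w b < 2 ^ (i + 1) := by
        rw [h₃]; exact Nat.lt_pow_succ_log_self (by norm_num) _
      have h₅ : dist (pos a) (pos b) ^ 2 < V / 2 ^ (i + 2) := by
        have h₆ : ∀ m : Fin d, dist (pos a m) (pos b m) ^ 2 < h i ^ 2 := by
          intro m
          have h₇ := congrFun h₄ m
          simp only [hcell, ← h₃, ← h₂] at h₇
          have h₈ := Int.abs_sub_lt_one_of_floor_eq_floor h₇
          rw [← sub_div, abs_div, abs_of_pos (hpos _), div_lt_one (hpos _)] at h₈
          rw [Real.dist_eq]
          have : |pos a m - pos b m| < h i := by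
            rwa [sub_sub_sub_cancel_right] at h₈
          gcongr
        rw [EuclideanSpace.dist_eq, Real.sq_sqrt (by positivity)]
        have : Nonempty (Fin d) := ⟨⟨0, hd⟩⟩
        calc ∑ m, dist (pos a m) (pos b m) ^ 2 < ∑ _m : Fin d, h i ^ 2 :=
              Finset.sum_lt_sum_of_nonempty Finset.univ_nonempty fun m _ => h₆ m
          _ = V / 2 ^ (i + 2) / d := by
              rw [Finset.sum_const, Finset.card_univ, Fintype.card_fin, nsmul_eq_mul, hsq]
              field_simp
          _ ≤ V / 2 ^ (i + 2) := div_le_self (by positivity) hd1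
      have h₆ : ((w a + w b : ℕ) : ℝ) ≤ 2 ^ (i + 2) := by
        have : w a + w b ≤ 2 ^ (i + 2) := by rw [pow_succ]; omega
        exact_mod_cast this
      have h₇ : ((w a + w b : ℕ) : ℝ) * dist (pos a) (pos b) ^ 2 < V := by
        calc _ ≤ 2 ^ (i + 2) * dist (pos a) (pos b) ^ 2 := by gcongr
          _ < 2 ^ (i + 2) * (V / 2 ^ (i + 2)) := by gcongr
          _ = V := by field_simp
      linarith
  have hcard : ((Finset.range l ×ˢ (Finset.univ : Finset (Fin k)) ×ˢ
      Finset.range (j + 1) ×ˢ Fintype.piFinset fun _ : Fin d => B).card : ℝ) =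
      l * k * (j + 1) * (B.card : ℝ) ^ d := by
    simp [Finset.card_product]; ring
  calc (S.card : ℝ) ≤ _ := Nat.cast_le.2 hbound
    _ = _ := hcard
    _ ≤ _ := by gcongr

end ColorKMeans

namespace ColorKMeans

/-! ### Summaries of a part of the stream -/

section Summary

variable {ι : Type} {d k : ℕ}

/-- The k-means cost of the points in a list, each with the center given by `α`. -/
noncomputable def ptCost (x : ι → EuclideanSpace ℝ (Fin d)) (c : Fin k → EuclideanSpace ℝ (Fin d))
    (α : ι → Fin k) (pts : List ι) : ℝ :=
  (pts.map fun p => dist (x p) (c (α p)) ^ 2).sum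

theorem ptCost_nonneg (x : ι → EuclideanSpace ℝ (Fin d)) (c : Fin k → EuclideanSpace ℝ (Fin d))
    (α : ι → Fin k) (pts : List ι) : 0 ≤ ptCost x c α pts :=
  List.sum_nonneg (by simp only [List.mem_map]; rintro _ ⟨p, -, rfl⟩; positivity)

theorem ptCost_perm {x : ι → EuclideanSpace ℝ (Fin d)} {c : Fin k → EuclideanSpace ℝ (Fin d)}
    {α : ι → Fin k} {A B : List ι} (h : A.Perm B) : ptCost x c α A = ptCost x c α B :=
  (h.map _).sum_eq

theorem ptCost_append {x : ι → EuclideanSpace ℝ (Fin d)} {c : Fin k → EuclideanSpace ℝ (Fin d)}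
    {α : ι → Fin k} (A B : List ι) :
    ptCost x c α (A ++ B) = ptCost x c α A + ptCost x c α B := by simp [ptCost]

theorem ptCost_flatMap {x : ι → EuclideanSpace ℝ (Fin d)} {c : Fin k → EuclideanSpace ℝ (Fin d)}
    {α : ι → Fin k} (L : List (Rep ι d)) :
    ptCost x c α (L.flatMap Rep.mem) = (L.map fun s => ptCost x c α s.mem).sum := by
  induction L with
  | nil => simp [ptCost]
  | cons s L ih => simp [ptCost_append, ih]

/-- The sum of the squared distances by which all the points were moved. -/
noncomputable def totalMovement (x : ι → EuclideanSpace ℝ (Fin d)) (L : List (Rep ι d)) : ℝ :=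
  (L.map (Rep.movement x)).sum

theorem sum_weight_eq {L : List (Rep ι d)} {pts : List ι} (h : (L.flatMap Rep.mem).Perm pts) :
    (L.map Rep.weight).sum = pts.length := by
  rw [← h.length_eq, List.length_flatMap]; rfl

theorem weight_le_length {L : List (Rep ι d)} {pts : List ι} (h : (L.flatMap Rep.mem).Perm pts)
    {s : Rep ι d} (hs : s ∈ L) : s.weight ≤ pts.length := by
  rw [← sum_weight_eq h]
  exact List.le_sum_of_mem (List.mem_map_of_mem hs)

/-- The logarithm of a weight is at most `j + 1`, since there are at most `2 ^ j` points. -/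
theorem totalMovement_le {x : ι → EuclideanSpace ℝ (Fin d)} {f : ι → ℕ} {T : ℝ} {j : ℕ}
    {L : List (Rep ι d)} (hT : 0 ≤ T) (hL : ∀ s ∈ L, s.Sound x f T)
    (hw : ∀ s ∈ L, s.weight ≤ 2 ^ j) :
    totalMovement x L ≤ 3 / 2 * (L.map Rep.slack).sum + 3 * T * (j + 1) * L.length := by
  induction L with
  | nil => simp [totalMovement]
  | cons s L ih =>
    have h₁ := ih (fun s hs => hL s (by simp [hs])) fun s hs => hw s (by simp [hs])
    have h₂ := (hL s (by simp)).movement_le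
    have h₃ : Real.log s.weight ≤ j + 1 := by
      have hpos : (0 : ℝ) < s.weight := by exact_mod_cast (hL s (by simp)).weight_pos
      have : (s.weight : ℝ) ≤ 2 ^ j := by exact_mod_cast hw s (by simp)
      calc Real.log s.weight ≤ Real.log (2 ^ j) := Real.log_le_log hpos this
        _ = j * Real.log 2 := Real.log_pow _ _
        _ ≤ j * 1 := by
            gcongr
            linarith [Real.log_two_lt_d9]
        _ ≤ j + 1 := by linarith
    have h₄ := mul_le_mul_of_nonneg_left h₃ hT
    simp only [totalMovement, List.map_cons, List.sum_cons, List.length_cons, Nat.cast_add,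
      Nat.cast_one] at h₁ ⊢
    linarith

/-- The number `κ` bounds the representatives that are kept of at most `2 ^ j` points, such that they
may move by `δ` times the cost.  The number `Y` enters the proof only: a representative counts as
close to a center if its weight times the squared distance is at most `Y ^ 2` times the threshold.
By `le_cap`, at most half of `κ` separated representatives are close to the centers, and by `le_sq`
the other half makes the cost so large that `δ` times the cost exceeds the possible movement. -/
structure Capacity (d k l j : ℕ) (δ Y κ : ℝ) : Prop where
  d_pos : 1 ≤ d
  k_pos : 1 ≤ k
  l_pos : 1 ≤ l
  δ_pos : 0 < δ
  δ_le : δ ≤ 1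
  one_le : 1 ≤ Y
  le_sq : 288 * ((j : ℝ) + 1) ≤ δ * Y ^ 2
  le_cap : 2 * (l * k * (j + 1) * (6 * Y * d) ^ d) ≤ κ

theorem Capacity.two_mul_le {l j : ℕ} {δ Y κ : ℝ} (h : Capacity d k l j δ Y κ) : 2 * (l : ℝ) ≤ κ := by
  have hk : (1 : ℝ) ≤ k := by exact_mod_cast h.k_pos
  have hl : (1 : ℝ) ≤ l := by exact_mod_cast h.l_pos
  have hd : (1 : ℝ) ≤ d := by exact_mod_cast h.d_pos
  have hY := h.one_le
  have h₁ : (1 : ℝ) ≤ 6 * Y * d := by nlinarith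
  have h₂ : (1 : ℝ) ≤ (6 * Y * d) ^ d := one_le_pow₀ h₁
  have hj : (0 : ℝ) ≤ j := Nat.cast_nonneg j
  have h₃ : (1 : ℝ) ≤ k * (j + 1) * (6 * Y * d) ^ d :=
    one_le_mul_of_one_le_of_one_le (one_le_mul_of_one_le_of_one_le hk (by linarith)) h₂
  refine le_trans ?_ h.le_cap
  rw [mul_assoc, mul_assoc]
  rw [mul_assoc] at h₃
  nlinarith

/-- `T'` is at least twice `T`, and also at least the smallest value of two representatives of the
same color if there are two. -/
def Raised (T : ℝ) (L : List (Rep ι d)) (T' : ℝ) : Prop :=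
  ∃ V, T' = max (2 * T) V ∧ L.Pairwise (fun a b => a.color = b.color → V ≤ a.value b) ∧
    (¬ L.Pairwise (fun a b => a.color ≠ b.color) →
      ¬ L.Pairwise (fun a b => a.color = b.color → V < a.value b))

theorem exists_same_color {l : ℕ} {L : List (Rep ι d)} (hcol : ∀ s ∈ L, s.color < l)
    (hlen : l < L.length) : ¬ L.Pairwise (fun a b => a.color ≠ b.color) := by
  intro h
  have h₁ : (L.map Rep.color).Nodup := List.pairwise_map.2 h
  have h₂ := h₁.length_le_of_subset (l₂ := List.range l) fun c hc => by
    obtain ⟨s, hs, rfl⟩ := List.mem_map.1 hc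
    exact List.mem_range.2 (hcol s hs)
  simp at h₂; omega

open Classical in
/-- When there are too many representatives no two of which may be joined, then every solution is
expensive: few of them are close to the centers, and the others contribute to the cost. -/
theorem Raised.cost_le {x : ι → EuclideanSpace ℝ (Fin d)} {f : ι → ℕ} {l j : ℕ} {δ Y κ T T' : ℝ}
    (hC : Capacity d k l j δ Y κ) {L : List (Rep ι d)} {pts : List ι}
    (hperm : (L.flatMap Rep.mem).Perm pts) (hn : pts.length ≤ 2 ^ j) (hT : 0 ≤ T)
    (hL : ∀ s ∈ L, s.Sound x f T) (hcol : ∀ s ∈ L, s.color < l)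
    (hpw : L.Pairwise fun a b => ¬ a.Mergeable T b)
    (hslack : (L.map Rep.slack).sum ≤ 6 * (κ + 1) * (j + 1) * T)
    (hlen : κ < L.length) (hlen' : (L.length : ℝ) ≤ κ + 1) (hr : Raised T L T')
    (c : Fin k → EuclideanSpace ℝ (Fin d)) (α : ι → Fin k) :
    12 * (κ + 1) * (j + 1) * T' ≤ δ * ptCost x c α pts := by
  obtain ⟨V₀, hT', hV₀, hV₀'⟩ := hr
  have hκ := hC.two_mul_le
  have hl1 : (1 : ℝ) ≤ l := by exact_mod_cast hC.l_pos
  have hκ0 : 0 ≤ κ := by linarith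
  have hκ2 : κ + 1 ≤ 2 * κ := by linarith
  have hj : (0 : ℝ) ≤ j := Nat.cast_nonneg j
  have hsame := hV₀' (exists_same_color hcol (by
    have : (l : ℝ) < L.length := by linarith
    exact_mod_cast this))
  have hTV : L.Pairwise (fun a b => a.color = b.color → T < a.value b) :=
    hpw.imp fun h e => not_le.1 fun h' => h ⟨e, h'⟩
  -- `V₀` is the value of some pair, and no pair may be joined at the threshold `T`
  have hV₀T : T < V₀ := by
    by_contra hlt
    exact hsame (hTV.imp fun h e => (not_lt.1 hlt).trans_lt (h e))
  have hV : 0 < V₀ := hT.trans_lt hV₀T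
  have hmov := totalMovement_le hT hL fun s hs => (weight_le_length hperm hs).trans hn
  -- the nearest center of a representative
  have : Nonempty (Fin k) := ⟨⟨0, hC.k_pos⟩⟩
  have hex : ∀ s : Rep ι d, ∃ i, ∀ i', dist s.pos (c i) ≤ dist s.pos (c i') := fun s =>
    Finite.exists_min fun i => dist s.pos (c i)
  choose near hnear using hex
  have hrep : ∀ s : Rep ι d, (s.weight : ℝ) * dist s.pos (c (near s)) ^ 2 ≤
      2 * ptCost x c α s.mem + 2 * s.movement x := by
    intro s
    have : ∀ A : List ι, (A.length : ℝ) * dist s.pos (c (near s)) ^ 2 ≤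
        2 * ptCost x c α A + 2 * (A.map fun p => dist (x p) s.pos ^ 2).sum := by
      intro A
      induction A with
      | nil => simp [ptCost]
      | cons p A ih =>
        have h₁ := dist_sq_le_mul s.pos (x p) (c (α p)) one_pos
        have h₂ : dist s.pos (c (near s)) ^ 2 ≤ dist s.pos (c (α p)) ^ 2 := by
          gcongr; exact hnear s _
        rw [dist_comm s.pos (x p)] at h₁
        simp only [ptCost, List.map_cons, List.sum_cons, List.length_cons, Nat.cast_add,
          Nat.cast_one] at ih ⊢
        linarith
    exact this s.mem
  have hsum : ∑ a : Fin L.length, ((L.get a).weight : ℝ) * dist (L.get a).pos (c (near (L.get a))) ^ 2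
      ≤ 2 * ptCost x c α pts + 2 * totalMovement x L := by
    have h₁ : ∑ a : Fin L.length, ((L.get a).weight : ℝ) *
        dist (L.get a).pos (c (near (L.get a))) ^ 2 =
        (L.map fun s => (s.weight : ℝ) * dist s.pos (c (near s)) ^ 2).sum := by
      rw [← List.sum_ofFn, ← List.ofFn_get (L.map _)]
      congr 1
      apply List.ext_getElem <;> simp
    rw [h₁, ← ptCost_perm hperm, ptCost_flatMap, totalMovement]
    clear h₁ hmov hsame hTV hV₀' hV₀ hpw hperm hslack hlen hlen' hcol hL
    induction L with
    | nil => simp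
    | cons s L ih =>
      simp only [List.map_cons, List.sum_cons]
      linarith [hrep s]
  set w : Fin L.length → ℝ := fun a =>
    ((L.get a).weight : ℝ) * dist (L.get a).pos (c (near (L.get a))) ^ 2 with hw
  set S : Finset (Fin L.length) := Finset.univ.filter fun a => w a ≤ Y ^ 2 * V₀ with hS
  have hScard : (S.card : ℝ) ≤ l * k * (j + 1) * (6 * Y * d) ^ d := by
    refine card_le_of_separated hC.d_pos S (fun a => (L.get a).pos) (fun a => (L.get a).color)
      (fun a => (L.get a).weight) (fun a => near (L.get a)) c hV hC.one_le
      (fun a _ => hcol _ (List.get_mem _ _)) (fun a _ => (hL _ (List.get_mem _ _)).weight_pos)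
      (fun a _ => (weight_le_length hperm (List.get_mem _ _)).trans hn) ?_
      (fun a ha => (Finset.mem_filter.1 ha).2)
    intro a _ b _ hab hc
    rcases lt_or_gt_of_ne hab with h | h
    · exact List.pairwise_iff_get.1 hV₀ a b h hc
    · have := List.pairwise_iff_get.1 hV₀ b a h hc.symm
      rwa [Rep.value_comm] at this
  -- the representatives outside of `S` are far from the centers
  have hfar : ((L.length : ℝ) - S.card) * (Y ^ 2 * V₀) ≤ ∑ a, w a := by
    have h₁ : ((L.length : ℝ) - S.card) = (Sᶜ.card : ℝ) := by
      rw [Finset.card_compl, Fintype.card_fin, Nat.cast_sub]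
      simpa using S.card_le_univ
    rw [h₁, ← nsmul_eq_mul]
    refine (Finset.card_nsmul_le_sum Sᶜ w _ fun a ha => ?_).trans
      (Finset.sum_le_univ_sum_of_nonneg fun a => by positivity)
    simp only [hS, Finset.compl_filter, Finset.mem_filter, Finset.mem_univ, true_and, not_le] at ha
    exact ha.le
  have hcap := hC.le_cap
  have hY2 : 0 ≤ Y ^ 2 * V₀ := by positivity
  have h₁ : κ / 2 * (Y ^ 2 * V₀) ≤ 2 * ptCost x c α pts + 2 * totalMovement x L :=
    le_trans (mul_le_mul_of_nonneg_right (by linarith) hY2) (hfar.trans hsum)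
  -- the movement is at most `12 * (κ + 1) * (j + 1) * T`, and `T ≤ V₀`
  have h₂ : totalMovement x L ≤ 24 * κ * (j + 1) * V₀ := by
    have h₃ : 3 * T * (j + 1) * L.length ≤ 3 * T * (j + 1) * (κ + 1) := by gcongr
    have h₄ : (κ + 1) * ((j + 1) * T) ≤ (2 * κ) * ((j + 1) * V₀) := by
      gcongr
    linarith
  have h₅ : T' ≤ 2 * V₀ := by rw [hT']; exact max_le (by linarith) (by linarith)
  have h₆ : 12 * (κ + 1) * (j + 1) * T' ≤ 48 * κ * (j + 1) * V₀ := by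
    have : (κ + 1) * ((j + 1) * T') ≤ (2 * κ) * ((j + 1) * (2 * V₀)) := by
      have : (0 : ℝ) ≤ (j + 1) * T' := by
        have : 0 ≤ T' := hT' ▸ le_max_of_le_right hV.le
        positivity
      gcongr
    linarith
  have h₇ : δ * (κ * Y ^ 2 * V₀ / 4 - 24 * κ * (j + 1) * V₀) ≤ δ * ptCost x c α pts :=
    mul_le_mul_of_nonneg_left (by linarith) hC.δ_pos.le
  have h₈ := mul_le_mul_of_nonneg_right hC.le_sq (show 0 ≤ κ * V₀ by positivity)
  have h₉ := mul_le_mul_of_nonneg_right hC.δ_le (show 0 ≤ κ * (j + 1) * V₀ by positivity)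
  linarith

/-- The representatives `L` are a summary of the points `pts` at the threshold `T`.  By `slack_le` and
soundness the movement is at most a multiple of `T`, and by `threshold_le` this multiple is at most
`δ` times the cost of every solution. -/
structure Summary (x : ι → EuclideanSpace ℝ (Fin d)) (f : ι → ℕ) (k l j : ℕ) (δ κ T : ℝ)
    (L : List (Rep ι d)) (pts : List ι) : Prop where
  perm : (L.flatMap Rep.mem).Perm pts
  threshold_nonneg : 0 ≤ T
  sound : ∀ s ∈ L, s.Sound x f T
  color_lt : ∀ s ∈ L, s.color < l
  pairwise : L.Pairwise fun a b => ¬ a.Mergeable T b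
  slack_le : (L.map Rep.slack).sum ≤ 6 * (κ + 1) * (j + 1) * T
  length_le : (L.length : ℝ) ≤ κ
  threshold_le : ∀ (c : Fin k → EuclideanSpace ℝ (Fin d)) (α : ι → Fin k),
    12 * (κ + 1) * (j + 1) * T ≤ δ * ptCost x c α pts

theorem Summary.nil {x : ι → EuclideanSpace ℝ (Fin d)} {f : ι → ℕ} {l j : ℕ} {δ κ : ℝ}
    (hκ : 0 ≤ κ) : Summary x f k l j δ κ 0 [] [] where
  perm := by simp
  threshold_nonneg := le_rfl
  sound := by simp
  color_lt := by simp
  pairwise := by simp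
  slack_le := by simp
  length_le := by simpa
  threshold_le := by simp [ptCost]

theorem Summary.totalMovement_le {x : ι → EuclideanSpace ℝ (Fin d)} {f : ι → ℕ} {l j : ℕ}
    {δ κ T : ℝ} {L : List (Rep ι d)} {pts : List ι} (h : Summary x f k l j δ κ T L pts)
    (hn : pts.length ≤ 2 ^ j) (c : Fin k → EuclideanSpace ℝ (Fin d)) (α : ι → Fin k) :
    totalMovement x L ≤ δ * ptCost x c α pts := by
  refine le_trans ?_ (h.threshold_le c α)
  have h₁ := ColorKMeans.totalMovement_le h.threshold_nonneg h.sound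
    fun s hs => (weight_le_length h.perm hs).trans hn
  have h₂ : 3 * T * (j + 1) * L.length ≤ 3 * T * (j + 1) * (κ + 1) := by
    have := h.threshold_nonneg
    gcongr
    linarith [h.length_le]
  linarith [h.slack_le]

/-- How the threshold and the representatives change when the point `p` arrives. -/
def UpdateRel (x : ι → EuclideanSpace ℝ (Fin d)) (f : ι → ℕ) (κ T : ℝ) (L : List (Rep ι d)) (p : ι)
    (T' : ℝ) (L' : List (Rep ι d)) : Prop :=
  let L₁ := insertRep T L (Rep.single x f p)
  ((L₁.length : ℝ) ≤ κ ∧ T' = T ∧ L' = L₁) ∨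
    (κ < L₁.length ∧ Raised T L₁ T' ∧ L' = rebuild x T' L₁)

/-- When the list is rebuilt, the threshold has at least doubled, and so the movement up to then fits
into the bound on the slack again; the cost of every solution is large enough for the new threshold
by `Raised.cost_le`. -/
theorem Summary.update {x : ι → EuclideanSpace ℝ (Fin d)} {f : ι → ℕ} {l j : ℕ} {δ Y κ T T' : ℝ}
    (hC : Capacity d k l j δ Y κ) {L L' : List (Rep ι d)} {pts : List ι} {p : ι} (hp : f p < l)
    (h : Summary x f k l j δ κ T L pts) (hn : pts.length + 1 ≤ 2 ^ j)
    (hu : UpdateRel x f κ T L p T' L') : Summary x f k l j δ κ T' L' (pts ++ [p]) := by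
  set L₁ := insertRep T L (Rep.single x f p) with hL₁
  have hfresh := Rep.single_fresh x f p
  have hperm : (L₁.flatMap Rep.mem).Perm (pts ++ [p]) :=
    insertRep_mem_perm.trans (h.perm.append_right [p])
  have hsound : ∀ s ∈ L₁, s.Sound x f T := insertRep_sound h.threshold_nonneg h.sound hfresh
  have hcol : ∀ s ∈ L₁, s.color < l := by
    intro s hs
    rcases mem_insertRep hs with hs | ⟨s', hs', -, rfl⟩ | rfl
    · exact h.color_lt s hs
    · exact h.color_lt s' hs'
    · exact hp
  have hpw : L₁.Pairwise fun a b => ¬ a.Mergeable T b := insertRep_pairwise h.pairwise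
  have hslack : (L₁.map Rep.slack).sum ≤ 6 * (κ + 1) * (j + 1) * T := by
    rw [hL₁, insertRep_slack]
    simpa [Rep.single] using h.slack_le
  rcases hu with ⟨hlen, rfl, rfl⟩ | ⟨hlen, hr, rfl⟩
  · refine ⟨hperm, h.threshold_nonneg, hsound, hcol, hpw, hslack, hlen, fun c α => ?_⟩
    refine (h.threshold_le c α).trans ?_
    rw [ptCost_append]
    have := mul_nonneg hC.δ_pos.le (ptCost_nonneg x c α [p])
    linarith
  · have hlen' : (L₁.length : ℝ) ≤ κ + 1 := by
      have h₁ := length_insertRep_le (T := T) (L := L) (g := Rep.single x f p)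
      have h₂ : (L₁.length : ℝ) ≤ L.length + 1 := by exact_mod_cast h₁
      linarith [h.length_le]
    have hκ := hC.two_mul_le
    have hl1 : (1 : ℝ) ≤ l := by exact_mod_cast hC.l_pos
    have hκ0 : 0 ≤ κ := by linarith
    have hj : (0 : ℝ) ≤ j := Nat.cast_nonneg j
    have hcost := hr.cost_le hC hperm (by simpa using hn) h.threshold_nonneg hsound hcol hpw hslack
      hlen hlen'
    obtain ⟨V, hT', hV, hV'⟩ := id hr
    have hTT' : 2 * T ≤ T' := hT' ▸ le_max_left _ _
    have hT0 : 0 ≤ T' := by linarith [h.threshold_nonneg]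
    have hmem : ((L₁.map (Rep.resetSlack x)).flatMap Rep.mem) = L₁.flatMap Rep.mem := by
      rw [List.flatMap_map]; rfl
    have hfr : ∀ g ∈ L₁.map (Rep.resetSlack x), g.Fresh x f := by
      intro g hg
      obtain ⟨s, hs, rfl⟩ := List.mem_map.1 hg
      exact (hsound s hs).resetSlack
    refine ⟨?_, hT0, ?_, ?_, ?_, ?_, ?_, hcost⟩
    · refine (foldl_insertRep_mem_perm _).trans ?_
      rw [hmem]; simpa using hperm
    · exact foldl_insertRep_sound hT0 (by simp) hfr
    · have : ∀ (I Q : List (Rep ι d)), (∀ g ∈ I, g.color < l) → (∀ g ∈ Q, g.color < l) →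
          ∀ s ∈ I.foldl (insertRep T') Q, s.color < l := by
        intro I
        induction I with
        | nil => intro Q _ hQ; simpa
        | cons g I ih =>
          intro Q hI hQ
          refine ih _ (fun g hg => hI g (by simp [hg])) fun s hs => ?_
          rcases mem_insertRep hs with hs | ⟨s', hs', -, rfl⟩ | rfl
          · exact hQ s hs
          · exact hQ s' hs'
          · exact hI _ (by simp)
      refine this _ _ ?_ (by simp)
      intro g hg
      obtain ⟨s, hs, rfl⟩ := List.mem_map.1 hg
      exact hcol s hs
    · exact foldl_insertRep_pairwise _ (by simp)
    · have h₁ : ((rebuild x T' L₁).map Rep.slack).sum = totalMovement x L₁ := by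
        rw [rebuild, foldl_insertRep_slack]
        simp [totalMovement, List.map_map, Function.comp_def, Rep.resetSlack]
      rw [h₁]
      have h₂ := ColorKMeans.totalMovement_le h.threshold_nonneg hsound
        fun s hs => (weight_le_length hperm hs).trans (by simpa using hn)
      have h₃ : 3 * T * (j + 1) * L₁.length ≤ 3 * T * (j + 1) * (κ + 1) := by
        have := h.threshold_nonneg
        gcongr
      have h₄ : (κ + 1) * (j + 1) * (2 * T) ≤ (κ + 1) * (j + 1) * T' := by gcongr
      linarith
    · -- the two representatives of minimum value are not both kept
      have h₁ := foldl_insertRep_length_le (T := T') (L := []) (L₁.map (Rep.resetSlack x))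
      have h₂ : (rebuild x T' L₁).length ≠ L₁.length := by
        intro h₃
        have h₄ := foldl_insertRep_eq_append (T := T') (L := []) (I := L₁.map (Rep.resetSlack x))
          (by simpa [rebuild] using h₃)
        have h₅ := foldl_insertRep_pairwise (T := T') (L := []) (L₁.map (Rep.resetSlack x)) (by simp)
        rw [h₄, List.nil_append, List.pairwise_map] at h₅
        refine hV' (exists_same_color hcol (by
          have : (l : ℝ) < L₁.length := by linarith
          exact_mod_cast this)) (h₅.imp fun {a b} hab e => ?_)
        refine lt_of_le_of_lt (hT' ▸ le_max_right _ _ : V ≤ T') (not_le.1 fun h' => hab ⟨e, h'⟩)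
      have h₃ : (rebuild x T' L₁).length + 1 ≤ L₁.length := by
        simp only [List.length_nil, List.length_map, zero_add] at h₁
        rw [rebuild] at h₂ ⊢; omega
      have : ((rebuild x T' L₁).length : ℝ) + 1 ≤ L₁.length := by exact_mod_cast h₃
      linarith

end Summary

end ColorKMeans

namespace ColorKMeans

/-! ### Assignments of points and of their representatives -/

/-- The points of every class can be distributed with prescribed numbers. -/
theorem exists_assignment {P B I : Type} [Fintype P] [DecidableEq B] [Fintype I] [DecidableEq I]
    (f : P → B) (K : I → B → ℕ)
    (h : ∀ b, ∑ i, K i b = (Finset.univ.filter fun p => f p = b).card) :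
    ∃ α : P → I, ∀ i b, (Finset.univ.filter fun p => f p = b ∧ α p = i).card = K i b := by
  classical
  have e : ∀ b, Nonempty ({p // f p = b} ≃ Σ i, Fin (K i b)) := fun b => by
    refine Fintype.card_eq.1 ?_
    rw [Fintype.card_subtype, Fintype.card_sigma]
    simp [h b]
  let E := fun b => (e b).some
  refine ⟨fun p => (E (f p) ⟨p, rfl⟩).1, fun i b => ?_⟩
  have h₁ : ∀ p (hp : f p = b), (E (f p) ⟨p, rfl⟩).1 = (E b ⟨p, hp⟩).1 := by
    rintro p rfl; rfl
  have h₂ : (Finset.univ.filter fun p => f p = b ∧ (E (f p) ⟨p, rfl⟩).1 = i) =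
      Finset.univ.image fun a : Fin (K i b) => ((E b).symm ⟨i, a⟩).1 := by
    ext p
    simp only [Finset.mem_filter, Finset.mem_univ, true_and, Finset.mem_image]
    constructor
    · rintro ⟨hp, h₃⟩
      rw [h₁ p hp] at h₃
      subst h₃
      exact ⟨(E b ⟨p, hp⟩).2, by simp⟩
    · rintro ⟨a, rfl⟩
      have hb := ((E b).symm ⟨i, a⟩).2
      exact ⟨hb, by rw [h₁ _ hb]; simp⟩
  rw [h₂, Finset.card_image_of_injective, Finset.card_univ, Fintype.card_fin]
  intro a a' h
  have := (E b).symm.injective (Subtype.ext h)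
  simpa using this

section Cost

variable {n m k l d : ℕ} {x : Fin n → EuclideanSpace ℝ (Fin d)} {f : Fin n → Fin l}
  {𝒦 : Set (Matrix (Fin k) (Fin l) ℕ)}

theorem exists_satisfies (h : 𝒦.Nonempty) (hc : IsColorConstraint (fun _ => 1) f 𝒦) :
    ∃ α, Satisfies f 𝒦 α := by
  obtain ⟨K, hK⟩ := h
  obtain ⟨α, hα⟩ := exists_assignment f K fun j => by rw [hc K hK j]; simp
  exact ⟨α, K, hK, hα⟩

theorem colorCost_le {α : Fin n → Fin k} (h : Satisfies f 𝒦 α)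
    (c : Fin k → EuclideanSpace ℝ (Fin d)) : colorCost x f 𝒦 c ≤ cost x α c :=
  ciInf_le (Set.finite_range _).bddBelow (⟨α, h⟩ : {α // Satisfies f 𝒦 α})

theorem exists_cost_eq (h : ∃ α, Satisfies f 𝒦 α) (c : Fin k → EuclideanSpace ℝ (Fin d)) :
    ∃ α, Satisfies f 𝒦 α ∧ cost x α c = colorCost x f 𝒦 c := by
  obtain ⟨α, hα⟩ := h
  have : Nonempty {α // Satisfies f 𝒦 α} := ⟨⟨α, hα⟩⟩
  obtain ⟨a, ha⟩ := exists_eq_ciInf_of_finite (f := fun α : {α // Satisfies f 𝒦 α} => cost x α.1 c)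
  exact ⟨a.1, a.2, ha⟩

/-- The weighted assignment of the representatives induced by an assignment of the points. -/
def induced (s : Fin n → Fin m) (α : Fin n → Fin k) (p : Fin m) (i : Fin k) : ℕ :=
  (Finset.univ.filter fun r => s r = p ∧ α r = i).card

theorem wcost_induced (y : Fin m → EuclideanSpace ℝ (Fin d)) (s : Fin n → Fin m)
    (α : Fin n → Fin k) (c : Fin k → EuclideanSpace ℝ (Fin d)) :
    wcost y (induced s α) c = cost (fun r => y (s r)) α c := by
  simp only [wcost, cost, induced, Finset.card_filter, Nat.cast_sum, Finset.sum_mul]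
  have h₁ : ∀ p : Fin m, ∑ i : Fin k, ∑ r : Fin n,
      (((if s r = p ∧ α r = i then 1 else 0 : ℕ) : ℝ) * dist (y p) (c i) ^ 2) =
      ∑ r : Fin n, if s r = p then dist (y p) (c (α r)) ^ 2 else 0 := by
    intro p
    rw [Finset.sum_comm]
    refine Finset.sum_congr rfl fun r _ => ?_
    by_cases h : s r = p
    · simp [h]
    · simp [h]
  rw [Finset.sum_congr rfl fun p _ => h₁ p, Finset.sum_comm]
  simp

theorem sum_induced (s : Fin n → Fin m) (α : Fin n → Fin k) (p : Fin m) :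
    ∑ i, induced s α p i = (Finset.univ.filter fun r => s r = p).card := by
  simp only [induced]
  rw [Finset.card_eq_sum_card_fiberwise (f := α) (t := Finset.univ) fun _ _ => by simp]
  simp [Finset.filter_filter]

theorem sum_induced_color {s : Fin n → Fin m} {fc : Fin m → Fin l} (hs : ∀ r, fc (s r) = f r)
    (α : Fin n → Fin k) (i : Fin k) (j : Fin l) :
    ∑ p with fc p = j, induced s α p i =
      (Finset.univ.filter fun r => f r = j ∧ α r = i).card := by
  rw [Finset.card_eq_sum_card_fiberwise (f := s) (t := Finset.univ.filter fun p => fc p = j)]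
  · refine Finset.sum_congr rfl fun p hp => ?_
    rw [induced, Finset.filter_filter]
    congr 1
    ext r
    simp only [Finset.mem_filter, Finset.mem_univ, true_and] at hp ⊢
    constructor
    · rintro ⟨rfl, rfl⟩; exact ⟨⟨by rw [← hs, hp], rfl⟩, rfl⟩
    · rintro ⟨⟨-, h⟩, h'⟩; exact ⟨h', h⟩
  · intro r hr
    simp only [Finset.coe_filter, Set.mem_ofPred_eq, Finset.mem_univ, true_and] at hr ⊢
    rw [hs, hr.1]

theorem Satisfies.induced {s : Fin n → Fin m} {fc : Fin m → Fin l} {w : Fin m → ℕ}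
    (hs : ∀ r, fc (s r) = f r) (hw : ∀ p, w p = (Finset.univ.filter fun r => s r = p).card)
    {α : Fin n → Fin k} (h : Satisfies f 𝒦 α) : WSatisfies w fc 𝒦 (induced s α) := by
  obtain ⟨K, hK, h⟩ := h
  refine ⟨fun p => by rw [sum_induced, hw], K, hK, fun i j => ?_⟩
  rw [sum_induced_color hs, h]

/-- Every feasible weighted assignment is induced by a feasible assignment of the points. -/
theorem WSatisfies.exists_induced {s : Fin n → Fin m} {fc : Fin m → Fin l} {w : Fin m → ℕ}
    (hs : ∀ r, fc (s r) = f r) (hw : ∀ p, w p = (Finset.univ.filter fun r => s r = p).card)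
    {A : Fin m → Fin k → ℕ} (h : WSatisfies w fc 𝒦 A) :
    ∃ α, Satisfies f 𝒦 α ∧ ColorKMeans.induced s α = A := by
  obtain ⟨h₁, K, hK, h₂⟩ := h
  obtain ⟨α, hα⟩ := exists_assignment s (fun i p => A p i) fun p => by rw [h₁, hw]
  have : ColorKMeans.induced s α = A := by
    ext p i; exact hα i p
  refine ⟨α, ⟨K, hK, fun i j => ?_⟩, this⟩
  rw [← sum_induced_color hs, this, h₂]

theorem isColorConstraint_weights {s : Fin n → Fin m} {fc : Fin m → Fin l} {w : Fin m → ℕ}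
    (hs : ∀ r, fc (s r) = f r) (hw : ∀ p, w p = (Finset.univ.filter fun r => s r = p).card)
    (h : IsColorConstraint (fun _ => 1) f 𝒦) : IsColorConstraint w fc 𝒦 := by
  intro K hK j
  rw [h K hK j]
  have : ∑ p with fc p = j, w p = (Finset.univ.filter fun r => f r = j).card := by
    rw [Finset.card_eq_sum_card_fiberwise (f := s) (t := Finset.univ.filter fun p => fc p = j)]
    · refine Finset.sum_congr rfl fun p hp => ?_
      rw [hw, Finset.filter_filter]
      congr 1
      ext r
      simp only [Finset.mem_filter, Finset.mem_univ, true_and] at hp ⊢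
      constructor
      · rintro rfl; exact ⟨by rw [← hs, hp], rfl⟩
      · rintro ⟨-, h⟩; exact h
    · intro r hr
      simp only [Finset.coe_filter, Set.mem_ofPred_eq, Finset.mem_univ, true_and] at hr ⊢
      rw [hs, hr]
  rw [this]; simp

theorem cost_le_mul (x y : Fin n → EuclideanSpace ℝ (Fin d)) (α : Fin n → Fin k)
    (c : Fin k → EuclideanSpace ℝ (Fin d)) {τ : ℝ} (hτ : 0 < τ) :
    cost y α c ≤ (1 + τ) * cost x α c + (1 + 1 / τ) * ∑ r, dist (x r) (y r) ^ 2 := by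
  rw [cost, cost, Finset.mul_sum, Finset.mul_sum, ← Finset.sum_add_distrib]
  refine Finset.sum_le_sum fun r _ => ?_
  have := dist_sq_le_mul (y r) (x r) (c (α r)) (inv_pos.2 hτ)
  rw [dist_comm (y r) (x r)] at this
  rw [one_div, inv_inv] at this
  rw [one_div]
  linarith

/-! ### Means of few points as centers -/

/-- The mean of a sequence of `q` points of a family. -/
noncomputable def seqMean {q : ℕ} (y : Fin m → EuclideanSpace ℝ (Fin d)) (g : Fin q → Fin m) :
    EuclideanSpace ℝ (Fin d) := (q : ℝ)⁻¹ • ∑ t, y (g t)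

/-- The moment of inertia about `c` is least when `c` is the centroid `μ`. -/
theorem sum_weight_dist_sq (y : Fin m → EuclideanSpace ℝ (Fin d)) (a : Fin m → ℝ)
    {μ : EuclideanSpace ℝ (Fin d)} (hμ : ∑ p, a p • (y p - μ) = 0)
    (c : EuclideanSpace ℝ (Fin d)) :
    ∑ p, a p * dist (y p) c ^ 2 = ∑ p, a p * dist (y p) μ ^ 2 + (∑ p, a p) * dist μ c ^ 2 := by
  have h : ∀ p, a p * dist (y p) c ^ 2 = a p * dist (y p) μ ^ 2 + a p * dist μ c ^ 2 +
      2 * inner ℝ (a p • (y p - μ)) (μ - c) := by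
    intro p
    rw [dist_eq_norm, dist_eq_norm, dist_eq_norm,
      show y p - c = (y p - μ) + (μ - c) by abel, norm_add_sq_real, inner_smul_left]
    simp; ring
  rw [Finset.sum_congr rfl fun p _ => h p, Finset.sum_add_distrib, Finset.sum_add_distrib,
    ← Finset.mul_sum, ← sum_inner, hμ, inner_zero_left, Finset.sum_mul]
  ring

/-- The mean of some `q` points of a weighted point set is nearly as good a center as any point. Each
further point is chosen such that the sum of the deviations from the centroid stays small. -/
theorem exists_seqMean_le (y : Fin m → EuclideanSpace ℝ (Fin d)) (a : Fin m → ℕ) (hm : 0 < m) {q : ℕ}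
    (hq : 0 < q) : ∃ g : Fin q → Fin m, ∀ c,
      ∑ p, (a p : ℝ) * dist (y p) (seqMean y g) ^ 2 ≤
        (1 + 1 / q) * ∑ p, (a p : ℝ) * dist (y p) c ^ 2 := by
  set W : ℝ := ∑ p, (a p : ℝ) with hW
  have hW0 : 0 ≤ W := by positivity
  rcases hW0.eq_or_lt with h0 | hpos
  · refine ⟨fun _ => ⟨0, hm⟩, fun c => ?_⟩
    have : ∀ p, (a p : ℝ) = 0 := fun p =>
      (Finset.sum_eq_zero_iff_of_nonneg fun _ _ => by positivity).1 h0.symm p (Finset.mem_univ p)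
    simp [this]
  · set μ := W⁻¹ • ∑ p, (a p : ℝ) • y p with hμdef
    have hμ : ∑ p, (a p : ℝ) • (y p - μ) = 0 := by
      simp only [smul_sub, Finset.sum_sub_distrib, ← Finset.sum_smul]
      rw [hμdef, smul_smul, mul_inv_cancel₀ hpos.ne', one_smul, sub_self]
    set S := ∑ p, (a p : ℝ) * dist (y p) μ ^ 2 with hS
    -- the point that is added is one whose distance from `μ - Z`, for the sum `Z` of the deviations
    -- up to now, is at most the root mean square
    have hseq : ∀ t : ℕ, ∃ g : Fin t → Fin m, W * ‖∑ i, (y (g i) - μ)‖ ^ 2 ≤ t * S := by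
      intro t
      induction t with
      | zero => exact ⟨Fin.elim0, by simp⟩
      | succ t ih =>
        obtain ⟨g, hg⟩ := ih
        set Z := ∑ i, (y (g i) - μ) with hZ
        have h₁ := sum_weight_dist_sq y (fun p => (a p : ℝ)) hμ (μ - Z)
        have h₂ : ∃ p, W * dist (y p) (μ - Z) ^ 2 ≤ S + W * ‖Z‖ ^ 2 := by
          by_contra! hcon
          have h₃ : ∃ p, 0 < (a p : ℝ) := by
            by_contra! h₄
            have : W ≤ 0 := Finset.sum_nonpos fun p _ => h₄ p
            linarith
          obtain ⟨p₀, hp₀⟩ := h₃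
          have h₄ : ∑ p, (a p : ℝ) * (S + W * ‖Z‖ ^ 2) <
              ∑ p, (a p : ℝ) * (W * dist (y p) (μ - Z) ^ 2) :=
            Finset.sum_lt_sum (fun p _ => mul_le_mul_of_nonneg_left (hcon p).le (by positivity))
              ⟨p₀, Finset.mem_univ _, mul_lt_mul_of_pos_left (hcon p₀) hp₀⟩
          rw [← Finset.sum_mul] at h₄
          have h₅ : ∑ p, (a p : ℝ) * (W * dist (y p) (μ - Z) ^ 2) =
              W * ∑ p, (a p : ℝ) * dist (y p) (μ - Z) ^ 2 := by
            rw [Finset.mul_sum]; exact Finset.sum_congr rfl fun p _ => by ring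
          rw [h₅, h₁] at h₄
          have h₆ : dist μ (μ - Z) = ‖Z‖ := by rw [dist_eq_norm]; simp
          rw [h₆] at h₄
          exact lt_irrefl _ h₄
        obtain ⟨p, hp⟩ := h₂
        refine ⟨Fin.snoc g p, ?_⟩
        rw [Fin.sum_univ_castSucc]
        simp only [Fin.snoc_castSucc, Fin.snoc_last]
        rw [← hZ]
        have h₃ : dist (y p) (μ - Z) = ‖Z + (y p - μ)‖ := by
          rw [dist_eq_norm]; congr 1; abel
        rw [h₃] at hp
        push_cast
        linarith
    obtain ⟨g, hg⟩ := hseq q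
    refine ⟨g, fun c => ?_⟩
    have hq' : (0 : ℝ) < q := by exact_mod_cast hq
    have h₁ : W * dist μ (seqMean y g) ^ 2 ≤ S / q := by
      have h₂ : seqMean y g - μ = (q : ℝ)⁻¹ • ∑ i, (y (g i) - μ) := by
        rw [seqMean, Finset.sum_sub_distrib, smul_sub]
        simp [← Nat.cast_smul_eq_nsmul ℝ, smul_smul, inv_mul_cancel₀ hq'.ne']
      rw [dist_comm, dist_eq_norm, h₂, norm_smul, mul_pow, norm_inv, Real.norm_natCast]
      calc W * ((q : ℝ)⁻¹ ^ 2 * ‖∑ i, (y (g i) - μ)‖ ^ 2)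
          = (q : ℝ)⁻¹ ^ 2 * (W * ‖∑ i, (y (g i) - μ)‖ ^ 2) := by ring
        _ ≤ (q : ℝ)⁻¹ ^ 2 * (q * S) := by gcongr
        _ = S / q := by field_simp
    rw [sum_weight_dist_sq y _ hμ (seqMean y g), sum_weight_dist_sq y _ hμ c]
    have h₃ : 0 ≤ W * dist μ c ^ 2 := by positivity
    have h₄ : 0 ≤ 1 / (q : ℝ) * (W * dist μ c ^ 2) := by positivity
    have h₅ : S / q = 1 / q * S := by ring
    rw [← hW, ← hS]
    linarith

/-- If the representatives stand for the points with little movement, then centers that are the best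
among the means of `q` representatives each, for the representatives, are nearly optimal for the
points.  From an optimal solution for the points, the costs grow by factors of about `1 + ε / 8` when
passing to the representatives, then to means as centers, and back to the points; the movement adds
`ε / 16` of the cost in the first and the last of these steps. -/
theorem colorCost_le_of_best {y : Fin m → EuclideanSpace ℝ (Fin d)} {w : Fin m → ℕ}
    {fc : Fin m → Fin l} {s : Fin n → Fin m} {ε : ℝ} (hε : 0 < ε) (hε1 : ε < 1)
    (hs : ∀ r, fc (s r) = f r) (hw : ∀ p, w p = (Finset.univ.filter fun r => s r = p).card)
    (hmov : ∀ (c : Fin k → EuclideanSpace ℝ (Fin d)) (α : Fin n → Fin k),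
      ∑ r, dist (x r) (y (s r)) ^ 2 ≤ ε ^ 2 / 144 * cost x α c)
    {q : ℕ} (hq : 8 ≤ q * ε) (hsat : ∃ α, Satisfies f 𝒦 α)
    {b : Fin k → EuclideanSpace ℝ (Fin d)}
    (hb : 0 < m → ∃ A, WSatisfies w fc 𝒦 A ∧ ∀ (g : Fin k → Fin q → Fin m) (A'),
      WSatisfies w fc 𝒦 A' → wcost y A b ≤ wcost y A' fun i => seqMean y (g i))
    (c : Fin k → EuclideanSpace ℝ (Fin d)) :
    colorCost x f 𝒦 b ≤ (1 + ε) * colorCost x f 𝒦 c := by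
  rcases Nat.eq_zero_or_pos m with rfl | hm
  · have hn : IsEmpty (Fin n) := ⟨fun r => (s r).elim0⟩
    have : ∀ c, colorCost x f 𝒦 c = 0 := fun c => by simp [colorCost, cost]
    simp [this]
  obtain ⟨A, hA, hbest⟩ := hb hm
  obtain ⟨α, hα, hαc⟩ := exists_cost_eq (x := x) hsat c
  obtain ⟨β, hβ, rfl⟩ := hA.exists_induced hs hw
  have hq0 : 0 < q := by
    rcases Nat.eq_zero_or_pos q with rfl | h
    · norm_num at hq
    · exact h
  have hq' : (0 : ℝ) < q := by exact_mod_cast hq0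
  set v := cost x α c with hv
  have hv0 : 0 ≤ v := Finset.sum_nonneg fun _ _ => by positivity
  set τ := ε / 8 with hτ
  have hτ0 : 0 < τ := by positivity
  -- for each cluster of the optimal assignment, a mean that is a good center of its representatives
  choose g hg using fun i => exists_seqMean_le y (fun p => induced s α p i) hm hq0
  have h₁ : wcost y (induced s α) (fun i => seqMean y (g i)) ≤
      (1 + 1 / q) * wcost y (induced s α) c := by
    have h₀ : ∀ c : Fin k → EuclideanSpace ℝ (Fin d), wcost y (induced s α) c =
        ∑ i, ∑ p, (induced s α p i : ℝ) * dist (y p) (c i) ^ 2 := fun c => Finset.sum_comm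
    rw [h₀, h₀, Finset.mul_sum]
    exact Finset.sum_le_sum fun i _ => hg i (c i)
  have h₂ := cost_le_mul x (fun r => y (s r)) α c hτ0
  rw [← wcost_induced] at h₂
  have h₃ := hbest g _ (hα.induced hs hw)
  have h₄ := cost_le_mul (fun r => y (s r)) x β b hτ0
  rw [← wcost_induced y] at h₄
  simp only [dist_comm (y (s _)) (x _)] at h₄
  have h₅ : (1 + 1 / τ) * ∑ r, dist (x r) (y (s r)) ^ 2 ≤ ε / 16 * v := by
    have h₆ : 1 + 1 / τ ≤ 9 / ε := by
      rw [hτ, one_div_div, le_div_iff₀ hε, add_mul, div_mul_cancel₀ _ hε.ne']; linarith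
    calc _ ≤ 9 / ε * (ε ^ 2 / 144 * v) := by
          gcongr
          exact hmov c α
      _ = ε / 16 * v := by field_simp; ring
  have h₇ : 1 / (q : ℝ) ≤ τ := by
    rw [hτ, div_le_div_iff₀ hq' (by norm_num)]; linarith
  have h₈ : wcost y (induced s β) b ≤ (1 + τ) * ((1 + τ) * v + ε / 16 * v) :=
    h₃.trans (h₁.trans (mul_le_mul (by linarith) (by linarith) (by
      rw [wcost]; positivity) (by linarith)))
  have h₉ : (1 + τ) * wcost y (induced s β) b ≤
      (1 + τ) * ((1 + τ) * ((1 + τ) * v + ε / 16 * v)) :=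
    mul_le_mul_of_nonneg_left h₈ (by linarith)
  rw [← hαc]
  refine (colorCost_le hβ b).trans (h₄.trans ?_)
  have h₁₀ : (1 + τ) * ((1 + τ) * ((1 + τ) + ε / 16)) + ε / 16 ≤ 1 + ε := by
    rw [hτ]
    nlinarith [mul_pos hε hε, mul_pos (mul_pos hε hε) hε, mul_nonneg hε.le (sub_nonneg.2 hε1.le),
      mul_nonneg (mul_pos hε hε).le (sub_nonneg.2 hε1.le)]
  have := mul_le_mul_of_nonneg_right h₁₀ hv0
  linarith

end Cost

end ColorKMeans

namespace RealRAM

variable {sub : State → ℕ → State → Prop} {M W : ℕ} {P P' : Program} {s : State} {t t₁ t₂ : ℕ}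
  {Q Q' : State → Prop} {b : Test}

theorem Runs.le (h : Runs sub M W P s t₁ Q) (ht : t₁ ≤ t) : Runs sub M W P s t Q :=
  h.mono ht fun _ h => h

theorem Runs.imp (h : Runs sub M W P s t Q) (hQ : ∀ s', Q s' → Q' s') : Runs sub M W P s t Q' :=
  h.mono le_rfl hQ

theorem Runs.then (h : Runs sub M W P s t₁ Q') (h' : ∀ s', Q' s' → Runs sub M W P' s' t₂ Q) :
    Runs sub M W (.seq P P') s (t₁ + t₂) Q := Runs.seq (h.imp h')

/-- The rule for assignments with the address and the value spelled out. -/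
theorem Runs.setInt' {a e : IntExp} (x v : ℕ) (ha : a.eval s = x) (he : e.eval s = v) (hx : x < M)
    (hv : v ≤ W) (h : Q (s.setInt x v)) : Runs sub M W (.setInt a e) s 1 Q := by
  subst ha he; exact Runs.setInt hx hv h

theorem Runs.setReal' {a : IntExp} {e : RealExp} (x : ℕ) (v : ℝ) (ha : a.eval s = x)
    (he : e.eval s = v) (hx : x < M) (h : Q (s.setReal x v)) :
    Runs sub M W (.setReal a e) s 1 Q := by
  subst ha he; exact Runs.setReal hx h

theorem State.setInt_setInt (s : State) (a v v' : ℕ) : (s.setInt a v).setInt a v' = s.setInt a v' := by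
  simp [State.setInt]

/-! ### The list of representatives in the memory -/

/-- The color, the weight and the position in the slot `i` of the list of representatives.  The slots
begin at the integer cell `32` and at the real cell `d + 8`; the cells before them are used for
single numbers. -/
noncomputable def State.slot (d : ℕ) (s : State) (i : ℕ) : ℕ × ℕ × EuclideanSpace ℝ (Fin d) :=
  (s.int (32 + 2 * i), s.int (33 + 2 * i), s.vec d (d + 8 + i * d))

theorem State.slot_congr {d : ℕ} {s s' : State} {i : ℕ} (h₁ : s.int (32 + 2 * i) = s'.int (32 + 2 * i))
    (h₂ : s.int (33 + 2 * i) = s'.int (33 + 2 * i))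
    (h₃ : ∀ j < d, s.real (d + 8 + i * d + j) = s'.real (d + 8 + i * d + j)) :
    s.slot d i = s'.slot d i := by
  rw [State.slot, State.slot, h₁, h₂, State.vec_congr h₃]

@[simp] theorem State.slot_setReal {d : ℕ} (s : State) {a : ℕ} (v : ℝ) (i : ℕ) (h : a < d + 8) :
    (s.setReal a v).slot d i = s.slot d i :=
  State.slot_congr rfl rfl fun j _ => by rw [State.setReal_real, if_neg (by omega)]

@[simp] theorem State.slot_setInt {d : ℕ} (s : State) {a : ℕ} (v : ℕ) (i : ℕ) (h : a < 32) :
    (s.setInt a v).slot d i = s.slot d i :=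
  State.slot_congr (by rw [State.setInt_int, if_neg (by omega)])
    (by rw [State.setInt_int, if_neg (by omega)]) fun j _ => rfl

theorem mul_add_le_mul {i j : ℕ} (d : ℕ) (h : i < j) : i * d + d ≤ j * d := by
  have := Nat.mul_le_mul_right d (Nat.succ_le_of_lt h)
  rwa [Nat.succ_mul] at this

end RealRAM

namespace ColorKMeans

/-- The color in the slot `i`. -/
abbrev colorExp (i : IntExp) : IntExp := .get (.add (.lit 32) (.mul (.lit 2) i))

/-- The weight in the slot `i`. -/
abbrev weightExp (i : IntExp) : IntExp := .get (.add (.lit 33) (.mul (.lit 2) i))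

/-- The address of the position in the slot `i`. -/
abbrev pointExp (d : ℕ) (i : IntExp) : IntExp := .add (.lit (d + 8)) (.mul i (.lit d))

/-- The value of the representatives in the slots `i` and `r`. -/
def valueExp (d : ℕ) (i r : IntExp) : RealExp :=
  .mul (.ofInt (.add (weightExp i) (weightExp r))) (sqDistExp d (pointExp d i) (pointExp d r))

/-- The test whether the representatives in the slots `i` and `r` may be joined at the threshold in
the real cell `d + 1`. -/
def mergeTest (d : ℕ) (i r : IntExp) : Test :=
  .and (.intEq (colorExp i) (colorExp r)) (.realLe (valueExp d i r) (.var (d + 1)))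

section Stored

variable {ι : Type} {d : ℕ}

/-- What the program stores of a representative. -/
def Rep.data (g : Rep ι d) : ℕ × ℕ × EuclideanSpace ℝ (Fin d) := (g.color, g.weight, g.pos)

/-- The list is stored in the slots from `a` on. -/
def HoldsList (s : State) (a : ℕ) (L : List (Rep ι d)) : Prop :=
  ∀ (i : ℕ) (h : i < L.length), s.slot d (a + i) = L[i].data

theorem HoldsList.congr {s s' : State} {a : ℕ} {L : List (Rep ι d)} (h : HoldsList s a L)
    (hs : ∀ i, a ≤ i → i < a + L.length → s'.slot d i = s.slot d i) : HoldsList s' a L :=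
  fun i hi => by rw [hs _ (by omega) (by omega), h i hi]

theorem holdsList_append {s : State} {a : ℕ} {L L' : List (Rep ι d)} :
    HoldsList s a (L ++ L') ↔ HoldsList s a L ∧ HoldsList s (a + L.length) L' := by
  constructor
  · refine fun h => ⟨fun i hi => ?_, fun i hi => ?_⟩
    · have := h i (by simp; omega)
      rwa [List.getElem_append_left hi] at this
    · have := h (L.length + i) (by simp; omega)
      rw [List.getElem_append_right (by omega)] at this
      simpa [add_assoc] using this
  · rintro ⟨h, h'⟩ i hi
    by_cases hL : i < L.length
    · rw [List.getElem_append_left hL]; exact h i hL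
    · rw [List.getElem_append_right (by omega)]
      have := h' (i - L.length) (by simp at hi; omega)
      rwa [show a + L.length + (i - L.length) = a + i by omega] at this

theorem valueExp_eval {s : State} {i r : IntExp} {g h : Rep ι d} (hg : s.slot d (i.eval s) = g.data)
    (hh : s.slot d (r.eval s) = h.data) : (valueExp d i r).eval s = g.value h := by
  simp only [State.slot, Rep.data, Prod.mk.injEq] at hg hh
  simp [valueExp, RealExp.eval, IntExp.eval, Rep.value, hg.2.1, hg.2.2, hh.2.1, hh.2.2]

theorem mergeTest_holds {s : State} {i r : IntExp} {g h : Rep ι d} {T : ℝ}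
    (hg : s.slot d (i.eval s) = g.data) (hh : s.slot d (r.eval s) = h.data)
    (hT : s.real (d + 1) = T) : (mergeTest d i r).Holds s ↔ g.Mergeable T h := by
  have hv := valueExp_eval hg hh
  simp only [State.slot, Rep.data, Prod.mk.injEq] at hg hh
  simp only [mergeTest, Test.Holds, hv, IntExp.eval, RealExp.eval, hg.1, hh.1, hT, Rep.Mergeable]
  rw [← le_antisymm_iff]

end Stored

/-- Copies the slot `5` to the slot `6`. -/
def copySlot (d : ℕ) : Program :=
  .seq (.setInt (.add (.lit 32) (.mul (.lit 2) (.var 6))) (colorExp (.var 5)))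
  (.seq (.setInt (.add (.lit 33) (.mul (.lit 2) (.var 6))) (weightExp (.var 5)))
    (writeVec (pointExp d (.var 6)) (fun a => .get (.add (pointExp d (.var 5)) (.lit a))) d))

/-- Inserts the representative in the slot with the number in cell `5` into the list that begins at
the slot with the number in cell `4` and ends before the one with the number in cell `6`. -/
def insertProg (d : ℕ) : Program :=
  .seq (.setInt (.lit 7) (.var 4))
  (.seq (.while (.and (.intLt (.var 7) (.var 6)) (.not (mergeTest d (.var 7) (.var 5)))) (.incr 7))
  (.ite (.intLt (.var 7) (.var 6))
    (.setInt (.add (.lit 33) (.mul (.lit 2) (.var 7))) (.add (weightExp (.var 7)) (weightExp (.var 5))))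
    (.seq (copySlot d) (.incr 6))))

section Programs

variable {sub : State → ℕ → State → Prop} {M W : ℕ} {ι : Type} {d : ℕ}

theorem copySlot_runs {s : State} {a r : ℕ} (hr : s.int 5 = r) (ha : s.int 6 = a) (har : a ≤ r)
    (hM : 34 + 2 * a ≤ M) (hM' : d + 8 + (a + 1) * d ≤ M) (hW : (s.slot d r).1 ≤ W)
    (hW' : (s.slot d r).2.1 ≤ W) :
    Runs sub M W (copySlot d) s (d + 3) fun s' => s'.slot d a = s.slot d r ∧
      (∀ x < 32, s'.int x = s.int x) ∧ (∀ x < d + 8, s'.real x = s.real x) ∧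
      ∀ i, i ≠ a → s'.slot d i = s.slot d i := by
  simp only [State.slot] at hW hW'
  refine Runs.le (Runs.seq (Runs.setInt' (32 + 2 * a) (s.int (32 + 2 * r)) ?_ ?_ ?_ hW
    (Runs.seq (Runs.setInt' (33 + 2 * a) (s.int (33 + 2 * r)) ?_ ?_ ?_ hW' (Runs.writeVec
    (A := d + 8 + a * d) (v := fun j => s.real (d + 8 + r * d + j)) ?_ ?_ ?_ ?_)))))
    (le_of_eq (by ring))
  · simp [ha]
  · simp [hr]
  · omega
  · simp (disch := omega) [ha]
  · simp (disch := omega) [hr]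
  · omega
  · rw [add_mul] at hM'; omega
  · intro s' h
    simp (disch := omega) [h, ha]
  · intro j hj s' h h'
    simp (disch := omega) only [RealExp.eval, IntExp.eval, h, State.setInt_int_ne, hr]
    rw [h']
    · rfl
    · rcases har.eq_or_lt with rfl | h''
      · right; omega
      · have := mul_add_le_mul d h''; right; omega
  · intro s' h₁ h₂ h₃
    refine ⟨?_, fun x hx => ?_, fun x hx => ?_, fun i hi => ?_⟩
    · simp only [State.slot, h₁, Prod.mk.injEq]
      refine ⟨?_, ?_, State.vec_congr h₂⟩ <;> simp (disch := omega)
    · simp (disch := omega) [h₁]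
    · rw [h₃ x (by omega)]; rfl
    · refine State.slot_congr ?_ ?_ fun j hj => ?_
      · simp (disch := omega) [h₁]
      · simp (disch := omega) [h₁]
      · refine h₃ _ ?_
        rcases lt_or_gt_of_ne hi with h | h
        · have := mul_add_le_mul d h; left; omega
        · have := mul_add_le_mul d h; right; omega

/-- The limits leave room for `mx + 1` slots. -/
structure Fits (d mx M W : ℕ) : Prop where
  int : 34 + 2 * mx ≤ M
  real : d + 8 + (mx + 1) * d ≤ M
  word : mx + 1 ≤ W

theorem Fits.real_le {mx i : ℕ} (h : Fits d mx M W) (hi : i ≤ mx) : d + 8 + (i + 1) * d ≤ M :=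
  le_trans (by gcongr) h.real

/-- The program does what `insertRep` does, and leaves the slots outside of the list as they are. -/
theorem insertProg_runs {s : State} {b r mx : ℕ} {T : ℝ} {L : List (Rep ι d)} {g : Rep ι d}
    (hf : Fits d mx M W) (hb : s.int 4 = b) (hr : s.int 5 = r) (h6 : s.int 6 = b + L.length)
    (hle : b + L.length ≤ r) (hrm : r ≤ mx) (hT : s.real (d + 1) = T) (hL : HoldsList s b L)
    (hg : s.slot d r = g.data) (hw : (L.map Rep.weight).sum + g.weight ≤ W) (hcol : g.color ≤ W) :
    Runs sub M W (insertProg d) s (2 * mx + d + 9) fun s' =>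
      s'.int 6 = b + (insertRep T L g).length ∧ HoldsList s' b (insertRep T L g) ∧
      (∀ x < 32, x ≠ 6 → x ≠ 7 → s'.int x = s.int x) ∧ (∀ x < d + 8, s'.real x = s.real x) ∧
      ∀ i, (i < b ∨ b + (insertRep T L g).length ≤ i) → s'.slot d i = s.slot d i := by
  have hfi := hf.int
  have hfw := hf.word
  have hslot : ∀ v i, (s.setInt 7 v).slot d i = s.slot d i := fun v i =>
    State.slot_setInt s v i (by omega)
  have htest : ∀ (q : ℕ) (hq : q < L.length),
      ((mergeTest d (.var 7) (.var 5)).Holds (s.setInt 7 (b + q)) ↔ L[q].Mergeable T g) := by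
    intro q hq
    refine mergeTest_holds ?_ ?_ (by simpa using hT)
    · simp [hslot, hL q hq]
    · simp [hslot, hr, hg]
  have hsearch : Runs sub M W
      (.while (.and (.intLt (.var 7) (.var 6)) (.not (mergeTest d (.var 7) (.var 5)))) (.incr 7))
      (s.setInt 7 b) (2 * mx + 1) fun s' => ∃ q ≤ L.length, s' = s.setInt 7 (b + q) ∧
        (∀ (i : ℕ) (_ : i < q) (h : i < L.length), ¬ L[i].Mergeable T g) ∧
        ∀ (h : q < L.length), L[q].Mergeable T g := by
    refine (Runs.while (I := fun s' => ∃ q ≤ L.length, s' = s.setInt 7 (b + q) ∧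
        ∀ (i : ℕ) (_ : i < q) (h : i < L.length), ¬ L[i].Mergeable T g)
      (v := fun s' => b + L.length - s'.int 7) (t := 1) ?_ ⟨0, by simp⟩).mono ?_ ?_
    · rintro _ ⟨q, hq, rfl, hq'⟩ hb'
      rw [Test.Holds, Test.Holds, Test.Holds, Test.Holds] at hb'
      simp only [IntExp.eval, State.setInt_int_eq, ne_eq, Nat.reduceEqDiff, not_false_eq_true,
        State.setInt_int_ne, h6, not_le] at hb'
      obtain ⟨h₁, h₂⟩ := hb'
      have h₁ : q < L.length := by omega
      refine Runs.setInt' 7 (b + q + 1) rfl (by simp) (by omega) (by omega)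
        ⟨⟨q + 1, h₁, State.setInt_setInt _ _ _ _, fun i hi h => ?_⟩, by simp; omega⟩
      rcases Nat.lt_succ_iff_lt_or_eq.1 hi with hi | rfl
      · exact hq' i hi h
      · exact fun H => h₂ ((htest i h).2 H)
    · simp; omega
    · rintro _ ⟨⟨q, hq, rfl, hq'⟩, h₁⟩
      refine ⟨q, hq, rfl, hq', fun h => ?_⟩
      by_contra h₂
      refine h₁ ⟨by simp [h6]; omega, fun h₃ => h₂ ((htest q h).1 h₃)⟩
  refine Runs.le (Runs.then (t₁ := 1) (Runs.setInt' 7 b rfl hb (by omega) (by omega) rfl)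
    (t₂ := 2 * mx + 1 + (d + 6)) ?_) (by omega)
  rintro _ rfl
  refine Runs.then hsearch ?_
  rintro _ ⟨q, hq, rfl, h₁, h₂⟩
  refine Runs.le (Runs.ite (t₁ := 1) (t₂ := d + 4) (fun hb' => ?_) fun hb' => ?_) (by omega)
  · have hq : q < L.length := by simp [h6] at hb'; omega
    have hLq := hL q hq
    have hLq₂ : s.int (33 + 2 * (b + q)) = L[q].weight := (Prod.ext_iff.1 (Prod.ext_iff.1 hLq).2).1
    have hg₂ : s.int (33 + 2 * r) = g.weight := (Prod.ext_iff.1 (Prod.ext_iff.1 hg).2).1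
    rw [insertRep_eq_set hq (h₂ hq) fun i hi => h₁ i hi (by omega)]
    refine Runs.setInt' (33 + 2 * (b + q)) (L[q].weight + g.weight) (by simp) ?_ (by omega) ?_ ?_
    · simp (disch := omega) [hr, hLq₂, hg₂]
    · refine le_trans ?_ hw
      gcongr
      exact List.le_sum_of_mem (List.mem_map_of_mem (List.getElem_mem hq))
    · have hs : ∀ i v, i ≠ b + q →
          ((s.setInt 7 (b + q)).setInt (33 + 2 * (b + q)) v).slot d i = s.slot d i := by
        intro i v hi
        refine State.slot_congr ?_ ?_ fun j _ => rfl <;> simp (disch := omega)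
      refine ⟨by simp (disch := omega) [h6], fun i hi => ?_, fun x hx h6 h7 => ?_, fun x _ => rfl,
        fun i hi => hs i _ ?_⟩
      · rw [List.length_set] at hi
        by_cases hiq : i = q
        · subst hiq
          rw [List.getElem_set_self]
          simp only [State.slot, Rep.data, Prod.mk.injEq] at hLq ⊢
          refine ⟨?_, ?_, hLq.2.2⟩ <;> simp (disch := omega) [hLq.1]
        · rw [List.getElem_set_ne (Ne.symm hiq), hs _ _ (by omega), hL i hi]
      · simp (disch := omega)
      · rw [List.length_set] at hi; omega
  · have hq : q = L.length := by simp [h6] at hb'; omega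
    subst hq
    rw [insertRep_eq_append_of_not fun s' hs' => by
      obtain ⟨i, hi, rfl⟩ := List.getElem_of_mem hs'
      exact h₁ i hi hi]
    have hg₁ : (s.setInt 7 (b + L.length)).slot d r = g.data := by rw [hslot, hg]
    refine Runs.le (Runs.seq (t₂ := 1) ((copySlot_runs (d := d) (a := b + L.length) (r := r)
      (by simpa using hr) (by simpa using h6) hle (by omega) (hf.real_le (by omega))
      (by rw [hg₁]; exact hcol) (by rw [hg₁]; simp only [Rep.data]; omega)).imp ?_)) (by omega)
    rintro s' ⟨h₃, h₄, h₅, h₇⟩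
    have h₆ : s'.int 6 = b + L.length := by rw [h₄ 6 (by omega)]; simpa using h6
    refine Runs.setInt' 6 (b + L.length + 1) rfl (by simp [h₆]) (by omega) (by omega)
      ⟨by simp [add_assoc], ?_, fun x hx h6 h7 => ?_, fun x hx => ?_, fun i hi => ?_⟩
    · refine holdsList_append.2 ⟨fun i hi => ?_, fun i hi => ?_⟩
      · rw [State.slot_setInt _ _ _ (by omega), h₇ _ (by omega), hslot, hL i hi]
      · simp only [List.length_singleton, Nat.lt_one_iff] at hi
        subst hi
        rw [State.slot_setInt _ _ _ (by omega), add_zero, h₃, hslot, hg]; rfl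
    · rw [State.setInt_int_ne _ _ h6, h₄ x hx, State.setInt_int_ne _ _ h7]
    · rw [State.setInt_real, h₅ x hx]; rfl
    · rw [State.slot_setInt _ _ _ (by omega), h₇ _ (by simp at hi; omega), hslot]

end Programs

end ColorKMeans

namespace ColorKMeans

/-! ### Inserting many representatives and raising the threshold -/

/-- Inserts the representatives in the slots from the one with the number in cell `5` up to the end of
the list, whose number is in cell `3`. -/
def insertAllProg (d : ℕ) : Program :=
  .seq (.count 5 (.var 3) (insertProg d)) (.setInt (.lit 3) (.var 6))

/-- Computes in the real cell `d + 2` the smallest value of two representatives of the same color in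
the list between the slots with the numbers in the cells `4` and `3`; it is `-1` if there are none. -/
def minValueProg (d : ℕ) : Program :=
  .seq (.setReal (.lit (d + 2)) (.sub (.ofInt (.lit 0)) (.ofInt (.lit 1))))
  (.seq (.setInt (.lit 5) (.var 4))
  (.count 5 (.var 3) (.seq (.setInt (.lit 7) (.var 4)) (.count 7 (.var 5)
    (.ite (.and (.intEq (colorExp (.var 7)) (colorExp (.var 5)))
        (.or (.not (.realLe (.ofInt (.lit 0)) (.var (d + 2))))
          (.realLe (valueExp d (.var 7) (.var 5)) (.var (d + 2)))))
      (.setReal (.lit (d + 2)) (valueExp d (.var 7) (.var 5))) .skip)))))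

/-- Raises the threshold in the real cell `d + 1`. -/
def raiseProg (d : ℕ) : Program :=
  .seq (minValueProg d)
  (.ite (.realLe (.mul (.ofInt (.lit 2)) (.var (d + 1))) (.var (d + 2)))
    (.setReal (.lit (d + 1)) (.var (d + 2)))
    (.setReal (.lit (d + 1)) (.mul (.ofInt (.lit 2)) (.var (d + 1)))))

section Programs

variable {sub : State → ℕ → State → Prop} {M W : ℕ} {ι : Type} {d : ℕ}

theorem insertRep_weight {T : ℝ} {L : List (Rep ι d)} {g : Rep ι d} :
    ((insertRep T L g).map Rep.weight).sum = (L.map Rep.weight).sum + g.weight := by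
  induction L with
  | nil => simp [insertRep]
  | cons s L ih => rw [insertRep]; split_ifs <;> simp [ih] <;> ring

theorem foldl_insertRep_weight {T : ℝ} {L : List (Rep ι d)} (I : List (Rep ι d)) :
    ((I.foldl (insertRep T) L).map Rep.weight).sum =
      (L.map Rep.weight).sum + (I.map Rep.weight).sum := by
  induction I generalizing L with
  | nil => simp
  | cons g I ih => simp [ih, insertRep_weight]; ring

/-- The list `L` may grow into the slots of the representatives that are inserted, but only into those
of the ones that were inserted before. -/
theorem insertAllProg_runs {s : State} {b r mx : ℕ} {T : ℝ} {L I : List (Rep ι d)}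
    (hf : Fits d mx M W) (h3 : s.int 3 = r + I.length) (hb : s.int 4 = b) (hr : s.int 5 = r)
    (h6 : s.int 6 = b + L.length) (hle : b + L.length ≤ r) (hrm : r + I.length ≤ mx)
    (hT : s.real (d + 1) = T) (hL : HoldsList s b L) (hI : HoldsList s r I)
    (hw : (L.map Rep.weight).sum + (I.map Rep.weight).sum ≤ W) (hcol : ∀ g ∈ I, g.color ≤ W) :
    Runs sub M W (insertAllProg d) s (I.length * (2 * mx + d + 11) + 2) fun s' =>
      s'.int 3 = b + (I.foldl (insertRep T) L).length ∧ HoldsList s' b (I.foldl (insertRep T) L) ∧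
      (∀ x < 32, x ≠ 3 → x ≠ 5 → x ≠ 6 → x ≠ 7 → s'.int x = s.int x) ∧
      (∀ x < d + 8, s'.real x = s.real x) ∧ ∀ i < b, s'.slot d i = s.slot d i := by
  have hfi := hf.int
  have hfw := hf.word
  have hlen : ∀ c, b + ((I.take (c - r)).foldl (insertRep T) L).length ≤ r + (c - r) := fun c => by
    have := foldl_insertRep_length_le (T := T) (L := L) (I.take (c - r))
    have := List.length_take_le (c - r) I
    omega
  refine Runs.le (Runs.then (Runs.count (n := r + I.length) (i₀ := r) (t := 2 * mx + d + 9)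
    (I := fun c s' => s'.int 6 = b + ((I.take (c - r)).foldl (insertRep T) L).length ∧
      HoldsList s' b ((I.take (c - r)).foldl (insertRep T) L) ∧
      (∀ x < 32, x ≠ 5 → x ≠ 6 → x ≠ 7 → s'.int x = s.int x) ∧
      (∀ x < d + 8, s'.real x = s.real x) ∧ ∀ i, (i < b ∨ c ≤ i) → s'.slot d i = s.slot d i)
    (by omega) (by omega) ?_ hr (by omega) ?_ ?_) (t₂ := 1) ?_) (by simp)
  · rintro i s' ⟨-, -, h, -⟩
    simpa [h3] using h 3 (by omega) (by omega) (by omega) (by omega)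
  · simp [h6, hL]
  · rintro c s' hc hc' h5 ⟨h₁, h₂, h₃, h₄, h₅⟩
    have hci : c - r < I.length := by omega
    have hg : s'.slot d c = (I[c - r]).data := by
      rw [h₅ c (by omega), ← hI (c - r) hci]; congr 1; omega
    have hw' : (((I.take (c - r)).foldl (insertRep T) L).map Rep.weight).sum + (I[c - r]).weight
        ≤ W := by
      rw [foldl_insertRep_weight, add_assoc]
      refine le_trans ?_ hw
      gcongr
      have e : (I.take (c - r + 1)) = I.take (c - r) ++ [I[c - r]] := List.take_succ_eq_append_getElem hci
      have : ((I.take (c - r + 1)).map Rep.weight).sum ≤ (I.map Rep.weight).sum :=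
        ((List.take_sublist _ _).map _).sum_le_sum (by simp)
      rw [e, List.map_append, List.sum_append, List.map_singleton, List.sum_singleton] at this
      exact this
    have hl := hlen c
    refine (insertProg_runs hf (by rw [h₃ 4] <;> omega) h5 h₁ (by omega) (by omega)
      (by rw [h₄ _ (by omega), hT]) h₂ hg hw' (hcol _ (List.getElem_mem hci))).imp ?_
    rintro s'' ⟨g₁, g₂, g₃, g₄, g₅⟩
    have e : c + 1 - r = c - r + 1 := by omega
    have hfold : (I.take (c + 1 - r)).foldl (insertRep T) L =
        insertRep T ((I.take (c - r)).foldl (insertRep T) L) I[c - r] := by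
      rw [e, List.take_succ_eq_append_getElem hci, List.foldl_append]; rfl
    refine ⟨by rw [g₃ 5 (by omega) (by omega) (by omega), h5], ?_⟩
    rw [hfold]
    refine ⟨by simp (disch := omega) [g₁], g₂.congr fun i _ _ => State.slot_setInt _ _ _ (by omega),
      fun x hx h5 h6 h7 => ?_, fun x hx => ?_, fun i hi => ?_⟩
    · rw [State.setInt_int_ne _ _ h5, g₃ x hx h6 h7, h₃ x hx h5 h6 h7]
    · rw [State.setInt_real, g₄ x hx, h₄ x hx]
    · have := hlen (c + 1)
      rw [hfold] at this
      rw [State.slot_setInt _ _ _ (by omega), g₅ i (by omega), h₅ i (by omega)]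
  · rintro s' ⟨-, h₁, h₂, h₃, h₄, h₅⟩
    rw [show r + I.length - r = I.length by omega, List.take_length] at h₁ h₂
    have := hlen (r + I.length)
    rw [show r + I.length - r = I.length by omega, List.take_length] at this
    refine Runs.setInt' 3 _ rfl h₁ (by omega) (by omega) ⟨by simp,
      h₂.congr fun i _ _ => State.slot_setInt _ _ _ (by omega), fun x hx h3 h5 h6 h7 => ?_,
      h₄, fun i hi => ?_⟩
    · rw [State.setInt_int_ne _ _ h3, h₃ x hx h5 h6 h7]
    · rw [State.slot_setInt _ _ _ (by omega), h₅ i (by omega)]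

/-- The pair `a < a'` of positions in a list comes before the pair `(i, r)`, in the order in which the
pairs are inspected. -/
def Inspected {n : ℕ} (r i : ℕ) (a a' : Fin n) : Prop :=
  a < a' ∧ ((a' : ℕ) < r ∨ (a' : ℕ) = r ∧ (a : ℕ) < i)

/-- `V` is the smallest value of an inspected pair of the same color, or `-1` if there is none. -/
def IsMinValue (L : List (Rep ι d)) (r i : ℕ) (V : ℝ) : Prop :=
  (∀ a a' : Fin L.length, Inspected r i a a' → (L.get a).color = (L.get a').color →
    V ≤ (L.get a).value (L.get a')) ∧
  ((V = -1 ∧ ∀ a a' : Fin L.length, Inspected r i a a' → (L.get a).color ≠ (L.get a').color) ∨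
    (0 ≤ V ∧ ∃ a a' : Fin L.length, Inspected r i a a' ∧ (L.get a).color = (L.get a').color ∧
      (L.get a).value (L.get a') = V))

theorem Rep.value_nonneg (g h : Rep ι d) : 0 ≤ g.value h := by rw [value]; positivity

theorem inspected_succ_iff {n r i : ℕ} {a a' : Fin n} (hi : i < r) :
    Inspected r (i + 1) a a' ↔ Inspected r i a a' ∨ ((a' : ℕ) = r ∧ (a : ℕ) = i) := by
  simp only [Inspected, Fin.lt_def]; omega

theorem IsMinValue.row {L : List (Rep ι d)} {r : ℕ} {V : ℝ} (h : IsMinValue L r r V) :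
    IsMinValue L (r + 1) 0 V := by
  have e : ∀ a a' : Fin L.length, Inspected (r + 1) 0 a a' ↔ Inspected r r a a' := fun a a' => by
    simp only [Inspected, Fin.lt_def]; omega
  simpa only [IsMinValue, e] using h

theorem IsMinValue.keep {L : List (Rep ι d)} {r i : ℕ} {V : ℝ} (h : IsMinValue L r i V)
    (hi : i < r) (hr : r < L.length)
    (hk : L[i].color = L[r].color → 0 ≤ V ∧ V ≤ L[i].value L[r]) : IsMinValue L r (i + 1) V := by
  obtain ⟨h₁, h₂⟩ := h
  refine ⟨fun a a' ha hc => ?_, ?_⟩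
  · rcases (inspected_succ_iff hi).1 ha with ha | ⟨h₃, h₄⟩
    · exact h₁ a a' ha hc
    · obtain ⟨a, ha'⟩ := a
      obtain ⟨a', ha''⟩ := a'
      subst h₃ h₄
      exact (hk hc).2
  · rcases h₂ with ⟨h₂, h₃⟩ | ⟨h₂, a, a', h₃, h₄⟩
    · refine .inl ⟨h₂, fun a a' ha => ?_⟩
      rcases (inspected_succ_iff hi).1 ha with ha | ⟨h₄, h₅⟩
      · exact h₃ a a' ha
      · obtain ⟨a, ha'⟩ := a
        obtain ⟨a', ha''⟩ := a'
        subst h₄ h₅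
        intro hc
        have := (hk hc).1
        linarith
    · exact .inr ⟨h₂, a, a', (inspected_succ_iff hi).2 (.inl h₃), h₄⟩

theorem IsMinValue.replace {L : List (Rep ι d)} {r i : ℕ} {V : ℝ} (h : IsMinValue L r i V)
    (hi : i < r) (hr : r < L.length) (hc : L[i].color = L[r].color)
    (hV : 0 ≤ V → L[i].value L[r] ≤ V) : IsMinValue L r (i + 1) (L[i].value L[r]) := by
  obtain ⟨h₁, h₂⟩ := h
  refine ⟨fun a a' ha hc' => ?_, .inr ⟨Rep.value_nonneg _ _, ⟨i, by omega⟩, ⟨r, hr⟩,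
    (inspected_succ_iff hi).2 (.inr ⟨rfl, rfl⟩), hc, rfl⟩⟩
  rcases (inspected_succ_iff hi).1 ha with ha | ⟨h₃, h₄⟩
  · rcases h₂ with ⟨-, h₂⟩ | ⟨h₂, -⟩
    · exact absurd hc' (h₂ a a' ha)
    · exact (hV h₂).trans (h₁ a a' ha hc')
  · obtain ⟨a, ha'⟩ := a
    obtain ⟨a', ha''⟩ := a'
    subst h₃ h₄
    exact le_rfl

theorem minValueProg_runs {s : State} {b mx : ℕ} {L : List (Rep ι d)}
    (hf : Fits d mx M W) (h3 : s.int 3 = b + L.length) (hb : s.int 4 = b)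
    (hm : b + L.length ≤ mx) (hL : HoldsList s b L) :
    Runs sub M W (minValueProg d) s (mx * (4 * mx + 4) + 3) fun s' =>
      IsMinValue L L.length 0 (s'.real (d + 2)) ∧ (∀ x, x ≠ 5 → x ≠ 7 → s'.int x = s.int x) ∧
      (∀ x, x ≠ d + 2 → s'.real x = s.real x) := by
  have hfi := hf.int
  have hfr := hf.real
  have hfw := hf.word
  have hslot : ∀ s' : State, (∀ x, x ≠ 5 → x ≠ 7 → s'.int x = s.int x) →
      (∀ x, x ≠ d + 2 → s'.real x = s.real x) → ∀ i, s'.slot d i = s.slot d i :=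
    fun s' h h' i => State.slot_congr (h _ (by omega) (by omega)) (h _ (by omega) (by omega))
      fun j _ => h' _ (by omega)
  refine Runs.le (Runs.then (t₁ := 1) (Runs.setReal' (d + 2) (-1) rfl (by simp) (by omega) rfl)
    (t₂ := 1 + (L.length * (4 * mx + 4) + 1)) ?_) (by nlinarith)
  rintro _ rfl
  refine Runs.then (t₁ := 1) (Runs.setInt' 5 b rfl (by simpa using hb) (by omega) (by omega) rfl) ?_
  rintro _ rfl
  refine ((Runs.count (n := b + L.length) (i₀ := b) (t := 4 * mx + 2)
    (I := fun r s' => IsMinValue L (r - b) 0 (s'.real (d + 2)) ∧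
      (∀ x, x ≠ 5 → x ≠ 7 → s'.int x = s.int x) ∧ (∀ x, x ≠ d + 2 → s'.real x = s.real x))
    (by omega) (by omega) ?_ (by simp) (by omega) ?_ ?_).mono (by simp) ?_)
  · rintro i s' ⟨-, h, -⟩
    simpa [h3] using h 3 (by omega) (by omega)
  · refine ⟨⟨fun a a' h => ?_, .inl ⟨by simp, fun a a' h => ?_⟩⟩, fun x h₁ h₂ => by simp [h₁],
      fun x h => by simp [h]⟩ <;>
    simp [Inspected] at h
  · rintro r s' hr hr' h5 ⟨h₁, h₂, h₃⟩
    refine Runs.le (Runs.then (t₁ := 1) (Runs.setInt' 7 b rfl (by simpa [hb] using h₂ 4) (by omega)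
      (by omega) rfl) (t₂ := (r - b) * (2 + 2) + 1) ?_) (by omega)
    rintro _ rfl
    refine ((Runs.count (n := r) (i₀ := b) (t := 2)
      (I := fun i s' => IsMinValue L (r - b) (i - b) (s'.real (d + 2)) ∧ s'.int 5 = r ∧
        (∀ x, x ≠ 5 → x ≠ 7 → s'.int x = s.int x) ∧ (∀ x, x ≠ d + 2 → s'.real x = s.real x))
      (by omega) (by omega) ?_ (by simp) (by omega) ?_ ?_).imp ?_)
    · rintro i s' ⟨-, h, -⟩
      simpa using h
    · refine ⟨by simpa using h₁, by simpa using h5, fun x hx hx' => ?_, h₃⟩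
      rw [State.setInt_int_ne _ _ hx', h₂ x hx hx']
    · rintro i s₁ hi hi' h7 ⟨g₁, g₂, g₃, g₄⟩
      have e₁ : i - b < r - b := by omega
      have e₂ : r - b < L.length := by omega
      have hs₁ : s₁.slot d i = L[i - b].data := by
        rw [hslot s₁ g₃ g₄, ← hL (i - b) (by omega)]; congr 1; omega
      have hs₂ : s₁.slot d r = L[r - b].data := by
        rw [hslot s₁ g₃ g₄, ← hL (r - b) (by omega)]; congr 1; omega
      have hv : (valueExp d (.var 7) (.var 5)).eval s₁ = L[i - b].value L[r - b] :=
        valueExp_eval (by simpa [h7] using hs₁) (by simpa [g₂] using hs₂)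
      have hc₁ : s₁.int (32 + 2 * i) = L[i - b].color := (Prod.ext_iff.1 hs₁).1
      have hc₂ : s₁.int (32 + 2 * r) = L[r - b].color := (Prod.ext_iff.1 hs₂).1
      have e₃ : i + 1 - b = i - b + 1 := by omega
      refine Runs.le (Runs.ite (t₁ := 1) (t₂ := 1) (fun h => ?_) (fun h => ?_)) (by simp)
      · refine Runs.setReal' (d + 2) _ rfl hv (by omega) ⟨by simpa using h7, ?_, by simpa using g₂,
          fun x hx hx' => ?_, fun x hx => ?_⟩
        · simp only [Test.Holds, hv, IntExp.eval, RealExp.eval, h7, g₂, hc₁, hc₂] at h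
          rw [e₃]
          simp only [State.setInt_real, State.setReal_real_eq]
          refine g₁.replace e₁ e₂ (le_antisymm h.1.1 h.1.2) fun hV => ?_
          by_contra hcon
          exact h.2 ⟨by simpa using hV, hcon⟩
        · simp [hx, hx', g₃]
        · simp [hx, g₄]
      · refine Runs.skip ⟨by simpa using h7, ?_, by simpa using g₂, fun x hx hx' => ?_,
          fun x hx => g₄ x hx⟩
        · simp only [Test.Holds, hv, IntExp.eval, RealExp.eval, h7, g₂, hc₁, hc₂] at h
          rw [e₃]
          simp only [State.setInt_real]
          refine g₁.keep e₁ e₂ fun hc => ?_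
          have h' : ¬ ¬ (¬ ¬ ((0 : ℕ) : ℝ) ≤ s₁.real (d + 2) ∧
              ¬ L[i - b].value L[r - b] ≤ s₁.real (d + 2)) := fun h' => h ⟨⟨hc.le, hc.ge⟩, h'⟩
          rw [not_not, not_not] at h'
          exact ⟨by simpa using h'.1, (not_le.1 h'.2).le⟩
        · simp [hx, hx', g₃]
    · rintro s₁ ⟨-, g₁, g₂, g₃, g₄⟩
      refine ⟨g₂, ?_, fun x hx hx' => ?_, fun x hx => g₄ x hx⟩
      · rw [show r + 1 - b = r - b + 1 by omega]
        exact g₁.row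
      · simp [hx, hx', g₃]
  · rintro s' ⟨-, h₁, h₂, h₃⟩
    rw [show b + L.length - b = L.length by omega] at h₁
    exact ⟨h₁, h₂, h₃⟩

theorem raiseProg_runs {s : State} {b mx : ℕ} {T : ℝ} {L : List (Rep ι d)}
    (hf : Fits d mx M W) (h3 : s.int 3 = b + L.length) (hb : s.int 4 = b)
    (hm : b + L.length ≤ mx) (hL : HoldsList s b L) (hT : s.real (d + 1) = T) :
    Runs sub M W (raiseProg d) s (mx * (4 * mx + 4) + 5) fun s' =>
      Raised T L (s'.real (d + 1)) ∧ (∀ x, x ≠ 5 → x ≠ 7 → s'.int x = s.int x) ∧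
      (∀ x, x ≠ d + 1 → x ≠ d + 2 → s'.real x = s.real x) := by
  have hfr := hf.real
  refine Runs.le (Runs.then (minValueProg_runs hf h3 hb hm hL) (t₂ := 2) ?_) (by omega)
  rintro s' ⟨⟨h₁, h₂⟩, h₃, h₄⟩
  have hT' : s'.real (d + 1) = T := by rw [h₄ _ (by omega), hT]
  have hinsp : ∀ a a' : Fin L.length, Inspected L.length 0 a a' ↔ a < a' := fun a a' => by
    simp [Inspected]
  simp only [hinsp] at h₁ h₂
  have key : Raised T L (max (2 * T) (s'.real (d + 2))) := by
    refine ⟨_, rfl, List.pairwise_iff_get.2 fun a a' h => h₁ a a' h, fun hc h => ?_⟩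
    rcases h₂ with ⟨-, h₂⟩ | ⟨-, a, a', h₂, h₅, h₆⟩
    · exact hc (List.pairwise_iff_get.2 h₂)
    · exact absurd (List.pairwise_iff_get.1 h a a' h₂ h₅) h₆.not_gt
  refine Runs.le (Runs.ite (t₁ := 1) (t₂ := 1) (fun h => ?_) (fun h => ?_)) (by simp)
  · refine Runs.setReal' (d + 1) _ rfl rfl (by omega) ⟨?_, h₃, fun x hx hx' => ?_⟩
    · have h : 2 * T ≤ s'.real (d + 2) := by simpa [hT'] using h
      simpa [max_eq_right h] using key
    · simp [hx, h₄ x hx']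
  · refine Runs.setReal' (d + 1) _ rfl rfl (by omega) ⟨?_, h₃, fun x hx hx' => ?_⟩
    · have h : s'.real (d + 2) < 2 * T := by simpa [hT'] using h
      simpa [max_eq_left h.le, hT'] using key
    · simp [hx, h₄ x hx']

end Programs

end ColorKMeans

namespace ColorKMeans

/-! ### The program for the items of the stream -/

/-- The number of representatives that are kept of the at most `2 ^ j` points of epoch `j`.  It is a
real number, since the program cannot round it. -/
noncomputable def capReal (d k l : ℕ) (ε : ℝ) (j : ℕ) : ℝ :=
  2 * l * k * (j + 1) * (1224 * d * (j + 1) / ε) ^ d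

/-- The constant `1224` is `6 * 204`, from `6 * Y * d` with `Y = 204 * (j + 1) / ε`. -/
theorem capReal_capacity {d k l : ℕ} {ε : ℝ} (hd : 1 ≤ d) (hk : 1 ≤ k) (hl : 1 ≤ l) (hε : 0 < ε)
    (hε1 : ε < 1) (j : ℕ) :
    Capacity d k l j (ε ^ 2 / 144) (204 * (j + 1) / ε) (capReal d k l ε j) where
  d_pos := hd
  k_pos := hk
  l_pos := hl
  δ_pos := by positivity
  δ_le := by nlinarith
  one_le := by
    rw [le_div_iff₀ hε]
    have : (0 : ℝ) ≤ j := Nat.cast_nonneg j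
    linarith
  le_sq := by
    have : (0 : ℝ) ≤ j := Nat.cast_nonneg j
    have h : ε ^ 2 / 144 * (204 * (j + 1) / ε) ^ 2 = 289 * ((j : ℝ) + 1) ^ 2 := by
      field_simp; norm_num
    rw [h]; nlinarith
  le_cap := le_of_eq (by
    rw [capReal, show 6 * (204 * ((j : ℝ) + 1) / ε) * d = 1224 * d * (j + 1) / ε by ring]; ring)

theorem capReal_nonneg {d k l : ℕ} {ε : ℝ} (hε : 0 < ε) (j : ℕ) : 0 ≤ capReal d k l ε j := by
  rw [capReal]; positivity

theorem capReal_mono {d k l : ℕ} {ε : ℝ} (hε : 0 < ε) {i j : ℕ} (h : i ≤ j) :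
    capReal d k l ε i ≤ capReal d k l ε j := by
  have : (i : ℝ) ≤ j := by exact_mod_cast h
  rw [capReal, capReal]; gcongr

/-- Computes `capReal` for the epoch with the number in cell `8`. -/
def capExp (d : ℕ) : RealExp :=
  .mul (.ofInt (.mul (.mul (.mul (.lit 2) (.var 1)) (.var 0)) (.add (.var 8) (.lit 1))))
    (powExp (.div (.ofInt (.mul (.lit (1224 * d)) (.add (.var 8) (.lit 1)))) (.var 0)) d)

theorem capExp_eval {s : State} {d k l j : ℕ} {ε : ℝ} (h0 : s.int 0 = k) (h1 : s.int 1 = l)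
    (h8 : s.int 8 = j) (h : s.real 0 = ε) : (capExp d).eval s = capReal d k l ε j := by
  simp [capExp, capReal, h0, h1, h8, h]

/-- Stores the point that has just been read as the last representative of the list. -/
def storeProg (d : ℕ) : Program :=
  .seq (.setInt (.add (.lit 32) (.mul (.lit 2) (.var 3))) (.var 2))
  (.seq (.setInt (.add (.lit 33) (.mul (.lit 2) (.var 3))) (.lit 1))
  (writeVec (pointExp d (.var 3)) (fun a => .get (.lit (1 + a))) d))

/-- Raises the threshold and rebuilds the list if it has become too long. -/
def shrinkProg (d : ℕ) : Program :=
  .ite (.not (.realLe (.ofInt (.sub (.var 3) (.var 4))) (capExp d)))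
    (.seq (raiseProg d) (.seq (.setInt (.lit 5) (.var 4)) (.seq (.setInt (.lit 6) (.var 4))
      (insertAllProg d))))
    .skip

/-- Counts the points of the epoch and begins a new epoch, of twice as many points and with an empty
list behind the present one, when there are enough. -/
def epochProg (d : ℕ) : Program :=
  .seq (.incr 9) (.ite (.intEq (.var 9) (.var 10))
    (.seq (.setInt (.lit 4) (.var 3)) (.seq (.setReal (.lit (d + 1)) (.ofInt (.lit 0)))
      (.seq (.setInt (.lit 9) (.lit 0)) (.seq (.setInt (.lit 10) (.mul (.lit 2) (.var 10)))
        (.incr 8)))))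
    .skip)

/-- Inserts the point that has just been read into the summary of the present epoch. -/
def absorbProg (d : ℕ) : Program :=
  .seq (storeProg d) (.seq (.setInt (.lit 5) (.var 3)) (.seq (.setInt (.lit 6) (.var 3))
    (.seq (.incr 3) (.seq (insertAllProg d) (shrinkProg d)))))

/-- What is done for every item of the stream.  The integer cells `0` and `1` hold `k` and `l`, the
cells `4` and `3` the limits of the list of representatives of the present epoch, the cells `8`, `9`
and `10` the number of the epoch, of its points up to now, and of its points in total.  The real
cell `0` holds `ε` and the real cell `d + 1` the threshold. -/
def updateProg (d : ℕ) : Program := .seq (absorbProg d) (epochProg d)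

section Programs

variable {sub : State → ℕ → State → Prop} {M W : ℕ} {ι : Type} {d : ℕ}

theorem storeProg_runs {s : State} {m mx : ℕ} (hf : Fits d mx M W) (h3 : s.int 3 = m)
    (hm : m ≤ mx) (hW : s.int 2 ≤ W) :
    Runs sub M W (storeProg d) s (d + 3) fun s' => s'.slot d m = (s.int 2, 1, s.vec d 1) ∧
      (∀ x < 32, s'.int x = s.int x) ∧ (∀ x < d + 8, s'.real x = s.real x) ∧
      ∀ i < m, s'.slot d i = s.slot d i := by
  have hfi := hf.int
  have hfr := hf.real_le hm
  have hfw := hf.word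
  rw [add_mul] at hfr
  refine Runs.le (Runs.then (t₁ := 1) (Runs.setInt' (32 + 2 * m) (s.int 2) (by simp [h3]) rfl
    (by omega) hW rfl) (t₂ := 1 + (d + 1)) ?_) (by omega)
  rintro _ rfl
  refine Runs.then (t₁ := 1) (Runs.setInt' (33 + 2 * m) 1 (by simp (disch := omega) [h3]) rfl
    (by omega) (by omega) rfl) ?_
  rintro _ rfl
  refine Runs.writeVec (A := d + 8 + m * d) (v := fun j => s.real (1 + j)) (by omega) ?_ ?_ ?_
  · intro s' h
    simp (disch := omega) [h, h3]
  · intro j hj s' h h'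
    simp only [RealExp.eval, IntExp.eval]
    rw [h' _ (by left; omega)]; rfl
  · intro s' h₁ h₂ h₃
    refine ⟨?_, fun x hx => ?_, fun x hx => ?_, fun i hi => ?_⟩
    · simp only [State.slot, h₁, Prod.mk.injEq]
      refine ⟨?_, ?_, State.vec_congr h₂⟩ <;> simp (disch := omega)
    · simp (disch := omega) [h₁]
    · rw [h₃ x (by omega)]; rfl
    · refine State.slot_congr ?_ ?_ fun j hj => ?_
      · simp (disch := omega) [h₁]
      · simp (disch := omega) [h₁]
      · refine h₃ _ ?_
        have := mul_add_le_mul d hi; left; omega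

theorem holdsList_map_resetSlack {s : State} {a : ℕ} {x : ι → EuclideanSpace ℝ (Fin d)}
    {L : List (Rep ι d)} (h : HoldsList s a L) : HoldsList s a (L.map (Rep.resetSlack x)) := by
  intro i hi
  rw [List.length_map] at hi
  rw [h i hi, List.getElem_map]; rfl

theorem absorbProg_runs {s : State} {b k l j mx : ℕ} {ε T : ℝ} {L : List (Rep ι d)}
    {x : ι → EuclideanSpace ℝ (Fin d)} {f : ι → ℕ} {p : ι} (hf : Fits d mx M W)
    (h0 : s.int 0 = k) (h1 : s.int 1 = l) (h8 : s.int 8 = j) (hε : s.real 0 = ε)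
    (h2 : s.int 2 = f p) (hx : s.vec d 1 = x p)
    (h3 : s.int 3 = b + L.length) (hb : s.int 4 = b) (hT : s.real (d + 1) = T)
    (hm : b + L.length + 1 ≤ mx) (hL : HoldsList s b L)
    (hw : (L.map Rep.weight).sum + 1 ≤ W) (hcol : ∀ g ∈ L, g.color ≤ W) (hcol' : f p ≤ W) :
    Runs sub M W (absorbProg d) s (6 * mx * mx + (d + 17) * mx + 2 * d + 40) fun s' =>
      ∃ T' L', UpdateRel x f (capReal d k l ε j) T L p T' L' ∧ s'.int 3 = b + L'.length ∧
        HoldsList s' b L' ∧ s'.real (d + 1) = T' ∧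
        (∀ x < 32, x ≠ 3 → x ≠ 5 → x ≠ 6 → x ≠ 7 → s'.int x = s.int x) ∧
        s'.real 0 = s.real 0 ∧ ∀ i < b, s'.slot d i = s.slot d i := by
  have hfi := hf.int
  have hfw := hf.word
  refine Runs.le (Runs.then (storeProg_runs hf h3 (by omega) (h2 ▸ hcol'))
    (t₂ := 3 + ((2 * mx + d + 13) + (6 * mx * mx + (d + 15) * mx + 12))) ?_) (by nlinarith)
  rintro s₁ ⟨hs₁, hs₂, hs₃, hs₄⟩
  refine Runs.le (t₁ := 1 + (1 + (1 + ((2 * mx + d + 13) + (6 * mx * mx + (d + 15) * mx + 12)))))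
    ?_ (by omega)
  refine Runs.then (t₁ := 1) (Runs.setInt' 5 (b + L.length) rfl (by simp [hs₂, h3]) (by omega)
    (by omega) rfl) ?_
  rintro _ rfl
  refine Runs.then (t₁ := 1) (Runs.setInt' 6 (b + L.length) rfl (by simp [hs₂, h3]) (by omega)
    (by omega) rfl) ?_
  rintro _ rfl
  refine Runs.then (t₁ := 1) (Runs.setInt' 3 (b + L.length + 1) rfl (by simp [hs₂, h3]) (by omega)
    (by omega) rfl) ?_
  rintro _ rfl
  set s₂ := ((s₁.setInt 5 (b + L.length)).setInt 6 (b + L.length)).setInt 3 (b + L.length + 1)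
    with hs₂'
  have hslot : ∀ i, s₂.slot d i = s₁.slot d i := fun i => by simp [hs₂']
  set L₁ := insertRep T L (Rep.single x f p) with hL₁
  have hlen₁ : L₁.length ≤ L.length + 1 := length_insertRep_le
  refine Runs.then (Runs.le (insertAllProg_runs (s := s₂) (b := b) (r := b + L.length) (mx := mx) (T := T)
    (L := L) (I := [Rep.single x f p]) hf (by simp [hs₂', add_assoc]) (by simp [hs₂', hs₂, hb])
    (by simp [hs₂']) (by simp [hs₂']) le_rfl (by simp; omega) (by simp [hs₂', hs₃, hT])
    (fun i hi => ?_) (fun i hi => ?_) (by simpa [Rep.single, Rep.weight] using hw)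
    (by simpa [Rep.single] using hcol')) (by simp)) ?_
  · rw [hslot, hs₄ _ (by omega), hL i hi]
  · obtain rfl : i = 0 := by simpa using hi
    rw [hslot, add_zero, hs₁]; simp [Rep.data, Rep.single, Rep.weight, h2, hx]
  rintro s₃ ⟨g₁, g₂, g₃, g₄, g₅⟩
  simp only [List.foldl_cons, List.foldl_nil] at g₁ g₂
  rw [← hL₁] at g₁ g₂
  have i₀ : ∀ x < 32, x ≠ 3 → x ≠ 5 → x ≠ 6 → x ≠ 7 → s₃.int x = s.int x := by
    intro x hx hx3 hx5 hx6 hx7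
    rw [g₃ x hx hx3 hx5 hx6 hx7, hs₂']
    simp [hx3, hx5, hx6, hs₂ x hx]
  have r₀ : ∀ x < d + 8, s₃.real x = s.real x := fun x hx => by
    rw [g₄ x hx, hs₂']; simp [hs₃ x hx]
  have sl : ∀ i < b, s₃.slot d i = s.slot d i := fun i hi => by
    rw [g₅ i hi, hslot, hs₄ i (by omega)]
  have hcap : (capExp d).eval s₃ = capReal d k l ε j := capExp_eval
    (by rw [i₀, h0] <;> omega) (by rw [i₀, h1] <;> omega) (by rw [i₀, h8] <;> omega)
    (by rw [r₀ 0 (by omega), hε])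
  have h3₄ : s₃.int 3 - s₃.int 4 = L₁.length := by
    rw [g₁, i₀ 4 (by omega) (by omega) (by omega) (by omega) (by omega), hb]; omega
  have hT₃ : s₃.real (d + 1) = T := by rw [r₀ _ (by omega), hT]
  have hb₃ : s₃.int 4 = b := by
    rw [i₀ 4 (by omega) (by omega) (by omega) (by omega) (by omega), hb]
  refine Runs.le (Runs.ite (t₁ := 6 * mx * mx + (d + 15) * mx + 10) (t₂ := 1) (fun h => ?_)
    (fun h => ?_)) (by omega)
  · simp only [Test.Holds, RealExp.eval, IntExp.eval, hcap, h3₄, not_le] at h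
    refine Runs.le (Runs.then (raiseProg_runs hf g₁ hb₃ (by omega) g₂ hT₃)
      (t₂ := 1 + (1 + (mx * (2 * mx + d + 11) + 2))) ?_) (by nlinarith)
    rintro s₄ ⟨k₁, k₂, k₃⟩
    have hb₄ : s₄.int 4 = b := by rw [k₂ 4 (by omega) (by omega), hb₃]
    refine Runs.then (t₁ := 1) (Runs.setInt' 5 b rfl hb₄ (by omega) (by omega) rfl) ?_
    rintro _ rfl
    refine Runs.then (t₁ := 1) (Runs.setInt' 6 b rfl (by simpa using hb₄) (by omega) (by omega)
      rfl) ?_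
    rintro _ rfl
    have hslot₄ : ∀ i, ((s₄.setInt 5 b).setInt 6 b).slot d i = s₃.slot d i := fun i => by
      rw [State.slot_setInt _ _ _ (by omega), State.slot_setInt _ _ _ (by omega)]
      exact State.slot_congr (k₂ _ (by omega) (by omega)) (k₂ _ (by omega) (by omega))
        fun j _ => k₃ _ (by omega) (by omega)
    refine (insertAllProg_runs (b := b) (r := b) (mx := mx) (T := s₄.real (d + 1))
      (L := ([] : List (Rep ι d))) (I := L₁.map (Rep.resetSlack x)) hf
      (by simp [k₂, g₁]) (by simp [hb₄]) (by simp) (by simp) (by simp) (by simp; omega) (by simp)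
      (by intro i hi; simp at hi)
      (holdsList_map_resetSlack (g₂.congr fun i _ _ => hslot₄ i)) ?_ ?_).mono ?_ ?_
    · have e : (L₁.map (Rep.resetSlack x)).map Rep.weight = L₁.map Rep.weight := by
        rw [List.map_map]; rfl
      rw [e, insertRep_weight]
      simpa [Rep.single, Rep.weight] using hw
    · intro g hg
      obtain ⟨r, hr, rfl⟩ := List.mem_map.1 hg
      rcases mem_insertRep hr with hr | ⟨r', hr', -, rfl⟩ | rfl
      · exact hcol r hr
      · exact hcol r' hr'
      · exact hcol'
    · rw [List.length_map]
      gcongr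
      omega
    · rintro s₅ ⟨m₁, m₂, m₃, m₄, m₅⟩
      refine ⟨_, _, .inr ⟨h, k₁, rfl⟩, m₁, m₂, ?_, fun x hx hx3 hx5 hx6 hx7 => ?_, ?_,
        fun i hi => ?_⟩
      · rw [m₄ _ (by omega)]; simp
      · rw [m₃ x hx hx3 hx5 hx6 hx7, State.setInt_int_ne _ _ hx6, State.setInt_int_ne _ _ hx5,
          k₂ x hx5 hx7, i₀ x hx hx3 hx5 hx6 hx7]
      · rw [m₄ 0 (by omega), State.setInt_real, State.setInt_real, k₃ 0 (by omega) (by omega),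
          r₀ 0 (by omega)]
      · rw [m₅ i hi, hslot₄, sl i hi]
  · simp only [Test.Holds, RealExp.eval, IntExp.eval, hcap, h3₄, not_not] at h
    exact Runs.skip ⟨T, L₁, .inl ⟨h, rfl, rfl⟩, g₁, g₂, hT₃, i₀, r₀ 0 (by omega), sl⟩

/-- The representatives of the points of earlier epochs, which do not change any more. -/
structure Frozen (x : ι → EuclideanSpace ℝ (Fin d)) (f : ι → ℕ) (k l : ℕ) (δ : ℝ)
    (F : List (Rep ι d)) (pts : List ι) : Prop where
  perm : (F.flatMap Rep.mem).Perm pts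
  ne_nil : ∀ g ∈ F, g.mem ≠ []
  color : ∀ g ∈ F, ∀ p ∈ g.mem, f p = g.color
  color_lt : ∀ g ∈ F, g.color < l
  movement_le : ∀ (c : Fin k → EuclideanSpace ℝ (Fin d)) (α : ι → Fin k),
    totalMovement x F ≤ δ * ptCost x c α pts

theorem Frozen.append {x : ι → EuclideanSpace ℝ (Fin d)} {f : ι → ℕ} {k l : ℕ} {δ : ℝ}
    {F F' : List (Rep ι d)} {pts pts' : List ι} (h : Frozen x f k l δ F pts)
    (h' : Frozen x f k l δ F' pts') : Frozen x f k l δ (F ++ F') (pts ++ pts') where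
  perm := by rw [List.flatMap_append]; exact h.perm.append h'.perm
  ne_nil g hg := (List.mem_append.1 hg).elim (h.ne_nil g) (h'.ne_nil g)
  color g hg := (List.mem_append.1 hg).elim (h.color g) (h'.color g)
  color_lt g hg := (List.mem_append.1 hg).elim (h.color_lt g) (h'.color_lt g)
  movement_le c α := by
    have h₁ := h.movement_le c α
    have h₂ := h'.movement_le c α
    rw [ptCost_append, mul_add]
    simp only [totalMovement, List.map_append, List.sum_append] at h₁ h₂ ⊢
    linarith

theorem Summary.frozen {x : ι → EuclideanSpace ℝ (Fin d)} {f : ι → ℕ} {k l j : ℕ} {δ κ T : ℝ}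
    {L : List (Rep ι d)} {pts : List ι} (h : Summary x f k l j δ κ T L pts)
    (hn : pts.length ≤ 2 ^ j) : Frozen x f k l δ L pts where
  perm := h.perm
  ne_nil g hg := (h.sound g hg).ne_nil
  color g hg := (h.sound g hg).color
  color_lt := h.color_lt
  movement_le := h.totalMovement_le hn

/-- The state of the program after the points `done`, of earlier epochs, and `cur`, of the present
epoch `j`. -/
structure StreamInv (x : ι → EuclideanSpace ℝ (Fin d)) (f : ι → ℕ) (k l : ℕ) (ε : ℝ) (s : State)
    (j : ℕ) (T : ℝ) (F L : List (Rep ι d)) (done cur : List ι) : Prop where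
  clusters : s.int 0 = k
  colors : s.int 1 = l
  total : s.int 3 = F.length + L.length
  start : s.int 4 = F.length
  epoch : s.int 8 = j
  count : s.int 9 = cur.length
  size : s.int 10 = 2 ^ j
  eps : s.real 0 = ε
  threshold : s.real (d + 1) = T
  holds : HoldsList s 0 (F ++ L)
  frozen : Frozen x f k l (ε ^ 2 / 144) F done
  summary : Summary x f k l j (ε ^ 2 / 144) (capReal d k l ε j) T L cur
  cur_lt : cur.length < 2 ^ j
  done_length : done.length + 1 = 2 ^ j
  frozen_length : (F.length : ℝ) ≤ j * capReal d k l ε j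

theorem State.load_int_ne {s : State} {v : EuclideanSpace ℝ (Fin d)} {j x : ℕ} (h : x ≠ 2) :
    (s.load v j).int x = s.int x := by simp [State.load, h]

theorem State.load_real_ne {s : State} {v : EuclideanSpace ℝ (Fin d)} {j x : ℕ}
    (h : x = 0 ∨ d < x) : (s.load v j).real x = s.real x := by
  simp only [State.load]
  rw [dif_neg (by omega)]

theorem State.load_slot {s : State} {v : EuclideanSpace ℝ (Fin d)} {j i : ℕ} :
    (s.load v j).slot d i = s.slot d i :=
  State.slot_congr (State.load_int_ne (by omega)) (State.load_int_ne (by omega)) fun _ _ =>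
    State.load_real_ne (by omega)

theorem State.load_vec {s : State} {v : EuclideanSpace ℝ (Fin d)} {j : ℕ} :
    (s.load v j).vec d 1 = v := by
  ext a
  simp [State.load]

theorem updateProg_runs {s : State} {k l j mx n : ℕ} {ε T : ℝ} {F L : List (Rep ι d)}
    {done cur : List ι} {x : ι → EuclideanSpace ℝ (Fin d)} {f : ι → ℕ} {p : ι}
    (hd : 1 ≤ d) (hk : 1 ≤ k) (hl : 1 ≤ l) (hε : 0 < ε) (hε1 : ε < 1)
    (hf : Fits d mx M W) (hW : 2 * n + l ≤ W)
    (hmx : ∀ j, 2 ^ j ≤ n → (j + 1) * capReal d k l ε j + 2 ≤ mx)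
    (h : StreamInv x f k l ε s j T F L done cur) (hp : f p < l)
    (hn : (done ++ cur).length + 1 ≤ n) :
    Runs sub M W (updateProg d) (s.load (x p) (f p)) (6 * mx * mx + (d + 17) * mx + 2 * d + 50)
      fun s' => ∃ j T F L done' cur', StreamInv x f k l ε s' j T F L done' cur' ∧
        done' ++ cur' = (done ++ cur) ++ [p] := by
  have hC := capReal_capacity hd hk hl hε hε1
  rw [List.length_append] at hn
  have hjn : 2 ^ j ≤ n := by have := h.done_length; omega
  have hj1 : j < 2 ^ j := Nat.lt_two_pow_self
  have hlen : F.length + L.length + 2 ≤ mx := by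
    have h₁ := hmx j hjn
    have h₂ := h.frozen_length
    have h₃ := h.summary.length_le
    have : (F.length : ℝ) + L.length + 2 ≤ mx := by linarith
    exact_mod_cast this
  have hfi := hf.int
  have hfr := hf.real
  have hholds := holdsList_append.1 h.holds
  rw [zero_add] at hholds
  refine Runs.le (Runs.then (absorbProg_runs (b := F.length) (k := k) (l := l) (j := j) (ε := ε)
    (T := T) (L := L) (x := x) (f := f) (p := p) hf ?_ ?_ ?_ ?_ ?_ ?_ ?_ ?_ ?_ ?_ ?_ ?_ ?_ ?_)
    (t₂ := 10) ?_) (by omega)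
  · rw [State.load_int_ne (by omega), h.clusters]
  · rw [State.load_int_ne (by omega), h.colors]
  · rw [State.load_int_ne (by omega), h.epoch]
  · rw [State.load_real_ne (by omega), h.eps]
  · simp [State.load]
  · exact State.load_vec
  · rw [State.load_int_ne (by omega), h.total]
  · rw [State.load_int_ne (by omega), h.start]
  · rw [State.load_real_ne (by omega), h.threshold]
  · omega
  · exact hholds.2.congr fun i _ _ => State.load_slot
  · rw [sum_weight_eq h.summary.perm]; omega
  · intro g hg
    have := h.summary.color_lt g hg
    omega
  · omega
  rintro s₁ ⟨T', L', hu, g₃, gL, gT, gi, gε, gs⟩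
  have hS := h.summary.update (hC j) hp (by have := h.cur_lt; omega) hu
  replace gi : ∀ x < 32, x ≠ 2 → x ≠ 3 → x ≠ 5 → x ≠ 6 → x ≠ 7 → s₁.int x = s.int x :=
    fun x hx h2 h3 h5 h6 h7 => by rw [gi x hx h3 h5 h6 h7, State.load_int_ne h2]
  have gs : HoldsList s₁ 0 (F ++ L') := by
    refine holdsList_append.2 ⟨hholds.1.congr fun i _ hi => ?_, by rwa [zero_add]⟩
    rw [zero_add] at hi
    rw [gs i hi, State.load_slot]
  rw [State.load_real_ne (by omega), h.eps] at gε
  have g0 : s₁.int 0 = k := by rw [gi 0, h.clusters] <;> omega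
  have g1 : s₁.int 1 = l := by rw [gi 1, h.colors] <;> omega
  have g4 : s₁.int 4 = F.length := by rw [gi 4, h.start] <;> omega
  have g8 : s₁.int 8 = j := by rw [gi 8, h.epoch] <;> omega
  have g9 : s₁.int 9 = cur.length := by rw [gi 9, h.count] <;> omega
  have g10 : s₁.int 10 = 2 ^ j := by rw [gi 10, h.size] <;> omega
  have hL'len : F.length + L'.length + 2 ≤ mx := by
    have h₁ := hmx j hjn
    have h₂ := h.frozen_length
    have h₃ := hS.length_le
    have : (F.length : ℝ) + L'.length + 2 ≤ mx := by linarith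
    exact_mod_cast this
  have hfw := hf.word
  refine Runs.le (Runs.then (t₁ := 1) (Runs.setInt' 9 (cur.length + 1) rfl (by simp [g9]) (by omega)
    (by omega) rfl) (t₂ := 6) ?_) (by omega)
  rintro _ rfl
  refine Runs.le (Runs.ite (t₁ := 5) (t₂ := 1) (fun hb => ?_) (fun hb => ?_)) (by simp)
  · have hb : cur.length + 1 = 2 ^ j := by
      simp [g10] at hb; omega
    refine Runs.le (Runs.then (t₁ := 1) (Runs.setInt' 4 (F.length + L'.length) rfl (by simp [g₃])
      (by omega) (by omega) rfl) (t₂ := 1 + (1 + (1 + 1))) ?_) (by omega)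
    rintro _ rfl
    refine Runs.then (t₁ := 1) (Runs.setReal' (d + 1) 0 rfl (by simp) (by omega) rfl) ?_
    rintro _ rfl
    refine Runs.then (t₁ := 1) (Runs.setInt' 9 0 rfl rfl (by omega) (by omega) rfl) ?_
    rintro _ rfl
    refine Runs.then (t₁ := 1) (Runs.setInt' 10 (2 * 2 ^ j) rfl (by simp [g10]) (by omega) (by omega)
      rfl) ?_
    rintro _ rfl
    refine Runs.setInt' 8 (j + 1) rfl (by simp [g8]) (by omega) (by omega)
      ⟨j + 1, 0, F ++ L', [], done ++ (cur ++ [p]), [], ?_, by simp⟩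
    refine ⟨by simp [g0], by simp [g1], by simp [g₃], by simp, by simp, by simp,
      by simp [pow_succ, mul_comm], by simp (disch := omega) [gε], by simp, ?_,
      h.frozen.append (hS.frozen (by simp; omega)), Summary.nil (capReal_nonneg hε _), by simp, ?_, ?_⟩
    · rw [List.append_nil]
      exact gs.congr fun i _ _ => by simp
    · have := h.done_length
      simp [pow_succ]; omega
    · have h₂ := h.frozen_length
      have h₃ := hS.length_le
      have h₄ := capReal_mono (d := d) (k := k) (l := l) hε (Nat.le_succ j)
      have h₅ : ((j : ℝ) + 1) * capReal d k l ε j ≤ (j + 1) * capReal d k l ε (j + 1) := by gcongr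
      rw [List.length_append, Nat.cast_add, Nat.cast_add, Nat.cast_one]
      linarith
  · have hb : cur.length + 1 ≠ 2 ^ j := by
      rintro hb
      simp [g10, hb] at *
    refine Runs.skip ⟨j, T', F, L', done, cur ++ [p], ?_, by simp⟩
    exact ⟨by simp [g0], by simp [g1], by simp [g₃], by simp [g4], by simp [g8], by simp,
      by simp [g10], by simpa using gε, by simpa using gT,
      gs.congr fun i _ _ => State.slot_setInt _ _ _ (by omega), h.frozen, hS,
      by have := h.cur_lt; simp; omega, h.done_length, h.frozen_length⟩

/-- The pass over the stream: every item takes a number of steps that is polynomial in `mx` and `d`. -/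
theorem streamRun_update {k l mx n : ℕ} {ε : ℝ}
    {x : ι → EuclideanSpace ℝ (Fin d)} {f : ι → ℕ}
    (hd : 1 ≤ d) (hk : 1 ≤ k) (hl : 1 ≤ l) (hε : 0 < ε) (hε1 : ε < 1)
    (hf : Fits d mx M W) (hW : 2 * n + l ≤ W)
    (hmx : ∀ j, 2 ^ j ≤ n → (j + 1) * capReal d k l ε j + 2 ≤ mx) (hp : ∀ p, f p < l)
    (pts : List ι) {s : State} {j : ℕ} {T : ℝ} {F L : List (Rep ι d)} {done cur : List ι}
    (h : StreamInv x f k l ε s j T F L done cur) (hn : (done ++ cur).length + pts.length ≤ n) :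
    ∃ t s', StreamRun (Exec sub M W) (updateProg d) (pts.map fun p => (x p, f p)) s t s' ∧
      t ≤ pts.length * (6 * mx * mx + (d + 17) * mx + 2 * d + 50) ∧
      ∃ j T F L done' cur', StreamInv x f k l ε s' j T F L done' cur' ∧
        done' ++ cur' = (done ++ cur) ++ pts := by
  induction pts generalizing s j T F L done cur with
  | nil => exact ⟨0, s, ⟨rfl, rfl⟩, by simp, j, T, F, L, done, cur, h, by simp⟩
  | cons p pts ih =>
    rw [List.length_cons] at hn
    obtain ⟨t₁, s₁, hr, ht₁, j', T', F', L', done', cur', h', e⟩ :=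
      updateProg_runs (sub := sub) hd hk hl hε hε1 hf hW hmx h (hp p) (by omega)
    obtain ⟨t₂, s₂, hr₂, ht₂, j'', T'', F'', L'', done'', cur'', h'', e'⟩ :=
      ih h' (by rw [e, List.length_append]; simp at hn ⊢; omega)
    refine ⟨t₁ + t₂, s₂, ⟨t₁, t₂, s₁, hr, hr₂, rfl⟩, ?_, j'', T'', F'', L'', done'', cur'', h'', ?_⟩
    · rw [List.length_cons, Nat.succ_mul]; omega
    · rw [e', e]; simp

/-- What is done before the stream begins: the first epoch has a single point. -/
def startProg : Program := .setInt (.lit 10) (.lit 1)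

theorem startProg_runs {k l : ℕ} {ε : ℝ} {x : ι → EuclideanSpace ℝ (Fin d)} {f : ι → ℕ}
    (hε : 0 < ε) (hM : 10 < M) (hW : 1 ≤ W) :
    Runs sub M W startProg (initialState k l ε) 1 fun s =>
      StreamInv x f k l ε s 0 0 [] [] [] [] := by
  refine Runs.setInt' 10 1 rfl rfl hM hW ?_
  refine ⟨by simp [initialState], by simp [initialState], by simp [initialState],
    by simp [initialState], by simp [initialState], by simp [initialState], by simp,
    by simp [initialState], by simp [initialState], fun i hi => by simp at hi, ?_,
    Summary.nil (capReal_nonneg hε _), by simp, by simp, by simp⟩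
  exact ⟨by simp, by simp, by simp, by simp, by simp [totalMovement, ptCost]⟩

end Programs

end ColorKMeans

namespace ColorKMeans

/-! ### The search for the centers -/

/-- Computes the smallest number `q` with `8 ≤ q * ε`, the number of points in a mean.  There is no
rounding, hence the loop. -/
def meanSizeProg : Program :=
  .seq (.setInt (.lit 12) (.lit 1))
    (.while (.not (.realLe (.ofInt (.lit 8)) (.mul (.ofInt (.var 12)) (.var 0)))) (.incr 12))

/-- Computes the addresses of the parts of the memory that are used in the search, and sets the mark
in cell `17` that the search is over if there are no points. -/
def addressProg (d : ℕ) : Program :=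
  .seq (.setInt (.lit 13) (.add (.lit 32) (.mul (.lit 2) (.var 3))))
  (.seq (.setInt (.lit 14) (.add (.lit 35) (.mul (.lit 4) (.var 3))))
  (.seq (.setInt (.lit 15) (.mul (.var 0) (.var 12)))
  (.seq (.setInt (.lit 16) (.add (.var 14) (.var 15)))
  (.seq (.setInt (.lit 21) (.add (.lit (d + 8)) (.mul (.var 3) (.lit d))))
  (.seq (.setInt (.lit 23) (.mul (.var 0) (.lit d)))
  (.seq (.setInt (.lit 22) (.add (.var 21) (.var 23)))
  (.setInt (.lit 17) (.sub (.lit 1) (.var 3)))))))))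

/-- Writes the sizes, the colors and the weights to the block that is handed over to the
subroutine. -/
def blockProg : Program :=
  .seq (.setInt (.var 13) (.var 3))
  (.seq (.setInt (.add (.var 13) (.lit 1)) (.var 0))
  (.seq (.setInt (.add (.var 13) (.lit 2)) (.var 1))
  (.seq (.setInt (.lit 18) (.lit 0))
  (.count 18 (.var 3) (.seq
      (.setInt (.add (.add (.var 13) (.lit 3)) (.var 18)) (colorExp (.var 18)))
      (.setInt (.add (.add (.add (.var 13) (.lit 3)) (.var 3)) (.var 18)) (weightExp (.var 18))))))))

/-- Begins the enumeration of the sequences of indices, with no best solution so far. -/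
def beginProg (d : ℕ) : Program :=
  .seq (.setInt (.lit 18) (.lit 0))
  (.seq (.count 18 (.var 15) (.setInt (.add (.var 14) (.var 18)) (.lit 0)))
  (.setReal (.lit (d + 2)) (.sub (.ofInt (.lit 0)) (.ofInt (.lit 1)))))

/-- What is done once before the search. -/
def prepareProg (d : ℕ) : Program :=
  .seq meanSizeProg (.seq (addressProg d) (.seq blockProg (beginProg d)))

/-- Computes the centers from the indices of the points in the means. -/
def centersProg (d : ℕ) : Program :=
  .seq (.setInt (.lit 20) (.lit 0))
  (.seq (.setInt (.lit 18) (.lit 0))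
  (.count 18 (.var 0)
    (.seq (writeVec (.add (.var 21) (.mul (.var 18) (.lit d))) (fun _ => .ofInt (.lit 0)) d)
    (.seq (.setInt (.lit 19) (.lit 0))
    (.count 19 (.var 12)
      (.seq (writeVec (.add (.var 21) (.mul (.var 18) (.lit d)))
        (fun a => .add (.get (.add (.add (.var 21) (.mul (.var 18) (.lit d))) (.lit a)))
          (.div (.get (.add (pointExp d (.get (.add (.var 14) (.var 20)))) (.lit a)))
            (.ofInt (.var 12)))) d)
      (.incr 20)))))))

/-- The limits leave room for the search. -/
structure Room (d k m q M W : ℕ) : Prop where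
  int : 67 + 4 * m + k * q + m * k ≤ M
  real : d + 8 + m * d + k * d + k * d ≤ M
  word : M ≤ W
  clusters : k ≤ W

/-- The part of the memory that does not change during the search: sizes, addresses, and the `m`
representatives with positions `y`, colors `col` and weights `w`.  Behind the list of representatives
follow, in the integer cells, the block for the subroutine from cell `32 + 2 * m` on, the `k * q`
current indices, and the `m * k` numbers that the subroutine returns; in the real cells, the current
centers and then the best centers up to now. -/
structure Env (d k l m q : ℕ) (y : ℕ → EuclideanSpace ℝ (Fin d)) (col w : ℕ → ℕ) (s : State) :
    Prop where
  c0 : s.int 0 = k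
  c3 : s.int 3 = m
  c12 : s.int 12 = q
  c13 : s.int 13 = 32 + 2 * m
  c14 : s.int 14 = 35 + 4 * m
  c15 : s.int 15 = k * q
  c16 : s.int 16 = 35 + 4 * m + k * q
  c21 : s.int 21 = d + 8 + m * d
  c22 : s.int 22 = d + 8 + m * d + k * d
  c23 : s.int 23 = k * d
  head₀ : s.int (32 + 2 * m) = m
  head₁ : s.int (33 + 2 * m) = k
  head₂ : s.int (34 + 2 * m) = l
  color : ∀ i < m, s.int (35 + 2 * m + i) = col i
  weight : ∀ i < m, s.int (35 + 3 * m + i) = w i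
  point : ∀ i < m, s.vec d (d + 8 + i * d) = y i

section Programs

variable {sub : State → ℕ → State → Prop} {M W : ℕ} {d k l m q : ℕ}
  {y : ℕ → EuclideanSpace ℝ (Fin d)} {col w : ℕ → ℕ}

theorem Env.congr {s s' : State} (h : Env d k l m q y col w s)
    (h₁ : ∀ x < 35 + 4 * m, x ≠ 17 → x ≠ 18 → x ≠ 19 → x ≠ 20 → s'.int x = s.int x)
    (h₂ : ∀ x, d + 8 ≤ x → x < d + 8 + m * d → s'.real x = s.real x) :
    Env d k l m q y col w s' where
  c0 := by rw [h₁, h.c0] <;> omega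
  c3 := by rw [h₁, h.c3] <;> omega
  c12 := by rw [h₁, h.c12] <;> omega
  c13 := by rw [h₁, h.c13] <;> omega
  c14 := by rw [h₁, h.c14] <;> omega
  c15 := by rw [h₁, h.c15] <;> omega
  c16 := by rw [h₁, h.c16] <;> omega
  c21 := by rw [h₁, h.c21] <;> omega
  c22 := by rw [h₁, h.c22] <;> omega
  c23 := by rw [h₁, h.c23] <;> omega
  head₀ := by rw [h₁, h.head₀] <;> omega
  head₁ := by rw [h₁, h.head₁] <;> omega
  head₂ := by rw [h₁, h.head₂] <;> omega
  color i hi := by rw [h₁, h.color i hi] <;> omega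
  weight i hi := by rw [h₁, h.weight i hi] <;> omega
  point i hi := by
    rw [← h.point i hi]
    refine State.vec_congr fun j hj => h₂ _ (by omega) ?_
    have := mul_add_le_mul d hi; omega

theorem meanSizeProg_runs {s : State} {ε : ℝ} (hε : 0 < ε) (hM : 12 < M) (hW : ⌈8 / ε⌉₊ ≤ W)
    (h : s.real 0 = ε) :
    Runs sub M W meanSizeProg s (2 * ⌈8 / ε⌉₊ + 2) fun s' => s' = s.setInt 12 ⌈8 / ε⌉₊ := by
  set q := ⌈8 / ε⌉₊ with hq
  have hq1 : 1 ≤ q := Nat.one_le_iff_ne_zero.2 (Nat.ceil_pos.2 (by positivity)).ne'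
  have hloop : ∀ r : ℕ, 8 ≤ (r : ℝ) * ε ↔ q ≤ r := fun r => by
    rw [hq, Nat.ceil_le, div_le_iff₀ hε]
  refine Runs.le (Runs.then (t₁ := 1) (Runs.setInt' 12 1 rfl rfl (by omega) (by omega) rfl)
    (t₂ := 2 * q + 1) ?_) (by omega)
  rintro _ rfl
  refine (Runs.while (I := fun s' => ∃ r, r ≤ q ∧ s' = s.setInt 12 r)
    (v := fun s' => q - s'.int 12) (t := 1) ?_ ⟨1, hq1, rfl⟩).mono ?_ ?_
  · rintro _ ⟨r, hrq, rfl⟩ hb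
    have hb : r < q := by
      simpa [h, hloop] using hb
    refine Runs.setInt' 12 (r + 1) rfl (by simp) (by omega) (by omega)
      ⟨⟨r + 1, hb, State.setInt_setInt _ _ _ _⟩, by simp; omega⟩
  · simp; omega
  · rintro _ ⟨⟨r, hrq, rfl⟩, hb⟩
    have hb : q ≤ r := by
      simpa [h, hloop] using hb
    rw [le_antisymm hrq hb]

/-- The addresses are in their places. -/
structure Addresses (d k m q : ℕ) (s : State) : Prop where
  c0 : s.int 0 = k
  c3 : s.int 3 = m
  c12 : s.int 12 = q
  c13 : s.int 13 = 32 + 2 * m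
  c14 : s.int 14 = 35 + 4 * m
  c15 : s.int 15 = k * q
  c16 : s.int 16 = 35 + 4 * m + k * q
  c21 : s.int 21 = d + 8 + m * d
  c22 : s.int 22 = d + 8 + m * d + k * d
  c23 : s.int 23 = k * d

theorem Addresses.congr {s s' : State} (h : Addresses d k m q s)
    (h₁ : ∀ x < 32, x ≠ 18 → s'.int x = s.int x) : Addresses d k m q s' where
  c0 := by rw [h₁, h.c0] <;> omega
  c3 := by rw [h₁, h.c3] <;> omega
  c12 := by rw [h₁, h.c12] <;> omega
  c13 := by rw [h₁, h.c13] <;> omega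
  c14 := by rw [h₁, h.c14] <;> omega
  c15 := by rw [h₁, h.c15] <;> omega
  c16 := by rw [h₁, h.c16] <;> omega
  c21 := by rw [h₁, h.c21] <;> omega
  c22 := by rw [h₁, h.c22] <;> omega
  c23 := by rw [h₁, h.c23] <;> omega

theorem addressProg_runs {s : State} (hr : Room d k m q M W) (h0 : s.int 0 = k) (h3 : s.int 3 = m)
    (h12 : s.int 12 = q) :
    Runs sub M W (addressProg d) s 8 fun s' => Addresses d k m q s' ∧ s'.int 17 = 1 - m ∧
      s'.int 1 = s.int 1 ∧ (∀ x, 32 ≤ x → s'.int x = s.int x) ∧ s'.real = s.real := by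
  obtain ⟨hri, hrr, hrw, hrk⟩ := hr
  refine Runs.le (t₁ := 1 + (1 + (1 + (1 + (1 + (1 + (1 + 1))))))) ?_ le_rfl
  refine Runs.then (t₁ := 1) (Runs.setInt' 13 (32 + 2 * m) rfl (by simp [h3]) (by omega) (by omega)
    rfl) ?_
  rintro _ rfl
  refine Runs.then (t₁ := 1) (Runs.setInt' 14 (35 + 4 * m) rfl (by simp [h3]) (by omega) (by omega)
    rfl) ?_
  rintro _ rfl
  refine Runs.then (t₁ := 1) (Runs.setInt' 15 (k * q) rfl (by simp [h0, h12]) (by omega) (by omega)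
    rfl) ?_
  rintro _ rfl
  refine Runs.then (t₁ := 1) (Runs.setInt' 16 (35 + 4 * m + k * q) rfl (by simp) (by omega)
    (by omega) rfl) ?_
  rintro _ rfl
  refine Runs.then (t₁ := 1) (Runs.setInt' 21 (d + 8 + m * d) rfl (by simp [h3]) (by omega)
    (by omega) rfl) ?_
  rintro _ rfl
  refine Runs.then (t₁ := 1) (Runs.setInt' 23 (k * d) rfl (by simp [h0]) (by omega)
    (by omega) rfl) ?_
  rintro _ rfl
  refine Runs.then (t₁ := 1) (Runs.setInt' 22 (d + 8 + m * d + k * d) rfl (by simp) (by omega)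
    (by omega) rfl) ?_
  rintro _ rfl
  refine Runs.setInt' 17 (1 - m) rfl (by simp [h3]) (by omega) (by omega) ?_
  refine ⟨⟨?_, ?_, ?_, ?_, ?_, ?_, ?_, ?_, ?_, ?_⟩, ?_, ?_, fun x hx => ?_, rfl⟩
  all_goals simp (disch := omega) [h0, h3, h12]

theorem blockProg_runs {s : State} (hr : Room d k m q M W) (ha : Addresses d k m q s)
    (h1 : s.int 1 = l) (hl : l ≤ W) (hcol : ∀ i < m, s.int (32 + 2 * i) ≤ W)
    (hw : ∀ i < m, s.int (33 + 2 * i) ≤ W) :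
    Runs sub M W blockProg s (m * 4 + 5) fun s' =>
      (∀ x < 32 + 2 * m, x ≠ 18 → s'.int x = s.int x) ∧ s'.int (32 + 2 * m) = m ∧
      s'.int (33 + 2 * m) = k ∧ s'.int (34 + 2 * m) = l ∧
      (∀ i < m, s'.int (35 + 2 * m + i) = s.int (32 + 2 * i) ∧
        s'.int (35 + 3 * m + i) = s.int (33 + 2 * i)) ∧ s'.real = s.real := by
  obtain ⟨hri, hrr, hrw, hrk⟩ := hr
  have e0 := ha.c0
  have e3 := ha.c3
  have e13 := ha.c13
  refine Runs.le (t₁ := 1 + (1 + (1 + (1 + (m * (2 + 2) + 1))))) ?_ (by omega)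
  refine Runs.then (t₁ := 1) (Runs.setInt' (32 + 2 * m) m (by simp [e13]) (by simp [e3]) (by omega)
    (by omega) rfl) ?_
  rintro _ rfl
  refine Runs.then (t₁ := 1) (Runs.setInt' (33 + 2 * m) k (by simp (disch := omega) [e13]; omega)
    (by simp (disch := omega) [e0]) (by omega) hrk rfl) ?_
  rintro _ rfl
  refine Runs.then (t₁ := 1) (Runs.setInt' (34 + 2 * m) l (by simp (disch := omega) [e13]; omega)
    (by simp (disch := omega) [h1]) (by omega) hl rfl) ?_
  rintro _ rfl
  refine Runs.then (t₁ := 1) (Runs.setInt' 18 0 rfl rfl (by omega) (by omega) rfl) ?_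
  rintro _ rfl
  refine Runs.mono (Runs.count (n := m) (i₀ := 0) (t := 2)
    (I := fun i s' => (∀ x < 32 + 2 * m, x ≠ 18 → s'.int x = s.int x) ∧ s'.int (32 + 2 * m) = m ∧
      s'.int (33 + 2 * m) = k ∧ s'.int (34 + 2 * m) = l ∧
      (∀ i' < i, s'.int (35 + 2 * m + i') = s.int (32 + 2 * i') ∧
        s'.int (35 + 3 * m + i') = s.int (33 + 2 * i')) ∧ s'.real = s.real)
    (by omega) (by omega) ?_ (by simp) (by omega) ?_ ?_) (by simp) fun s' h => h.2
  · rintro i s' ⟨h, -⟩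
    simpa [e3] using h 3 (by omega) (by omega)
  · refine ⟨fun x hx hx' => ?_, ?_, ?_, ?_, by simp, rfl⟩ <;> simp (disch := omega)
  · rintro i s' - hi h18 ⟨g₁, g₂, g₃, g₄, g₅, g₆⟩
    have g13 : s'.int 13 = 32 + 2 * m := by rw [g₁ _ (by omega) (by omega), e13]
    have g3 : s'.int 3 = m := by rw [g₁ _ (by omega) (by omega), e3]
    refine Runs.then (t₁ := 1) (t₂ := 1) (Runs.setInt' (35 + 2 * m + i) (s.int (32 + 2 * i))
      (by simp [g13, h18]; omega) ?_ (by omega) (hcol i hi) rfl) ?_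
    · simp only [IntExp.eval, h18]
      rw [g₁ _ (by omega) (by omega)]
    rintro _ rfl
    refine Runs.setInt' (35 + 3 * m + i) (s.int (33 + 2 * i))
      (by simp (disch := omega) [g13, h18, g3]; omega) ?_ (by omega) (hw i hi) ?_
    · simp (disch := omega) only [IntExp.eval, h18, State.setInt_int_ne]
      rw [g₁ _ (by omega) (by omega)]
    refine ⟨by simp (disch := omega) [h18], fun x hx hx' => ?_, ?_, ?_, ?_, fun i' hi' => ?_, g₆⟩
    · simp (disch := omega) [g₁]
    · simp (disch := omega) [g₂]
    · simp (disch := omega) [g₃]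
    · simp (disch := omega) [g₄]
    · rcases Nat.lt_succ_iff_lt_or_eq.1 hi' with hi' | rfl
      · simp (disch := omega) [g₅ i' hi']
      · simp (disch := omega)

theorem beginProg_runs {s : State} (hr : Room d k m q M W) (ha : Addresses d k m q s) :
    Runs sub M W (beginProg d) s (3 * (k * q) + 3) fun s' =>
      (∀ x < 35 + 4 * m, x ≠ 18 → s'.int x = s.int x) ∧
      (∀ z < k * q, s'.int (35 + 4 * m + z) = 0) ∧ s'.real (d + 2) = -1 ∧
      ∀ x, x ≠ d + 2 → s'.real x = s.real x := by
  obtain ⟨hri, hrr, hrw, hrk⟩ := hr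
  have e14 := ha.c14
  refine Runs.le (Runs.then (t₁ := 1) (Runs.setInt' 18 0 rfl rfl (by omega) (by omega) rfl)
    (t₂ := (k * q * (1 + 2) + 1) + 1) ?_) (by omega)
  rintro _ rfl
  refine Runs.then (Runs.count (n := k * q) (i₀ := 0) (t := 1)
    (I := fun i s' => (∀ x < 35 + 4 * m, x ≠ 18 → s'.int x = s.int x) ∧ s'.real = s.real ∧
      (∀ i' < i, s'.int (35 + 4 * m + i') = 0))
    (by omega) (by omega) ?_ (by simp) (by omega) ?_ ?_) ?_
  · rintro i s' ⟨h, -⟩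
    simpa [ha.c15] using h 15 (by omega) (by omega)
  · exact ⟨fun x hx hx' => by simp [hx'], rfl, by simp⟩
  · rintro i s' - hi h18 ⟨f₁, f₂, f₃⟩
    refine Runs.setInt' (35 + 4 * m + i) 0 ?_ rfl (by omega) (by omega) ?_
    · simp (disch := omega) [f₁, e14, h18]
    refine ⟨by simp (disch := omega) [h18], fun x hx hx' => ?_, f₂, fun i' hi' => ?_⟩
    · simp (disch := omega) [f₁]
    · rcases Nat.lt_succ_iff_lt_or_eq.1 hi' with hi' | rfl
      · simp (disch := omega) [f₃ i' hi']
      · simp (disch := omega)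
  rintro s₃ ⟨-, f₁, f₂, f₃⟩
  exact Runs.setReal' (d + 2) (-1) rfl (by simp) (by omega)
    ⟨f₁, f₃, by simp, fun x hx => by simp [hx, f₂]⟩

theorem prepareProg_runs {s : State} {ε : ℝ} (hε : 0 < ε)
    (hr : Room d k m ⌈8 / ε⌉₊ M W) (h0 : s.int 0 = k) (h1 : s.int 1 = l)
    (h3 : s.int 3 = m) (hrε : s.real 0 = ε) (hk : 1 ≤ k) (hl : l ≤ W)
    (hs : ∀ i < m, s.slot d i = (col i, w i, y i)) (hcol : ∀ i < m, col i ≤ W)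
    (hw : ∀ i < m, w i ≤ W) :
    Runs sub M W (prepareProg d) s (2 * ⌈8 / ε⌉₊ + m * 4 + 3 * (k * ⌈8 / ε⌉₊) + 18) fun s' =>
      Env d k l m ⌈8 / ε⌉₊ y col w s' ∧ s'.int 17 = 1 - m ∧
      (∀ z < k * ⌈8 / ε⌉₊, s'.int (35 + 4 * m + z) = 0) ∧ s'.real (d + 2) = -1 := by
  set q := ⌈8 / ε⌉₊ with hq
  have hkq : q ≤ k * q := Nat.le_mul_of_pos_left _ hk
  have hri := hr.int
  have hrw := hr.word
  simp only [State.slot, Prod.mk.injEq] at hs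
  refine Runs.le (Runs.then (meanSizeProg_runs hε (by omega) (by omega) hrε)
    (t₂ := 8 + ((m * 4 + 5) + (3 * (k * q) + 3))) ?_) (by omega)
  rintro _ rfl
  refine Runs.then (addressProg_runs hr (by simpa using h0) (by simpa using h3) (by simp [hq])) ?_
  rintro s₁ ⟨ha, f17, f1, f₁, f₂⟩
  have hold : ∀ x, 32 ≤ x → s₁.int x = s.int x := fun x hx => by
    rw [f₁ x hx, State.setInt_int_ne _ _ (by omega)]
  refine Runs.then (blockProg_runs (l := l) hr ha (by rw [f1]; simpa using h1) hl
    (fun i hi => by rw [hold _ (by omega), (hs i hi).1]; exact hcol i hi)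
    (fun i hi => by rw [hold _ (by omega), (hs i hi).2.1]; exact hw i hi)) ?_
  rintro s₂ ⟨g₁, g₂, g₃, g₄, g₅, g₆⟩
  have ha₂ : Addresses d k m q s₂ := ha.congr fun x hx hx' => g₁ x (by omega) hx'
  refine (beginProg_runs hr ha₂).imp ?_
  rintro s₃ ⟨e₁, e₂, e₃, e₄⟩
  have ha₃ : Addresses d k m q s₃ := ha₂.congr fun x hx hx' => e₁ x (by omega) hx'
  refine ⟨⟨ha₃.c0, ha₃.c3, ha₃.c12, ha₃.c13, ha₃.c14, ha₃.c15, ha₃.c16, ha₃.c21, ha₃.c22, ha₃.c23,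
    by rw [e₁, g₂] <;> omega, by rw [e₁, g₃] <;> omega, by rw [e₁, g₄] <;> omega,
    fun i hi => ?_, fun i hi => ?_, fun i hi => ?_⟩, ?_, e₂, e₃⟩
  · rw [e₁ _ (by omega) (by omega), (g₅ i hi).1, hold _ (by omega), (hs i hi).1]
  · rw [e₁ _ (by omega) (by omega), (g₅ i hi).2, hold _ (by omega), (hs i hi).2.1]
  · rw [← (hs i hi).2.2]
    refine State.vec_congr fun j hj => ?_
    rw [e₄ _ (by omega), g₆, f₂]; rfl
  · rw [e₁ _ (by omega) (by omega), g₁ _ (by omega) (by omega), f17]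

/-- The center number `i` that belongs to the sequence `D` of indices. -/
noncomputable def candidate (y : ℕ → EuclideanSpace ℝ (Fin d)) (q : ℕ) (D : ℕ → ℕ) (i : ℕ) :
    EuclideanSpace ℝ (Fin d) := ∑ t ∈ Finset.range q, (q : ℝ)⁻¹ • y (D (i * q + t))

theorem centersProg_runs {s : State} {D : ℕ → ℕ} (hr : Room d k m q M W)
    (h : Env d k l m q y col w s) (hD : ∀ z < k * q, D z < m)
    (hD' : ∀ z < k * q, s.int (35 + 4 * m + z) = D z) :
    Runs sub M W (centersProg d) s (k * (q * (d + 4) + d + 5) + 3) fun s' =>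
      (∀ i < k, s'.vec d (d + 8 + m * d + i * d) = candidate y q D i) ∧
      (∀ x, x ≠ 18 → x ≠ 19 → x ≠ 20 → s'.int x = s.int x) ∧
      ∀ x, (x < d + 8 + m * d ∨ d + 8 + m * d + k * d ≤ x) → s'.real x = s.real x := by
  obtain ⟨hri, hrr, hrw, hrk⟩ := hr
  refine Runs.le (Runs.then (t₁ := 1) (Runs.setInt' 20 0 rfl rfl (by omega) (by omega) rfl)
    (t₂ := 1 + (k * (q * (d + 4) + d + 5) + 1)) ?_) (by omega)
  rintro _ rfl
  refine Runs.then (t₁ := 1) (Runs.setInt' 18 0 rfl rfl (by omega) (by omega) rfl) ?_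
  rintro _ rfl
  refine Runs.mono (Runs.count (n := k) (i₀ := 0) (t := q * (d + 4) + d + 3)
    (I := fun i s' => s'.int 20 = i * q ∧
      (∀ i' < i, s'.vec d (d + 8 + m * d + i' * d) = candidate y q D i') ∧
      (∀ x, x ≠ 18 → x ≠ 19 → x ≠ 20 → s'.int x = s.int x) ∧
      ∀ x, (x < d + 8 + m * d ∨ d + 8 + m * d + k * d ≤ x) → s'.real x = s.real x)
    (by omega) hrk ?_ (by simp) (by omega) ?_ ?_) (by rw [Nat.sub_zero]) ?_
  · rintro i s' ⟨-, -, h', -⟩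
    simpa [h.c0] using h' 0 (by omega) (by omega) (by omega)
  · exact ⟨by simp, by simp, fun x h₁ h₂ h₃ => by simp [h₁, h₃], fun x _ => rfl⟩
  · rintro i s₁ - hi h18 ⟨g20, g₁, g₂, g₃⟩
    have hid := mul_add_le_mul d hi
    have hiq := mul_add_le_mul q hi
    have g21 : s₁.int 21 = d + 8 + m * d := by rw [g₂, h.c21] <;> omega
    refine Runs.le (Runs.then (t₁ := d + 1) (Q' := fun s' => s'.int = s₁.int ∧
        s'.vec d (d + 8 + m * d + i * d) = 0 ∧
        ∀ x, (x < d + 8 + m * d + i * d ∨ d + 8 + m * d + i * d + d ≤ x) → s'.real x = s₁.real x)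
      (Runs.writeVec (A := d + 8 + m * d + i * d) (v := fun _ => 0) (by omega) ?_ ?_ ?_)
      (t₂ := 1 + (q * (d + 2 + 2) + 1)) ?_) (by ring_nf; omega)
    · intro s' hs'
      simp [hs', g21, h18]
    · intro j hj s' hs' _
      simp
    · intro s' hs₁ hs₂ hs₃
      exact ⟨hs₁, by ext j; simpa using hs₂ j j.2, hs₃⟩
    rintro s₂ ⟨f₁, f₂, f₃⟩
    refine Runs.then (t₁ := 1) (Runs.setInt' 19 0 rfl rfl (by omega) (by omega) rfl) ?_
    rintro _ rfl
    refine (Runs.count (n := q) (i₀ := 0) (t := d + 2)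
      (I := fun t s' => s'.int 18 = i ∧ s'.int 20 = i * q + t ∧
        s'.vec d (d + 8 + m * d + i * d) = ∑ t' ∈ Finset.range t, (q : ℝ)⁻¹ • y (D (i * q + t')) ∧
        (∀ x, x ≠ 18 → x ≠ 19 → x ≠ 20 → s'.int x = s.int x) ∧
        ∀ x, (x < d + 8 + m * d + i * d ∨ d + 8 + m * d + i * d + d ≤ x) → s'.real x = s₁.real x)
      (by omega) (by omega) ?_ (by simp) (by omega) ?_ ?_).mono (by rw [Nat.sub_zero]) ?_
    · rintro t s' ⟨-, -, -, h', -⟩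
      simpa [h.c12] using h' 12 (by omega) (by omega) (by omega)
    · refine ⟨by simp [f₁, h18], by simp [f₁, g20], by simpa using f₂, fun x h₁ h₂ h₃ => ?_, f₃⟩
      simp [h₂, f₁, g₂ x h₁ h₂ h₃]
    · rintro t s₃ - ht h19 ⟨e18, e20, e₁, e₂, e₃⟩
      have hz : i * q + t < k * q := by omega
      have hy : ∀ j : Fin d, s₁.real (d + 8 + D (i * q + t) * d + j) = y (D (i * q + t)) j := by
        intro j
        rw [← h.point _ (hD _ hz), State.vec_apply]
        refine g₃ _ (.inl ?_)
        have := mul_add_le_mul d (hD _ hz)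
        have := j.2
        omega
      have e21 : s₃.int 21 = d + 8 + m * d := by rw [e₂, h.c21] <;> omega
      have e14 : s₃.int 14 = 35 + 4 * m := by rw [e₂, h.c14] <;> omega
      have e12 : s₃.int 12 = q := by rw [e₂, h.c12] <;> omega
      have eD : s₃.int (35 + 4 * m + (i * q + t)) = D (i * q + t) := by
        rw [e₂, hD' _ hz] <;> omega
      refine Runs.le (Runs.then (t₁ := d + 1) (Q' := fun s' => s'.int = s₃.int ∧
          s'.vec d (d + 8 + m * d + i * d) =
            s₃.vec d (d + 8 + m * d + i * d) + (q : ℝ)⁻¹ • y (D (i * q + t)) ∧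
          ∀ x, (x < d + 8 + m * d + i * d ∨ d + 8 + m * d + i * d + d ≤ x) →
            s'.real x = s₃.real x)
        (Runs.writeVec (A := d + 8 + m * d + i * d)
          (v := fun j => s₃.real (d + 8 + m * d + i * d + j) +
            s₁.real (d + 8 + D (i * q + t) * d + j) / q) (by omega) ?_ ?_ ?_)
        (t₂ := 1) ?_) (by omega)
      · intro s' hs'
        simp [hs', e21, e18]
      · intro j hj s' hs' hs''
        simp only [RealExp.eval, IntExp.eval, hs', e21, e18, e14, e20, eD, e12]
        rw [hs'' _ (.inr le_rfl), hs'' (d + 8 + D (i * q + t) * d + j) (.inl ?_),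
          e₃ (d + 8 + D (i * q + t) * d + j) (.inl ?_)]
        · have := mul_add_le_mul d (hD _ hz); omega
        · have := mul_add_le_mul d (hD _ hz); omega
      · intro s' hs₁ hs₂ hs₃
        refine ⟨hs₁, ?_, hs₃⟩
        ext j
        rw [State.vec_apply, hs₂ j j.2, hy j]
        simp [div_eq_inv_mul]
      rintro s₄ ⟨d₁, d₂, d₃⟩
      refine Runs.setInt' 20 (i * q + t + 1) rfl (by simp [d₁, e20]) (by omega) (by omega)
        ⟨by simp [d₁, h19], by simp [d₁, e18], by simp [add_assoc], ?_, fun x h₁ h₂ h₃ => ?_,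
          fun x hx => ?_⟩
      · rw [State.vec_setInt, State.vec_setInt, d₂, e₁, Finset.sum_range_succ]
      · simp [h₂, h₃, d₁, e₂ x h₁ h₂ h₃]
      · simp only [State.setInt_real]
        rw [d₃ x hx, e₃ x hx]
    · rintro s₃ ⟨-, e18, e20, e₁, e₂, e₃⟩
      refine ⟨e18, by simp [e20]; ring, fun i' hi' => ?_, fun x h₁ h₂ h₃ => ?_, fun x hx => ?_⟩
      · rw [State.vec_setInt]
        rcases Nat.lt_succ_iff_lt_or_eq.1 hi' with hi' | rfl
        · rw [← g₁ i' hi']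
          refine State.vec_congr fun j hj => e₃ _ (.inl ?_)
          have := mul_add_le_mul d hi'
          omega
        · exact e₁
      · simp [h₁, e₂ x h₁ h₂ h₃]
      · rw [State.setInt_real, e₃ x (by omega), g₃ x hx]
  · rintro s' ⟨-, -, g₁, g₂, g₃⟩
    exact ⟨g₁, g₂, g₃⟩

end Programs

end ColorKMeans

namespace ColorKMeans

/-! ### One step of the search -/

/-- Hands over the representatives and the current centers to the subroutine. -/
def callProg (d : ℕ) : Program :=
  .call (.var 13) (.add (.lit 3) (.mul (.lit 2) (.var 3))) (.lit (d + 8))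
    (.mul (.add (.var 3) (.var 0)) (.lit d)) (.var 16) (.mul (.var 3) (.var 0))

/-- Computes the cost of the assignment that the subroutine has returned. -/
def costProg (d : ℕ) : Program :=
  .seq (.setReal (.lit (d + 3)) (.ofInt (.lit 0)))
  (.seq (.setInt (.lit 20) (.lit 0))
  (.seq (.setInt (.lit 18) (.lit 0))
  (.count 18 (.var 3)
    (.seq (.setInt (.lit 19) (.lit 0))
    (.count 19 (.var 0)
      (.seq (.setReal (.lit (d + 3)) (.add (.var (d + 3))
        (.mul (.ofInt (.get (.add (.var 16) (.var 20))))
          (sqDistExp d (pointExp d (.var 18)) (.add (.var 21) (.mul (.var 19) (.lit d)))))))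
      (.incr 20)))))))

/-- Keeps the current centers if they are the first ones or better than the best ones so far. -/
def keepProg (d : ℕ) : Program :=
  .ite (.or (.not (.realLe (.ofInt (.lit 0)) (.var (d + 2))))
      (.not (.realLe (.var (d + 2)) (.var (d + 3)))))
    (.seq (.setReal (.lit (d + 2)) (.var (d + 3)))
    (.seq (.setInt (.lit 18) (.lit 0))
    (.count 18 (.var 23) (.setReal (.add (.var 22) (.var 18)) (.get (.add (.var 21) (.var 18)))))))
    .skip

/-- Adds one to the number whose digits to the base `m`, the least significant one first, are the
current indices, or marks the end of the search. -/
def nextProg : Program :=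
  .seq (.setInt (.lit 18) (.lit 0))
  (.seq (.while (.and (.intLt (.var 18) (.var 15))
      (.intEq (.add (.get (.add (.var 14) (.var 18))) (.lit 1)) (.var 3)))
    (.seq (.setInt (.add (.var 14) (.var 18)) (.lit 0)) (.incr 18)))
  (.ite (.intLt (.var 18) (.var 15))
    (.setInt (.add (.var 14) (.var 18)) (.add (.get (.add (.var 14) (.var 18))) (.lit 1)))
    (.setInt (.lit 17) (.lit 1))))

section Programs

variable {sub : State → ℕ → State → Prop} {M W : ℕ} {d k l m q : ℕ}
  {y : ℕ → EuclideanSpace ℝ (Fin d)} {col w : ℕ → ℕ}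

/-- The memory on which the subroutine starts. -/
theorem Env.encodes {s : State} (h : Env d k l m q y col w s) {fc : Fin m → Fin l}
    (hfc : ∀ p : Fin m, col p = fc p) {c : ℕ → EuclideanSpace ℝ (Fin d)}
    (hc : ∀ i < k, s.vec d (d + 8 + m * d + i * d) = c i) :
    Encodes (s.window (32 + 2 * m) (3 + 2 * m) (d + 8) ((m + k) * d)) (fun p : Fin m => y p)
      (fun p => w p) fc (fun i : Fin k => c i) where
  num := by simp [State.window, h.head₀]
  clusters := by
    rw [State.window]; simp only
    rw [if_pos (by omega), show 32 + 2 * m + 1 = 33 + 2 * m by omega, h.head₁]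
  colors := by
    rw [State.window]; simp only
    rw [if_pos (by omega), show 32 + 2 * m + 2 = 34 + 2 * m by omega, h.head₂]
  color p := by
    have := p.2
    rw [State.window]; simp only
    rw [if_pos (by omega), show 32 + 2 * m + (3 + p) = 35 + 2 * m + (p : ℕ) by omega,
      h.color _ p.2, hfc]
  weight p := by
    have := p.2
    rw [State.window]; simp only
    rw [if_pos (by omega), show 32 + 2 * m + (3 + m + p) = 35 + 3 * m + (p : ℕ) by omega,
      h.weight _ p.2]
  rest a ha := by
    rw [State.window]; simp only
    rw [if_neg (by omega)]
  point p j := by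
    have h₁ := mul_add_le_mul d p.2
    have h₂ := j.2
    have h₃ : (m + k) * d = m * d + k * d := add_mul ..
    rw [State.window]; simp only
    rw [if_pos (by omega), ← h.point p p.2, State.vec_apply, add_assoc _ ((p : ℕ) * d)]
  center i j := by
    have h₁ := mul_add_le_mul d i.2
    have h₂ := j.2
    have h₃ : (m + k) * d = m * d + k * d := add_mul ..
    have h₄ : (m + i) * d = m * d + i * d := add_mul ..
    rw [State.window]; simp only
    rw [if_pos (by omega), ← hc i i.2, State.vec_apply]
    congr 1; omega
  restReal a ha := by
    rw [State.window]; simp only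
    rw [if_neg (by omega)]

/-- The subroutine solves every assignment problem with the given points within `tA` steps. -/
def Oracle (sub : State → ℕ → State → Prop) (tA m : ℕ) {k l d : ℕ}
    (y : ℕ → EuclideanSpace ℝ (Fin d)) (w : ℕ → ℕ) (fc : Fin m → Fin l)
    (𝒦 : Set (Matrix (Fin k) (Fin l) ℕ)) : Prop :=
  ∀ (s : State) (c : Fin k → EuclideanSpace ℝ (Fin d)),
    Encodes s (fun p : Fin m => y p) (fun p => w p) fc c →
    ∃ t s', sub s t s' ∧ t ≤ tA ∧
      IsOptimalAssignment (fun p : Fin m => y p) (fun p => w p) fc 𝒦 c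
        (fun p i => s'.int (s'.int 0 + (p * k + i)))

variable {tA : ℕ} {fc : Fin m → Fin l} {𝒦 : Set (Matrix (Fin k) (Fin l) ℕ)}

theorem callProg_runs {s : State} (hr : Room d k m q M W) (h : Env d k l m q y col w s)
    (hfc : ∀ p : Fin m, col p = fc p) {c : ℕ → EuclideanSpace ℝ (Fin d)}
    (hc : ∀ i < k, s.vec d (d + 8 + m * d + i * d) = c i) (hw : ∀ p < m, w p ≤ W)
    (ho : Oracle sub tA m y w fc 𝒦) :
    Runs sub M W (callProg d) s (tA + (3 + 2 * m) + (m + k) * d + m * k + 1) fun s' =>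
      (∃ A, IsOptimalAssignment (fun p : Fin m => y p) (fun p => w p) fc 𝒦 (fun i : Fin k => c i) A ∧
        ∀ (p : Fin m) (i : Fin k), s'.int (35 + 4 * m + k * q + (p * k + i)) = A p i) ∧
      (∀ x < 35 + 4 * m + k * q, s'.int x = s.int x) ∧ s'.real = s.real := by
  obtain ⟨hri, hrr, hrw, hrk⟩ := hr
  obtain ⟨t, s', hs, ht, hopt⟩ := ho _ _ (h.encodes hfc hc)
  have e3 : (m + k) * d = m * d + k * d := add_mul ..
  refine ⟨_, _, .call (s' := s') (t := t) ?_ ?_ ?_ ?_ ?_, ?_, ⟨_, hopt, ?_⟩, ?_, rfl⟩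
  · simp [h.c3]; omega
  · simp [h.c3, h.c0]; omega
  · simp [h.c3, h.c0, h.c16]; omega
  · simpa [h.c3, h.c0, h.c13] using hs
  · intro x hx
    simp only [IntExp.eval, h.c3, h.c0] at hx
    have hk : 0 < k := by
      rcases Nat.eq_zero_or_pos k with rfl | hk
      · simp at hx
      · exact hk
    have hp : x / k < m := Nat.div_lt_of_lt_mul (by rwa [mul_comm])
    have hle := Finset.single_le_sum (f := fun i : Fin k => s'.int (s'.int 0 + (x / k * k + i)))
      (fun i _ => Nat.zero_le _) (Finset.mem_univ ⟨x % k, Nat.mod_lt _ hk⟩)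
    have := hopt.1.1 ⟨x / k, hp⟩
    simp only [Nat.div_add_mod'] at hle this
    exact (hle.trans this.le).trans (hw _ hp)
  · simp [h.c3, h.c0]; omega
  · intro p i
    have h₁ := mul_add_le_mul k p.2
    have h₂ := i.2
    simp only [State.copyBack, IntExp.eval, h.c16, h.c3, h.c0]
    rw [if_pos (by omega)]
    congr 2; omega
  · intro x hx
    simp only [State.copyBack, IntExp.eval, h.c16]
    rw [if_neg (by omega)]

theorem costProg_runs {s : State} (hr : Room d k m q M W) (h : Env d k l m q y col w s)
    {c : ℕ → EuclideanSpace ℝ (Fin d)}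
    (hc : ∀ i < k, s.vec d (d + 8 + m * d + i * d) = c i) {A : Fin m → Fin k → ℕ}
    (hA : ∀ (p : Fin m) (i : Fin k), s.int (35 + 4 * m + k * q + (p * k + i)) = A p i) :
    Runs sub M W (costProg d) s (m * (k * 4 + 4) + 4) fun s' =>
      s'.real (d + 3) = wcost (fun p : Fin m => y p) A (fun i : Fin k => c i) ∧
      (∀ x, x ≠ 18 → x ≠ 19 → x ≠ 20 → s'.int x = s.int x) ∧
      ∀ x, x ≠ d + 3 → s'.real x = s.real x := by
  obtain ⟨hri, hrr, hrw, hrk⟩ := hr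
  set T : ℕ → ℕ → ℝ := fun p i =>
    (s.int (35 + 4 * m + k * q + (p * k + i)) : ℝ) * dist (y p) (c i) ^ 2 with hT
  have hcost : wcost (fun p : Fin m => y p) A (fun i : Fin k => c i) =
      ∑ p ∈ Finset.range m, ∑ i ∈ Finset.range k, T p i := by
    simp only [wcost, Finset.sum_range, hT, hA]
  refine Runs.le (Runs.then (t₁ := 1) (Runs.setReal' (d + 3) 0 rfl (by simp) (by omega) rfl)
    (t₂ := 1 + (1 + (m * (k * 4 + 4) + 1))) ?_) (by omega)
  rintro _ rfl
  refine Runs.then (t₁ := 1) (Runs.setInt' 20 0 rfl rfl (by omega) (by omega) rfl) ?_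
  rintro _ rfl
  refine Runs.then (t₁ := 1) (Runs.setInt' 18 0 rfl rfl (by omega) (by omega) rfl) ?_
  rintro _ rfl
  refine Runs.mono (Runs.count (n := m) (i₀ := 0) (t := k * 4 + 2)
    (I := fun p s' => s'.int 20 = p * k ∧
      s'.real (d + 3) = ∑ p ∈ Finset.range p, ∑ i ∈ Finset.range k, T p i ∧
      (∀ x, x ≠ 18 → x ≠ 19 → x ≠ 20 → s'.int x = s.int x) ∧
      ∀ x, x ≠ d + 3 → s'.real x = s.real x)
    (by omega) (by omega) ?_ (by simp) (by omega) ?_ ?_) (by rw [Nat.sub_zero]) ?_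
  · rintro i s' ⟨-, -, h', -⟩
    simpa [h.c3] using h' 3 (by omega) (by omega) (by omega)
  · exact ⟨by simp, by simp, fun x h₁ h₂ h₃ => by simp [h₁, h₃], fun x hx => by simp [hx]⟩
  · rintro p s₁ - hp h18 ⟨g20, g₁, g₂, g₃⟩
    have hpk := mul_add_le_mul k hp
    refine Runs.le (Runs.then (t₁ := 1) (Runs.setInt' 19 0 rfl rfl (by omega) (by omega) rfl)
      (t₂ := k * (2 + 2) + 1) ?_) (by omega)
    rintro _ rfl
    refine (Runs.count (n := k) (i₀ := 0) (t := 2)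
      (I := fun i s' => s'.int 18 = p ∧ s'.int 20 = p * k + i ∧
        s'.real (d + 3) = ∑ p ∈ Finset.range p, ∑ i ∈ Finset.range k, T p i +
          ∑ i ∈ Finset.range i, T p i ∧
        (∀ x, x ≠ 18 → x ≠ 19 → x ≠ 20 → s'.int x = s.int x) ∧
        ∀ x, x ≠ d + 3 → s'.real x = s.real x)
      (by omega) hrk ?_ (by simp) (by omega) ?_ ?_).mono (by rw [Nat.sub_zero]) ?_
    · rintro i s' ⟨-, -, -, h', -⟩
      simpa [h.c0] using h' 0 (by omega) (by omega) (by omega)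
    · exact ⟨by simp [h18], by simp [g20], by simpa using g₁,
        fun x h₁ h₂ h₃ => by simp [h₂, g₂ x h₁ h₂ h₃], g₃⟩
    · rintro i s₂ - hi h19 ⟨f18, f20, f₁, f₂, f₃⟩
      have f21 : s₂.int 21 = d + 8 + m * d := by rw [f₂, h.c21] <;> omega
      have f16 : s₂.int 16 = 35 + 4 * m + k * q := by rw [f₂, h.c16] <;> omega
      have e₁ : s₂.vec d (d + 8 + p * d) = y p := by
        rw [← h.point p hp]; exact State.vec_congr fun j hj => f₃ _ (by omega)
      have e₂ : s₂.vec d (d + 8 + m * d + i * d) = c i := by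
        rw [← hc i hi]; exact State.vec_congr fun j hj => f₃ _ (by omega)
      have e₃ : s₂.int (35 + 4 * m + k * q + (p * k + i)) =
          s.int (35 + 4 * m + k * q + (p * k + i)) := f₂ _ (by omega) (by omega) (by omega)
      refine Runs.then (t₁ := 1) (t₂ := 1) (Runs.setReal' (d + 3)
        (s₂.real (d + 3) + T p i) rfl ?_ (by omega) rfl) ?_
      · simp [pointExp, f18, f20, f21, f16, h19, e₁, e₂, e₃, hT]
      rintro _ rfl
      refine Runs.setInt' 20 (p * k + i + 1) rfl (by simp [f20]) (by omega) (by omega)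
        ⟨by simp [h19], by simp [f18], by simp [add_assoc], ?_, fun x h₁ h₂ h₃ => ?_,
          fun x hx => ?_⟩
      · simp [f₁, Finset.sum_range_succ, add_assoc]
      · simp [h₂, h₃, f₂ x h₁ h₂ h₃]
      · simp [hx, f₃ x hx]
    · rintro s₂ ⟨-, f18, f20, f₁, f₂, f₃⟩
      refine ⟨f18, by simp [f20]; ring, ?_, fun x h₁ h₂ h₃ => ?_, f₃⟩
      · simp only [State.setInt_real, f₁, Finset.sum_range_succ _ p]
      · simp [h₁, f₂ x h₁ h₂ h₃]
  · rintro s' ⟨-, -, g₁, g₂, g₃⟩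
    exact ⟨g₁.trans hcost.symm, g₂, g₃⟩

theorem keepProg_runs {s : State} (hr : Room d k m q M W) (h : Env d k l m q y col w s) :
    Runs sub M W (keepProg d) s (k * d * 3 + 4) fun s' =>
      (∀ x, x ≠ 18 → s'.int x = s.int x) ∧
      (∀ x, d + 8 ≤ x → x < d + 8 + m * d → s'.real x = s.real x) ∧
      if s.real (d + 2) < 0 ∨ s.real (d + 3) < s.real (d + 2) then
        s'.real (d + 2) = s.real (d + 3) ∧
        ∀ i < k, s'.vec d (d + 8 + m * d + k * d + i * d) = s.vec d (d + 8 + m * d + i * d)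
      else s'.real = s.real := by
  obtain ⟨hri, hrr, hrw, hrk⟩ := hr
  refine Runs.le (Runs.ite (t₁ := 1 + (1 + (k * d * (1 + 2) + 1))) (t₂ := 1) (fun hb => ?_)
    fun hb => ?_) (by omega)
  · simp only [Test.Holds, RealExp.eval, IntExp.eval, Nat.cast_zero, not_and_or, not_not,
      not_le] at hb
    simp only [if_pos hb]
    refine Runs.then (t₁ := 1) (Runs.setReal' (d + 2) (s.real (d + 3)) rfl (by simp) (by omega)
      rfl) ?_
    rintro _ rfl
    refine Runs.then (t₁ := 1) (Runs.setInt' 18 0 rfl rfl (by omega) (by omega) rfl) ?_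
    rintro _ rfl
    refine (Runs.count (n := k * d) (i₀ := 0) (t := 1)
      (I := fun i s' => (∀ x, x ≠ 18 → s'.int x = s.int x) ∧ s'.real (d + 2) = s.real (d + 3) ∧
        (∀ x, d + 8 ≤ x → x < d + 8 + m * d + k * d → s'.real x = s.real x) ∧
        ∀ i' < i, s'.real (d + 8 + m * d + k * d + i') = s.real (d + 8 + m * d + i'))
      (by omega) (by omega) ?_ (by simp) (by omega) ?_ ?_).mono (by rw [Nat.sub_zero]) ?_
    · rintro i s' ⟨h', -⟩
      simpa [h.c23] using h' 23 (by omega)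
    · exact ⟨fun x hx => by simp [hx], by simp, fun x h₁ h₂ => by
        simp (disch := omega), by simp⟩
    · rintro i s₁ - hi h18 ⟨g₁, g₂, g₃, g₄⟩
      have g21 : s₁.int 21 = d + 8 + m * d := by rw [g₁, h.c21]; omega
      have g22 : s₁.int 22 = d + 8 + m * d + k * d := by rw [g₁, h.c22]; omega
      refine Runs.setReal' (d + 8 + m * d + k * d + i) (s.real (d + 8 + m * d + i))
        (by simp [g22, h18]) ?_ (by omega) ⟨by simpa using h18, fun x hx => ?_, ?_,
          fun x h₁ h₂ => ?_, fun i' hi' => ?_⟩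
      · simp [g21, h18, g₃ (d + 8 + m * d + i) (by omega) (by omega)]
      · simp [hx, g₁ x hx]
      · simp (disch := omega) [g₂]
      · simp (disch := omega) [g₃ x h₁ h₂]
      · rcases Nat.lt_succ_iff_lt_or_eq.1 hi' with hi' | rfl
        · simp (disch := omega) [g₄ i' hi']
        · simp
    · rintro s' ⟨-, g₁, g₂, g₃, g₄⟩
      refine ⟨g₁, fun x h₁ h₂ => g₃ x h₁ (by omega), g₂, fun i hi => State.vec_congr fun j hj => ?_⟩
      have := mul_add_le_mul d hi
      rw [add_assoc _ (i * d), g₄ _ (by omega), add_assoc _ (i * d)]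
  · simp only [Test.Holds, RealExp.eval, IntExp.eval, Nat.cast_zero, not_and_or, not_not,
      not_le] at hb
    simp only [if_neg hb]
    exact Runs.skip ⟨fun _ _ => rfl, fun _ _ _ => rfl, rfl⟩

end Programs

end ColorKMeans

namespace ColorKMeans

/-- A carry reaches the position `z + 1` if it reaches the position `z` and the digit there is `m - 1`. -/
theorem pow_succ_dvd_iff {m z τ : ℕ} (hm : 0 < m) (h : m ^ z ∣ τ + 1) :
    m ^ (z + 1) ∣ τ + 1 ↔ τ / m ^ z % m + 1 = m := by
  have h₁ : (τ + 1) / m ^ z = τ / m ^ z + 1 := by rw [Nat.succ_div, if_pos h]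
  rw [pow_succ, ← Nat.dvd_div_iff_mul_dvd h, h₁, Nat.dvd_iff_mod_eq_zero, ← Nat.mod_add_mod]
  have := Nat.mod_lt (τ / m ^ z) hm
  rcases (Nat.succ_le_of_lt this).eq_or_lt with h₂ | h₂
  · simp [← Nat.succ_eq_add_one, h₂]
  · rw [Nat.mod_eq_of_lt h₂]; omega

/-- Adding one: the digit at the first position without a carry grows by one, the ones after it
stay. -/
theorem digit_add_one {m z τ : ℕ} (hm : 0 < m) (h : m ^ z ∣ τ + 1) (h' : ¬ m ^ (z + 1) ∣ τ + 1)
    (z' : ℕ) : (τ + 1) / m ^ z' % m =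
      if z' < z then 0 else if z' = z then τ / m ^ z % m + 1 else τ / m ^ z' % m := by
  split_ifs with h₁ h₂
  · rw [← Nat.dvd_iff_mod_eq_zero, Nat.dvd_div_iff_mul_dvd ((pow_dvd_pow m h₁.le).trans h),
      ← pow_succ]
    exact (pow_dvd_pow m h₁).trans h
  · subst h₂
    rw [Nat.succ_div, if_pos h, ← Nat.mod_add_mod]
    refine Nat.mod_eq_of_lt (lt_of_le_of_ne (Nat.succ_le_of_lt (Nat.mod_lt _ hm)) ?_)
    exact fun e => h' ((pow_succ_dvd_iff hm h).2 e)
  · rw [Nat.succ_div, if_neg, add_zero]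
    exact fun e => h' ((pow_dvd_pow m (by omega)).trans e)

section Programs

variable {sub : State → ℕ → State → Prop} {M W : ℕ} {d k l m q : ℕ}
  {y : ℕ → EuclideanSpace ℝ (Fin d)} {col w : ℕ → ℕ}

/-- While the carry stands at the position `z`, which is in cell `18`, `m ^ z` divides `τ + 1` and the
digits before `z` have become `0`. -/
theorem nextProg_runs {s : State} {τ : ℕ} (hr : Room d k m q M W) (h : Env d k l m q y col w s)
    (hm : 0 < m) (h17 : s.int 17 = 0)
    (hD : ∀ z < k * q, s.int (35 + 4 * m + z) = τ / m ^ z % m) :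
    Runs sub M W nextProg s (k * q * 3 + 4) fun s' =>
      (∀ x < 35 + 4 * m, x ≠ 17 → x ≠ 18 → s'.int x = s.int x) ∧ s'.real = s.real ∧
      (τ + 1 < m ^ (k * q) → s'.int 17 = 0 ∧
        ∀ z < k * q, s'.int (35 + 4 * m + z) = (τ + 1) / m ^ z % m) ∧
      (τ + 1 = m ^ (k * q) → s'.int 17 = 1) := by
  obtain ⟨hri, hrr, hrw, hrk⟩ := hr
  refine Runs.le (Runs.then (t₁ := 1) (Runs.setInt' 18 0 rfl rfl (by omega) (by omega) rfl)
    (t₂ := (k * q * 3 + 1) + (max 1 1 + 1)) ?_) (by simp; omega)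
  rintro _ rfl
  refine Runs.then (Runs.le (Runs.while (t := 2)
    (I := fun s' => s'.int 18 ≤ k * q ∧ m ^ s'.int 18 ∣ τ + 1 ∧
      (∀ z < s'.int 18, s'.int (35 + 4 * m + z) = 0) ∧
      (∀ z < k * q, s'.int 18 ≤ z → s'.int (35 + 4 * m + z) = τ / m ^ z % m) ∧
      (∀ x < 35 + 4 * m, x ≠ 18 → s'.int x = s.int x) ∧ s'.real = s.real)
    (v := fun s' => k * q - s'.int 18) ?_ ?_) (by simp)) ?_
  · rintro s₁ ⟨g₁, g₂, g₃, g₄, g₅, g₆⟩ hb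
    have g14 : s₁.int 14 = 35 + 4 * m := by rw [g₅, h.c14] <;> omega
    have g15 : s₁.int 15 = k * q := by rw [g₅, h.c15] <;> omega
    have g0 : s₁.int 3 = m := by rw [g₅, h.c3] <;> omega
    simp only [Test.Holds, IntExp.eval, g14, g15, g0, not_le] at hb
    obtain ⟨hb₁, hb₂⟩ := hb
    rw [g₄ _ hb₁ le_rfl] at hb₂
    have hdvd := (pow_succ_dvd_iff hm g₂).2 (le_antisymm hb₂.1 hb₂.2)
    refine Runs.then (t₁ := 1) (t₂ := 1) (Runs.setInt' (35 + 4 * m + s₁.int 18) 0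
      (by simp [g14]) rfl (by omega) (by omega) rfl) ?_
    rintro _ rfl
    refine Runs.setInt' 18 (s₁.int 18 + 1) rfl (by simp (disch := omega)) (by omega) (by omega) ?_
    refine ⟨⟨by simpa using hb₁, by simpa using hdvd, fun z hz => ?_, fun z hz hz' => ?_,
      fun x hx hx' => ?_, g₆⟩, by simp; omega⟩
    · simp only [State.setInt_int_eq] at hz
      rcases Nat.lt_succ_iff_lt_or_eq.1 hz with hz | rfl
      · simp (disch := omega) [g₃ z hz]
      · simp (disch := omega)
    · simp only [State.setInt_int_eq] at hz'
      simp (disch := omega) [g₄ z hz]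
    · simp (disch := omega) [g₅ x hx hx']
  · refine ⟨by simp, by simp, by simp, fun z hz _ => ?_, fun x hx hx' => by simp [hx'], rfl⟩
    simp (disch := omega) [hD z hz]
  rintro s₁ ⟨⟨g₁, g₂, g₃, g₄, g₅, g₆⟩, hb⟩
  have g14 : s₁.int 14 = 35 + 4 * m := by rw [g₅, h.c14] <;> omega
  have g15 : s₁.int 15 = k * q := by rw [g₅, h.c15] <;> omega
  have g0 : s₁.int 3 = m := by rw [g₅, h.c3] <;> omega
  simp only [Test.Holds, IntExp.eval, g14, g15, g0, not_le] at hb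
  refine Runs.ite (fun hz => ?_) fun hz => ?_
  · simp only [Test.Holds, IntExp.eval, g15, not_le] at hz
    have hb₂ : τ / m ^ s₁.int 18 % m + 1 ≠ m := by
      intro e
      refine hb ⟨hz, ?_⟩
      rw [g₄ _ hz le_rfl]
      omega
    have hnd : ¬ m ^ (s₁.int 18 + 1) ∣ τ + 1 := fun e => hb₂ ((pow_succ_dvd_iff hm g₂).1 e)
    have hdig := digit_add_one hm g₂ hnd
    have hlt : τ / m ^ s₁.int 18 % m < m := Nat.mod_lt _ hm
    refine Runs.setInt' (35 + 4 * m + s₁.int 18) (τ / m ^ s₁.int 18 % m + 1) (by simp [g14])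
      (by simp [g14, g₄ _ hz le_rfl]) (by omega) (by omega) ⟨fun x hx h₁ h₂ => ?_, g₆, ?_, ?_⟩
    · simp (disch := omega) [g₅ x hx h₂]
    · refine fun _ => ⟨?_, fun z hz' => ?_⟩
      · simp (disch := omega) [g₅, h17]
      · rw [hdig]
        split_ifs with h₁ h₂
        · simp (disch := omega) [g₃ z h₁]
        · simp (disch := omega) [h₂]
        · simp (disch := omega) [g₄ z hz' (by omega)]
    · intro e
      exact absurd (e ▸ pow_dvd_pow m hz) hnd
  · simp only [Test.Holds, IntExp.eval, g15, not_le, not_lt] at hz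
    refine Runs.setInt' 17 1 rfl rfl (by omega) (by omega) ⟨fun x hx h₁ h₂ => ?_, g₆, ?_, ?_⟩
    · simp (disch := omega) [g₅ x hx h₂]
    · intro e
      rw [le_antisymm g₁ hz] at g₂
      have := Nat.le_of_dvd (by omega) g₂
      omega
    · simp

end Programs

end ColorKMeans

namespace ColorKMeans

/-! ### The search -/

/-- Evaluates one sequence of indices and goes on to the next one. -/
def tryProg (d : ℕ) : Program :=
  .seq (centersProg d) (.seq (callProg d) (.seq (costProg d) (.seq (keepProg d) nextProg)))

/-- The program for the end of the stream: it tries all families of `k` means of `q` representatives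
as centers, and returns the ones of smallest cost. -/
def finishProg (d : ℕ) : Program :=
  .seq (prepareProg d) (.seq (.while (.intLe (.var 17) (.lit 0)) (tryProg d))
    (.setInt (.lit 0) (.var 22)))

/-- `v` is the cost of the centers `b`, and none of the first `τ` sequences of indices leads to
centers of smaller cost; before the first sequence, `v` is `-1`. -/
def BestSoFar {k l d : ℕ} (m q : ℕ) (y : ℕ → EuclideanSpace ℝ (Fin d)) (w : ℕ → ℕ)
    (fc : Fin m → Fin l) (𝒦 : Set (Matrix (Fin k) (Fin l) ℕ)) (τ : ℕ) (v : ℝ)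
    (b : Fin k → EuclideanSpace ℝ (Fin d)) : Prop :=
  (τ = 0 ∧ v = -1) ∨ ∃ A, WSatisfies (fun p => w p) fc 𝒦 A ∧
    v = wcost (fun p : Fin m => y p) A b ∧
    ∀ τ' < τ, ∀ A', WSatisfies (fun p => w p) fc 𝒦 A' →
      v ≤ wcost (fun p : Fin m => y p) A' fun i => candidate y q (fun z => τ' / m ^ z % m) i

theorem wcost_nonneg {m k d : ℕ} (x : Fin m → EuclideanSpace ℝ (Fin d)) (A : Fin m → Fin k → ℕ)
    (c : Fin k → EuclideanSpace ℝ (Fin d)) : 0 ≤ wcost x A c :=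
  Finset.sum_nonneg fun _ _ => Finset.sum_nonneg fun _ _ => by positivity

variable {sub : State → ℕ → State → Prop} {M W : ℕ} {d k l m q : ℕ}
  {y : ℕ → EuclideanSpace ℝ (Fin d)} {col w : ℕ → ℕ} {tA : ℕ} {fc : Fin m → Fin l}
  {𝒦 : Set (Matrix (Fin k) (Fin l) ℕ)}

theorem BestSoFar.keep {τ : ℕ} {v : ℝ} {b : Fin k → EuclideanSpace ℝ (Fin d)}
    (h : BestSoFar m q y w fc 𝒦 τ v b) {A : Fin m → Fin k → ℕ} {u : ℝ}
    (hA : IsOptimalAssignment (fun p : Fin m => y p) (fun p => w p) fc 𝒦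
      (fun i => candidate y q (fun z => τ / m ^ z % m) i) A)
    (hu : u = wcost (fun p : Fin m => y p) A fun i => candidate y q (fun z => τ / m ^ z % m) i)
    (hv : ¬ (v < 0 ∨ u < v)) : BestSoFar m q y w fc 𝒦 (τ + 1) v b := by
  rw [not_or, not_lt, not_lt] at hv
  rcases h with ⟨-, h⟩ | ⟨A₀, h₁, h₂, h₃⟩
  · linarith
  · refine .inr ⟨A₀, h₁, h₂, fun τ' hτ' A' hA' => ?_⟩
    rcases Nat.lt_succ_iff_lt_or_eq.1 hτ' with hτ' | rfl
    · exact h₃ τ' hτ' A' hA'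
    · exact (hv.2.trans hu.le).trans (hA.2 A' hA')

theorem BestSoFar.replace {τ : ℕ} {v : ℝ} {b : Fin k → EuclideanSpace ℝ (Fin d)}
    (h : BestSoFar m q y w fc 𝒦 τ v b) {A : Fin m → Fin k → ℕ} {u : ℝ}
    (hA : IsOptimalAssignment (fun p : Fin m => y p) (fun p => w p) fc 𝒦
      (fun i => candidate y q (fun z => τ / m ^ z % m) i) A)
    (hu : u = wcost (fun p : Fin m => y p) A fun i => candidate y q (fun z => τ / m ^ z % m) i)
    (hv : v < 0 ∨ u < v) : BestSoFar m q y w fc 𝒦 (τ + 1) u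
      (fun i => candidate y q (fun z => τ / m ^ z % m) i) := by
  refine .inr ⟨A, hA.1, hu, fun τ' hτ' A' hA' => ?_⟩
  rcases Nat.lt_succ_iff_lt_or_eq.1 hτ' with hτ' | rfl
  · rcases h with ⟨rfl, -⟩ | ⟨A₀, h₁, h₂, h₃⟩
    · omega
    · refine le_trans (hv.resolve_left ?_).le (h₃ τ' hτ' A' hA')
      rw [h₂]
      exact (wcost_nonneg _ _ _).not_gt
  · exact hu.le.trans (hA.2 A' hA')

/-- The memory before the sequence number `τ` is tried.  The current indices are the digits of `τ` to the
base `m`, and the cell `17` is the mark that the search is over. -/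
structure SearchInv (d k l m q : ℕ) (y : ℕ → EuclideanSpace ℝ (Fin d)) (col w : ℕ → ℕ)
    (fc : Fin m → Fin l) (𝒦 : Set (Matrix (Fin k) (Fin l) ℕ)) (τ : ℕ) (s : State) : Prop where
  env : Env d k l m q y col w s
  index_le : τ ≤ m ^ (k * q)
  digits : τ < m ^ (k * q) →
    s.int 17 = 0 ∧ ∀ z < k * q, s.int (35 + 4 * m + z) = τ / m ^ z % m
  ended : τ = m ^ (k * q) → s.int 17 = 1
  best : BestSoFar m q y w fc 𝒦 τ (s.real (d + 2))
    fun i => s.vec d (d + 8 + m * d + k * d + i * d)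

/-- A bound on the number of steps for one sequence of indices. -/
def tryTime (d k m q tA : ℕ) : ℕ :=
  (k * (q * (d + 4) + d + 5) + 3) + ((tA + (3 + 2 * m) + (m + k) * d + m * k + 1) +
    ((m * (k * 4 + 4) + 4) + ((k * d * 3 + 4) + (k * q * 3 + 4))))

theorem tryProg_runs {s : State} {τ : ℕ} (hr : Room d k m q M W)
    (h : SearchInv d k l m q y col w fc 𝒦 τ s) (hτ : τ < m ^ (k * q)) (hm : 0 < m)
    (hfc : ∀ p : Fin m, col p = fc p) (hw : ∀ p < m, w p ≤ W) (ho : Oracle sub tA m y w fc 𝒦) :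
    Runs sub M W (tryProg d) s (tryTime d k m q tA)
      (SearchInv d k l m q y col w fc 𝒦 (τ + 1)) := by
  have he := h.env
  obtain ⟨h17, hdig⟩ := h.digits hτ
  refine Runs.then (centersProg_runs (D := fun z => τ / m ^ z % m) hr he
    (fun z _ => Nat.mod_lt _ hm) hdig) ?_
  rintro s₁ ⟨a₁, a₂, a₃⟩
  have he₁ : Env d k l m q y col w s₁ :=
    he.congr (fun x _ h₁ h₂ h₃ h₄ => a₂ x h₂ h₃ h₄) fun x _ hx => a₃ x (.inl hx)
  refine Runs.then (callProg_runs hr he₁ hfc a₁ hw ho) ?_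
  rintro s₂ ⟨⟨A, hA, hA'⟩, b₁, b₂⟩
  have he₂ : Env d k l m q y col w s₂ :=
    he₁.congr (fun x hx _ _ _ _ => b₁ x (by omega)) fun x _ _ => by rw [b₂]
  have a₁' : ∀ i < k, s₂.vec d (d + 8 + m * d + i * d) =
      candidate y q (fun z => τ / m ^ z % m) i := fun i hi => by
    rw [← a₁ i hi]; exact State.vec_congr fun j _ => by rw [b₂]
  refine Runs.then (costProg_runs hr he₂ a₁' hA') ?_
  rintro s₃ ⟨c₁, c₂, c₃⟩
  have he₃ : Env d k l m q y col w s₃ :=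
    he₂.congr (fun x _ _ h₂ h₃ h₄ => c₂ x h₂ h₃ h₄) fun x hx _ => c₃ x (by omega)
  have a₁'' : ∀ i < k, s₃.vec d (d + 8 + m * d + i * d) =
      candidate y q (fun z => τ / m ^ z % m) i := fun i hi => by
    rw [← a₁' i hi]; exact State.vec_congr fun j _ => c₃ _ (by omega)
  have hold : ∀ x, (x < d + 8 + m * d ∨ d + 8 + m * d + k * d ≤ x) → x ≠ d + 3 →
      s₃.real x = s.real x := fun x hx hx' => by rw [c₃ x hx', b₂, a₃ x hx]
  refine Runs.then (keepProg_runs hr he₃) ?_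
  rintro s₄ ⟨e₁, e₂, e₃⟩
  have he₄ : Env d k l m q y col w s₄ :=
    he₃.congr (fun x _ _ h₂ _ _ => e₁ x h₂) fun x hx hx' => e₂ x hx hx'
  have hbest : BestSoFar m q y w fc 𝒦 (τ + 1) (s₄.real (d + 2))
      fun i => s₄.vec d (d + 8 + m * d + k * d + i * d) := by
    split_ifs at e₃ with hv
    · rw [e₃.1, show (fun i : Fin k => s₄.vec d (d + 8 + m * d + k * d + i * d)) = _ from
        funext fun i => (e₃.2 i i.2).trans (a₁'' i i.2)]
      rw [hold (d + 2) (.inl (by omega)) (by omega)] at hv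
      exact h.best.replace hA c₁ hv
    · rw [e₃, hold (d + 2) (.inl (by omega)) (by omega),
        show (fun i : Fin k => s₄.vec d (d + 8 + m * d + k * d + i * d)) =
          fun i : Fin k => s.vec d (d + 8 + m * d + k * d + i * d) from
        funext fun i => State.vec_congr fun j _ => by
          rw [e₃, hold _ (.inr (by omega)) (by omega)]]
      rw [hold (d + 2) (.inl (by omega)) (by omega)] at hv
      exact h.best.keep hA c₁ hv
  have hint : ∀ x < 35 + 4 * m + k * q, x ≠ 18 → x ≠ 19 → x ≠ 20 → s₄.int x = s.int x :=
    fun x hx h₁ h₂ h₃ => by rw [e₁ x h₁, c₂ x h₁ h₂ h₃, b₁ x hx, a₂ x h₁ h₂ h₃]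
  refine (nextProg_runs hr he₄ hm (by rw [hint, h17] <;> omega) fun z hz => by
    rw [hint, hdig z hz] <;> omega).imp ?_
  rintro s₅ ⟨f₁, f₂, f₃, f₄⟩
  refine ⟨he₄.congr (fun x hx h₁ h₂ _ _ => f₁ x hx h₁ h₂) fun x _ _ => by rw [f₂], hτ, f₃, f₄, ?_⟩
  simpa only [State.vec, f₂] using hbest

/-- Every choice of `q` indices for each of `k` clusters is a sequence of digits. -/
theorem exists_digits (g : Fin k → Fin q → Fin m) :
    ∃ τ < m ^ (k * q), ∀ (i : Fin k) (t : Fin q), τ / m ^ (i * q + t : ℕ) % m = g i t := by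
  let h : Fin (k * q) → Fin m := fun z => g (finProdFinEquiv.symm z).1 (finProdFinEquiv.symm z).2
  refine ⟨finFunctionFinEquiv h, (finFunctionFinEquiv h).2, fun i t => ?_⟩
  have := finFunctionFinEquiv_symm_apply_val (finFunctionFinEquiv h) (finProdFinEquiv (i, t))
  rw [Equiv.symm_apply_apply] at this
  simp only [h, Equiv.symm_apply_apply, finProdFinEquiv_apply_val] at this
  rw [this, show (i * q + t : ℕ) = t + q * i by ring]

theorem candidate_eq_seqMean {τ : ℕ} {g : Fin k → Fin q → Fin m}
    (h : ∀ (i : Fin k) (t : Fin q), τ / m ^ (i * q + t : ℕ) % m = g i t) (i : Fin k) :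
    candidate y q (fun z => τ / m ^ z % m) i = seqMean (fun p : Fin m => y p) (g i) := by
  simp only [candidate, seqMean, Finset.sum_range, h, Finset.smul_sum]

/-- Without points (`m = 0`) no sequence is tried, and the claim is void. -/
theorem finishProg_runs {s : State} {ε : ℝ} (hε : 0 < ε) (hr : Room d k m ⌈8 / ε⌉₊ M W)
    (h0 : s.int 0 = k) (h1 : s.int 1 = l) (h3 : s.int 3 = m) (hrε : s.real 0 = ε) (hk : 1 ≤ k)
    (hl : l ≤ W) (hs : ∀ i < m, s.slot d i = (col i, w i, y i))
    (hfc : ∀ p : Fin m, col p = fc p) (hw : ∀ i < m, w i ≤ W) (ho : Oracle sub tA m y w fc 𝒦) :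
    Runs sub M W (finishProg d) s ((2 * ⌈8 / ε⌉₊ + m * 4 + 3 * (k * ⌈8 / ε⌉₊) + 18) +
      (m ^ (k * ⌈8 / ε⌉₊) * (tryTime d k m ⌈8 / ε⌉₊ tA + 1) + 1 + 1)) fun s' =>
      0 < m → ∃ A, WSatisfies (fun p => w p) fc 𝒦 A ∧
        ∀ (g : Fin k → Fin ⌈8 / ε⌉₊ → Fin m) (A' : Fin m → Fin k → ℕ),
          WSatisfies (fun p => w p) fc 𝒦 A' →
          wcost (fun p : Fin m => y p) A (outputCenters d k s') ≤
            wcost (fun p : Fin m => y p) A' fun i => seqMean (fun p : Fin m => y p) (g i) := by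
  set q := ⌈8 / ε⌉₊ with hq
  have hq1 : 1 ≤ q := Nat.one_le_iff_ne_zero.2 (Nat.ceil_pos.2 (by positivity)).ne'
  have hkq : k * q ≠ 0 := by positivity
  refine Runs.then (prepareProg_runs hε hr h0 h1 h3 hrε hk hl hs (fun i hi => ?_) hw) ?_
  · rw [hfc ⟨i, hi⟩]; exact (fc ⟨i, hi⟩).2.le.trans hl
  rintro s₁ ⟨he, h17, hodo, hbest⟩
  refine Runs.then (Runs.while_index (n := m ^ (k * q)) (t := tryTime d k m q tA)
    (I := fun n s' => ∃ τ, n + τ = m ^ (k * q) ∧ SearchInv d k l m q y col w fc 𝒦 τ s') ?_ ?_) ?_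
  · rintro n s₂ ⟨τ, hn, h⟩ hb
    have hb : s₂.int 17 = 0 := by simpa using hb
    have hτ : τ < m ^ (k * q) := lt_of_le_of_ne h.index_le fun e => by simp [h.ended e] at hb
    have hm : 0 < m := by
      rcases Nat.eq_zero_or_pos m with rfl | hm
      · rw [zero_pow hkq] at hτ; omega
      · exact hm
    exact (tryProg_runs hr h hτ hm hfc hw ho).imp fun s₃ h₃ =>
      ⟨n - 1, by omega, τ + 1, by omega, h₃⟩
  · refine ⟨0, rfl, he, Nat.zero_le _, fun hpos => ?_, fun hz => ?_, .inl ⟨rfl, hbest⟩⟩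
    · have hm : 0 < m := by
        rcases Nat.eq_zero_or_pos m with rfl | hm
        · rw [zero_pow hkq] at hpos; omega
        · exact hm
      exact ⟨by omega, fun z hz => by simp [hodo z hz]⟩
    · have : m = 0 := eq_zero_of_pow_eq_zero hz.symm
      omega
  · rintro s₂ ⟨n, ⟨τ, -, h⟩, hb⟩
    have hb : s₂.int 17 ≠ 0 := by simpa using hb
    have hτ : τ = m ^ (k * q) := by
      by_contra hne
      exact hb (h.digits (lt_of_le_of_ne h.index_le hne)).1
    obtain ⟨hri, hrr, hrw, hrk⟩ := hr
    refine Runs.setInt' 0 (d + 8 + m * d + k * d) rfl (by simp [h.env.c22]) (by omega) (by omega) ?_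
    intro hm
    have hout : outputCenters d k (s₂.setInt 0 (d + 8 + m * d + k * d)) =
        fun i : Fin k => s₂.vec d (d + 8 + m * d + k * d + i * d) := by
      funext i; ext j; simp [outputCenters, add_assoc]
    have hpos : 0 < τ := hτ ▸ Nat.pow_pos hm
    obtain ⟨A, h₁, h₂, h₃⟩ := h.best.resolve_left fun e => by omega
    refine ⟨A, h₁, fun g A' hA' => ?_⟩
    obtain ⟨τ', hτ', hg⟩ := exists_digits g
    rw [hout, ← h₂]
    simpa only [candidate_eq_seqMean hg] using h₃ τ' (hτ ▸ hτ') A' hA'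

end ColorKMeans

namespace ColorKMeans

/-! ### From the stream to the centers -/

section

variable {n d k l : ℕ} {x : Fin n → EuclideanSpace ℝ (Fin d)} {f : Fin n → ℕ} {δ : ℝ}
  {R : List (Rep (Fin n) d)}

/-- Every point of the stream has exactly one representative. -/
theorem Frozen.exists_index (h : Frozen x f k l δ R (List.finRange n)) :
    ∃ s : Fin n → Fin R.length, ∀ p i, s p = i ↔ p ∈ R[i].mem := by
  have hmem : ∀ p, ∃ i : Fin R.length, p ∈ R[i].mem := fun p => by
    obtain ⟨g, hg, hp⟩ := List.mem_flatMap.1 (h.perm.mem_iff.2 (List.mem_finRange p))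
    obtain ⟨i, hi, rfl⟩ := List.mem_iff_getElem.1 hg
    exact ⟨⟨i, hi⟩, hp⟩
  have hdis := (List.nodup_flatMap.1 (h.perm.nodup_iff.2 (List.nodup_finRange n))).2
  rw [List.pairwise_iff_getElem] at hdis
  choose s hs using hmem
  refine ⟨s, fun p i => ⟨fun e => e ▸ hs p, fun hp => ?_⟩⟩
  rcases lt_trichotomy (s p) i with hlt | heq | hlt
  · exact (hdis _ _ (s p).2 i.2 hlt (hs p) hp).elim
  · exact heq
  · exact (hdis _ _ i.2 (s p).2 hlt hp (hs p)).elim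

theorem Frozen.nodup (h : Frozen x f k l δ R (List.finRange n)) {g : Rep (Fin n) d} (hg : g ∈ R) :
    g.mem.Nodup :=
  (List.nodup_flatMap.1 (h.perm.nodup_iff.2 (List.nodup_finRange n))).1 g hg

variable {s : Fin n → Fin R.length}

theorem Frozen.weight_eq (h : Frozen x f k l δ R (List.finRange n))
    (hs : ∀ p i, s p = i ↔ p ∈ R[i].mem) (i : Fin R.length) :
    R[i].weight = (Finset.univ.filter fun p => s p = i).card := by
  classical
  have : (Finset.univ.filter fun p => s p = i) = R[i].mem.toFinset := by
    ext p; simp [hs]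
  rw [this]
  exact (List.toFinset_card_of_nodup (h.nodup (List.getElem_mem i.2))).symm

theorem Frozen.sum_dist_sq_le (h : Frozen x f k l δ R (List.finRange n))
    (hs : ∀ p i, s p = i ↔ p ∈ R[i].mem) (c : Fin k → EuclideanSpace ℝ (Fin d))
    (α : Fin n → Fin k) : ∑ p, dist (x p) R[s p].pos ^ 2 ≤ δ * cost x α c := by
  classical
  have h₁ : cost x α c = ptCost x c α (List.finRange n) := by
    rw [cost, ptCost, Fin.sum_univ_def]
  have h₂ : ∑ p, dist (x p) R[s p].pos ^ 2 = totalMovement x R := by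
    rw [totalMovement, ← Fin.sum_univ_fun_getElem, ← Finset.sum_fiberwise (g := s)]
    refine Finset.sum_congr rfl fun i _ => ?_
    have : (Finset.univ.filter fun p => s p = i) = R[i].mem.toFinset := by
      ext p; simp [hs]
    rw [Rep.movement, ← List.sum_toFinset _ (h.nodup (List.getElem_mem _))]
    refine Finset.sum_congr this fun p hp => ?_
    obtain rfl := (hs p i).2 (by simpa using hp)
    rfl
  rw [h₁, h₂]
  exact h.movement_le c α

end

/-- After the stream, centers are found that are nearly optimal for the points of the stream. -/
theorem StreamInv.finish {sub : State → ℕ → State → Prop} {M W n d k l j tA : ℕ} {ε T : ℝ}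
    {x : Fin n → EuclideanSpace ℝ (Fin d)} {f : Fin n → Fin l} {s : State}
    {F L : List (Rep (Fin n) d)} {done cur : List (Fin n)}
    {𝒦 : Set (Matrix (Fin k) (Fin l) ℕ)} (hε : 0 < ε) (hε1 : ε < 1) (hk : 1 ≤ k)
    (h : StreamInv x (fun p => f p) k l ε s j T F L done cur) (hn : done ++ cur = List.finRange n)
    (hr : Room d k (F.length + L.length) ⌈8 / ε⌉₊ M W) (hl : l ≤ W) (hnW : n ≤ W)
    (hK : 𝒦.Nonempty) (hc : IsColorConstraint (fun _ => 1) f 𝒦)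
    (ho : ∀ (y : ℕ → EuclideanSpace ℝ (Fin d)) (w : ℕ → ℕ)
      (fc : Fin (F.length + L.length) → Fin l), (∀ p : Fin (F.length + L.length), 0 < w p) →
      ∑ p : Fin (F.length + L.length), w p = n →
      IsColorConstraint (fun p : Fin (F.length + L.length) => w p) fc 𝒦 →
      Oracle sub tA (F.length + L.length) y w fc 𝒦) :
    Runs sub M W (finishProg d) s
      ((2 * ⌈8 / ε⌉₊ + (F.length + L.length) * 4 + 3 * (k * ⌈8 / ε⌉₊) + 18) +
        ((F.length + L.length) ^ (k * ⌈8 / ε⌉₊) *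
          (tryTime d k (F.length + L.length) ⌈8 / ε⌉₊ tA + 1) + 1 + 1))
      fun s' => ∀ c, colorCost x f 𝒦 (outputCenters d k s') ≤ (1 + ε) * colorCost x f 𝒦 c := by
  have hfr : Frozen x (fun p => (f p : ℕ)) k l (ε ^ 2 / 144) (F ++ L) (List.finRange n) := by
    rw [← hn]
    exact h.frozen.append (h.summary.frozen h.cur_lt.le)
  have hlen : (F ++ L).length = F.length + L.length := List.length_append
  have hholds := h.holds
  have htotal := h.total
  rw [← hlen] at hr ho htotal ⊢
  clear hlen
  generalize F ++ L = R at *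
  obtain ⟨ix, hix⟩ := hfr.exists_index
  set y : ℕ → EuclideanSpace ℝ (Fin d) := fun i => (s.slot d i).2.2 with hy
  set w : ℕ → ℕ := fun i => (s.slot d i).2.1 with hw
  set col : ℕ → ℕ := fun i => (s.slot d i).1 with hcol
  have hslot : ∀ i : Fin R.length, s.slot d i = R[i].data := fun i => by
    simpa using hholds i i.2
  have hwR : ∀ i : Fin R.length, w i = R[i].weight := fun i => by rw [hw]; simp [hslot, Rep.data]
  have hyR : ∀ i : Fin R.length, y i = R[i].pos := fun i => by rw [hy]; simp [hslot, Rep.data]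
  let fc : Fin R.length → Fin l := fun i => ⟨R[i].color, hfr.color_lt _ (List.getElem_mem _)⟩
  have hfc : ∀ i : Fin R.length, col i = fc i := fun i => by rw [hcol]; simp [hslot, Rep.data, fc]
  have hsf : ∀ p, fc (ix p) = f p := fun p => by
    refine Fin.ext ?_
    exact (hfr.color _ (List.getElem_mem _) p ((hix p _).1 rfl)).symm
  have hwc : ∀ i : Fin R.length, w i = (Finset.univ.filter fun p => ix p = i).card := fun i => by
    rw [hwR, hfr.weight_eq hix]
  have hwpos : ∀ i : Fin R.length, 0 < w i := fun i => by
    rw [hwR]; exact List.length_pos_iff.2 (hfr.ne_nil _ (List.getElem_mem _))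
  have hwsum : ∑ i : Fin R.length, w i = n := by
    simp only [hwc]
    rw [← Finset.card_eq_sum_card_fiberwise (fun p _ => Finset.mem_univ _)]
    simp
  have hwle : ∀ i < R.length, w i ≤ W := fun i hi =>
    ((Finset.single_le_sum (f := fun i : Fin R.length => w i) (fun _ _ => Nat.zero_le _)
      (Finset.mem_univ ⟨i, hi⟩)).trans hwsum.le).trans hnW
  refine (finishProg_runs (y := y) (w := w) (col := col) (fc := fc) hε hr h.clusters h.colors htotal
    h.eps hk hl (fun i _ => rfl) hfc hwle
    (ho y w fc hwpos hwsum (isColorConstraint_weights hsf hwc hc))).imp ?_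
  intro s' hs' c
  refine colorCost_le_of_best (y := fun i : Fin R.length => y i) (w := fun i => w i) (s := ix) hε hε1
    hsf hwc (fun c α => ?_) (q := ⌈8 / ε⌉₊) ?_ (exists_satisfies hK hc) hs' c
  · simp only [hyR]
    exact hfr.sum_dist_sq_le hix c α
  · have := Nat.le_ceil (8 / ε)
    rwa [div_le_iff₀ hε] at this

end ColorKMeans

namespace ColorKMeans

/-! ### Bounds in terms of the base -/

section

variable {d k l n : ℕ} {ε : ℝ}

/-- The bound is `log 3 = (3 * log 2 + log (9 / 8)) / 2`, up to rounding; its eighth power exceeds `2`. -/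
theorem le_log_add_three (n : ℕ) : 1.095 ≤ Real.log ((n : ℝ) + 3) := by
  have h₁ : Real.log 3 ≤ Real.log ((n : ℝ) + 3) :=
    Real.log_le_log (by norm_num) (by linarith [Nat.cast_nonneg (α := ℝ) n])
  have h₂ : 2 * Real.log 3 = 3 * Real.log 2 + Real.log (9 / 8) := by
    have e₁ : 2 * Real.log 3 = Real.log (3 ^ 2) := by rw [Real.log_pow]; norm_num
    have e₂ : 3 * Real.log 2 = Real.log (2 ^ 3) := by rw [Real.log_pow]; norm_num
    rw [e₁, e₂, ← Real.log_mul (by norm_num) (by norm_num)]; norm_num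
  have h₃ := Real.one_sub_inv_le_log_of_pos (show (0 : ℝ) < 9 / 8 by norm_num)
  have h₄ := Real.log_two_gt_d9
  norm_num at h₃ ⊢
  linarith

/-- The base dominates each of its factors, and a fixed power of it exceeds `2`. -/
theorem base_bounds (hd : 1 ≤ d) (hk : 1 ≤ k) (hl : 1 ≤ l) (hε : 0 < ε) (hε1 : ε < 1) :
    1 ≤ base d k l n ε ∧ (k : ℝ) ≤ base d k l n ε ∧ (l : ℝ) ≤ base d k l n ε ∧
      1 / ε ≤ base d k l n ε ∧ Real.log ((n : ℝ) + 3) ≤ base d k l n ε ∧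
      2 ≤ base d k l n ε ^ 8 := by
  have hL := le_log_add_three n
  have hk' : (1 : ℝ) ≤ k := by exact_mod_cast hk
  have hl' : (1 : ℝ) ≤ l := by exact_mod_cast hl
  have hi : 1 ≤ ε⁻¹ := (one_le_inv₀ hε).2 hε1.le
  have hp : ε⁻¹ ≤ ε⁻¹ ^ d := le_self_pow₀ hi (by omega)
  have hp1 : 1 ≤ ε⁻¹ ^ d := hi.trans hp
  rw [base]
  set L := Real.log ((n : ℝ) + 3)
  set E := ε⁻¹ ^ d
  have hlk : (1 : ℝ) ≤ l * k := one_le_mul_of_one_le_of_one_le hl' hk'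
  have hlkE : (1 : ℝ) ≤ l * k * E := one_le_mul_of_one_le_of_one_le hlk hp1
  have hL1 : 1 ≤ L := by linarith
  have h₁ : l * k * E ≤ l * k * E * L := le_mul_of_one_le_right (by positivity) hL1
  have h₂ : (l * k : ℝ) ≤ l * k * E := le_mul_of_one_le_right (by positivity) hp1
  have h₃ : L ≤ l * k * E * L := le_mul_of_one_le_left (by positivity) hlkE
  have h₄ : E ≤ l * k * E := le_mul_of_one_le_left (by positivity) hlk
  refine ⟨by linarith, ?_, ?_, ?_, h₃, ?_⟩
  · exact (le_mul_of_one_le_left (by positivity) hl').trans (h₂.trans h₁)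
  · exact (le_mul_of_one_le_right (by positivity) hk').trans (h₂.trans h₁)
  · rw [one_div]; exact hp.trans (h₄.trans h₁)
  · calc (2 : ℝ) ≤ 1.095 ^ 8 := by norm_num
      _ ≤ _ := pow_le_pow_left₀ (by norm_num) (hL.trans h₃) 8

/-- The number of the last epoch that begins, with room for one further point. -/
def lastEpoch (n : ℕ) : ℕ := Nat.log 2 (n + 1)

theorem le_lastEpoch {j : ℕ} (h : 2 ^ j ≤ n + 1) : j ≤ lastEpoch n :=
  Nat.le_log_of_pow_le (by norm_num) h

theorem size_le_lastEpoch (n : ℕ) : Nat.size n ≤ lastEpoch n + 1 := by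
  rw [Nat.size_le]
  have := Nat.lt_pow_succ_log_self (b := 2) (by norm_num) (n + 1)
  rw [lastEpoch]
  omega

theorem lastEpoch_le (n : ℕ) : (lastEpoch n : ℝ) + 1 ≤ 3 * Real.log ((n : ℝ) + 3) := by
  have h₁ : ((2 : ℝ) ^ lastEpoch n) ≤ n + 3 := by
    have : 2 ^ lastEpoch n ≤ n + 1 := Nat.pow_log_le_self 2 (by omega)
    have : (2 : ℝ) ^ lastEpoch n ≤ n + 1 := by exact_mod_cast this
    linarith
  have h₂ := Real.log_le_log (by positivity) h₁
  rw [Real.log_pow] at h₂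
  have h₃ := Real.log_two_gt_d9
  have h₄ := le_log_add_three n
  have h₅ : (lastEpoch n : ℝ) * (1 / 2) ≤ lastEpoch n * Real.log 2 := by
    gcongr; linarith
  linarith

/-- A bound on the number of representatives at any time. -/
noncomputable def slots (d k l n : ℕ) (ε : ℝ) : ℕ :=
  ⌈(lastEpoch n + 1) * capReal d k l ε (lastEpoch n) + 2⌉₊

/-- The quantity in which all the bounds are polynomial. -/
noncomputable def magnitude (d k l n : ℕ) (ε : ℝ) : ℕ :=
  d + k + l + ⌈8 / ε⌉₊ + slots d k l n ε + Nat.size n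

theorem cap_add_two_le_slots (hε : 0 < ε) {j : ℕ} (h : 2 ^ j ≤ n + 1) :
    (j + 1) * capReal d k l ε j + 2 ≤ slots d k l n ε := by
  have h₁ : (j : ℝ) ≤ lastEpoch n := by exact_mod_cast le_lastEpoch h
  have h₂ := capReal_mono (d := d) (k := k) (l := l) hε (le_lastEpoch h)
  have h₃ := capReal_nonneg (d := d) (k := k) (l := l) hε j
  refine le_trans ?_ (Nat.le_ceil _)
  gcongr

/-- The exponent with which the magnitude is bounded by a power of the base. -/
def magnitudeExp (d : ℕ) : ℕ := (8 * d + 106) * d + 84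

theorem slots_le (hd : 1 ≤ d) (hk : 1 ≤ k) (hl : 1 ≤ l) (hε : 0 < ε) (hε1 : ε < 1) :
    (slots d k l n ε : ℝ) ≤ base d k l n ε ^ ((8 * d + 106) * d + 60) := by
  obtain ⟨h1, hkB, hlB, hεB, hLB, h2⟩ := base_bounds (n := n) hd hk hl hε hε1
  have hJ := lastEpoch_le n
  rw [slots]
  set B := base d k l n ε
  set J : ℝ := ((lastEpoch n : ℕ) : ℝ)
  have hcap0 : 0 ≤ capReal d k l ε (lastEpoch n) := capReal_nonneg hε _
  have hJ0 : (0 : ℝ) ≤ J := Nat.cast_nonneg _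
  have hB0 : 0 ≤ B := by linarith
  have hJB : J + 1 ≤ B ^ 17 := by
    calc J + 1 ≤ (2 * 2) * B := by linarith
      _ ≤ (B ^ 8 * B ^ 8) * B := by gcongr
      _ = B ^ 17 := by ring
  have hdB : (d : ℝ) ≤ B ^ (8 * d) := by
    calc (d : ℝ) ≤ 2 ^ d := by exact_mod_cast Nat.lt_two_pow_self.le
      _ ≤ (B ^ 8) ^ d := by gcongr
      _ = _ := (pow_mul _ _ _).symm
  have hin : 1224 * d * (J + 1) / ε ≤ B ^ (8 * d + 106) := by
    calc 1224 * d * (J + 1) / ε = 1224 * d * (J + 1) * (1 / ε) := by ring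
      _ ≤ (2 ^ 11) * B ^ (8 * d) * B ^ 17 * B := by gcongr; norm_num
      _ ≤ ((B ^ 8) ^ 11) * B ^ (8 * d) * B ^ 17 * B := by gcongr
      _ = _ := by rw [← pow_mul, ← pow_add, ← pow_add, ← pow_succ]; congr 1; omega
  have hcap : capReal d k l ε (lastEpoch n) ≤ B ^ ((8 * d + 106) * d + 27) := by
    rw [capReal]
    calc 2 * (l : ℝ) * k * (J + 1) * (1224 * d * (J + 1) / ε) ^ d
        ≤ B ^ 8 * B * B * B ^ 17 * (B ^ (8 * d + 106)) ^ d := by gcongr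
      _ = _ := by rw [← pow_mul]; ring
  have hprod : (J + 1) * capReal d k l ε (lastEpoch n) ≤ B ^ ((8 * d + 106) * d + 44) := by
    calc _ ≤ B ^ 17 * B ^ ((8 * d + 106) * d + 27) := by gcongr
      _ = _ := by ring
  have h8 : B ^ 8 ≤ B ^ ((8 * d + 106) * d + 44) := pow_le_pow_right₀ h1 (by omega)
  have hc := Nat.ceil_lt_add_one (show 0 ≤ (J + 1) * capReal d k l ε (lastEpoch n) + 2 by positivity)
  calc _ ≤ (2 * 2) * B ^ ((8 * d + 106) * d + 44) := by linarith
    _ ≤ (B ^ 8 * B ^ 8) * B ^ ((8 * d + 106) * d + 44) := by gcongr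
    _ = _ := by ring

theorem magnitude_le (hd : 1 ≤ d) (hk : 1 ≤ k) (hl : 1 ≤ l) (hε : 0 < ε) (hε1 : ε < 1) :
    (magnitude d k l n ε : ℝ) ≤ base d k l n ε ^ magnitudeExp d := by
  obtain ⟨h1, hkB, hlB, hεB, hLB, h2⟩ := base_bounds (n := n) hd hk hl hε hε1
  have hJ := lastEpoch_le n
  have hs := slots_le (n := n) hd hk hl hε hε1
  have hsize : (Nat.size n : ℝ) ≤ lastEpoch n + 1 := by exact_mod_cast size_le_lastEpoch n
  have hq := Nat.ceil_lt_add_one (show 0 ≤ 8 / ε by positivity)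
  have hq' : 8 / ε = 8 * (1 / ε) := by ring
  rw [magnitude, magnitudeExp]
  set B := base d k l n ε
  have hB0 : 0 ≤ B := by linarith
  have hdB : (d : ℝ) ≤ B ^ (8 * d) := by
    calc (d : ℝ) ≤ 2 ^ d := by exact_mod_cast Nat.lt_two_pow_self.le
      _ ≤ (B ^ 8) ^ d := by gcongr
      _ = _ := (pow_mul _ _ _).symm
  have hdE : B ^ (8 * d) ≤ B ^ ((8 * d + 106) * d + 60) := pow_le_pow_right₀ h1 (by nlinarith)
  have hBE : B * B ^ 32 ≤ B ^ ((8 * d + 106) * d + 60) := by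
    rw [← pow_succ']
    exact pow_le_pow_right₀ h1 (by nlinarith)
  have h16 : (16 : ℝ) ≤ B ^ 32 := by
    calc (16 : ℝ) = 2 ^ 4 := by norm_num
      _ ≤ (B ^ 8) ^ 4 := by gcongr
      _ = _ := by ring
  have hBE' : B * 16 ≤ B ^ ((8 * d + 106) * d + 60) := (mul_le_mul_of_nonneg_left h16 hB0).trans hBE
  push_cast
  calc _ ≤ (2 ^ 3) * B ^ ((8 * d + 106) * d + 60) := by linarith
    _ ≤ ((B ^ 8) ^ 3) * B ^ ((8 * d + 106) * d + 60) := by gcongr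
    _ = _ := by ring

theorem ten_le_magnitude (hd : 1 ≤ d) (hk : 1 ≤ k) (hl : 1 ≤ l) (hε : 0 < ε) (hε1 : ε < 1) :
    10 ≤ magnitude d k l n ε := by
  have : 8 < ⌈8 / ε⌉₊ := by
    rw [Nat.lt_ceil, lt_div_iff₀ hε]
    push_cast
    linarith
  rw [magnitude]
  omega

end

end ColorKMeans

namespace ColorKMeans

section

variable {d k l m q mx G e M W n : ℕ}

/-! ### Running time and memory -/

theorem tryTime_add_one_le {tA : ℕ} (hG : 10 ≤ G) (hd : d ≤ G) (hk : k ≤ G) (hm : m ≤ G)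
    (hq : q ≤ G) : tryTime d k m q tA + 1 ≤ tA + G ^ 4 := by
  calc tryTime d k m q tA + 1 ≤ tryTime G G G G tA + 1 := by unfold tryTime; gcongr
    _ = tA + (G ^ 3 + 18 * G ^ 2 + 11 * G + 20) := by unfold tryTime; ring
    _ ≤ tA + G ^ 4 := by
      obtain ⟨a, rfl⟩ := Nat.exists_eq_add_of_le hG
      ring_nf
      omega

/-- A bound on the number of steps after the pass. -/
theorem finishTime_le (hG : 10 ≤ G) (hd : d ≤ G) (hk : k ≤ G) (hm : m ≤ G) (hq : q ≤ G) :
    (2 * q + m * 4 + 3 * (k * q) + 18) + (m ^ (k * q) * (tryTime d k m q (G ^ e) + 1) + 1 + 1) ≤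
      G ^ (k * q + e + 6) := by
  have h₁ : tryTime d k m q (G ^ e) + 1 ≤ G ^ (e + 5) := by
    have h₀ := tryTime_add_one_le (tA := G ^ e) hG hd hk hm hq
    have h₂ : G ^ e ≤ G ^ (e + 4) := Nat.pow_le_pow_right (by omega) (by omega)
    have h₃ : G ^ 4 ≤ G ^ (e + 4) := Nat.pow_le_pow_right (by omega) (by omega)
    have h₄ : G ^ (e + 5) = G ^ (e + 4) * G := by ring
    nlinarith
  have h₂ : m ^ (k * q) * (tryTime d k m q (G ^ e) + 1) ≤ G ^ (k * q + e + 5) := by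
    rw [add_assoc, pow_add]
    exact Nat.mul_le_mul (Nat.pow_le_pow_left hm _) h₁
  have h₃ : G ^ 5 ≤ G ^ (k * q + e + 5) := Nat.pow_le_pow_right (by omega) (by omega)
  have h₄ : G ^ (k * q + e + 6) = G ^ (k * q + e + 5) * G := by ring
  have h₅ : k * q ≤ G * G := Nat.mul_le_mul hk hq
  have h₆ : 1000 * (G * G) ≤ G ^ 5 := by
    calc 1000 * (G * G) = 10 ^ 3 * G ^ 2 := by ring
      _ ≤ G ^ 3 * G ^ 2 := by gcongr
      _ = G ^ 5 := by ring
  nlinarith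

theorem updateTime_le (hG : 10 ≤ G) (hd : d ≤ G) (hm : mx ≤ G) (n : ℕ) :
    1 + n * (6 * mx * mx + (d + 17) * mx + 2 * d + 50) ≤ (n + 1) * G ^ 3 := by
  have h : 6 * mx * mx + (d + 17) * mx + 2 * d + 50 ≤ G ^ 3 := by
    calc 6 * mx * mx + (d + 17) * mx + 2 * d + 50
        ≤ 6 * G * G + (G + 17) * G + 2 * G + 50 := by gcongr
      _ ≤ G ^ 3 := by
        obtain ⟨a, rfl⟩ := Nat.exists_eq_add_of_le hG
        ring_nf
        omega
  have h₁ := Nat.mul_le_mul_left n h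
  have h₂ : 1 ≤ G ^ 3 := Nat.one_le_pow _ _ (by omega)
  rw [Nat.add_one_mul n]
  omega

theorem thousand_mul_sq_le (hG : 10 ≤ G) : 1000 * (G * G) ≤ G ^ (e + 5) := by
  calc 1000 * (G * G) = 10 ^ 3 * G ^ 2 := by ring
    _ ≤ G ^ 3 * G ^ 2 := by gcongr
    _ = G ^ 5 := by ring
    _ ≤ G ^ (e + 5) := Nat.pow_le_pow_right (by omega) (by omega)

theorem fits_of_le (hG : 10 ≤ G) (hd : d ≤ G) (hm : mx ≤ G) (hM : 1000 * (G * G) ≤ M)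
    (hMW : M ≤ W) : Fits d mx M W := by
  have h₁ : mx * d ≤ G * G := Nat.mul_le_mul hm hd
  have h₂ : G * 10 ≤ G * G := Nat.mul_le_mul_left _ hG
  refine ⟨by omega, ?_, by omega⟩
  rw [add_mul]
  omega

theorem room_of_le (hG : 10 ≤ G) (hd : d ≤ G) (hk : k ≤ G) (hm : m ≤ G) (hq : q ≤ G)
    (hM : 1000 * (G * G) ≤ M) (hMW : M ≤ W) : Room d k m q M W := by
  have h₁ : m * d ≤ G * G := Nat.mul_le_mul hm hd
  have h₂ : k * d ≤ G * G := Nat.mul_le_mul hk hd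
  have h₃ : k * q ≤ G * G := Nat.mul_le_mul hk hq
  have h₄ : m * k ≤ G * G := Nat.mul_le_mul hm hk
  have h₅ : G * 10 ≤ G * G := Nat.mul_le_mul_left _ hG
  exact ⟨by omega, by omega, hMW, by omega⟩

end

/-- Within larger limits, an efficient assignment algorithm solves all problems that arise. -/
theorem IsEfficientAssignment.oracle {d k l e m G n M W : ℕ}
    {𝒦 : Set (Matrix (Fin k) (Fin l) ℕ)} {A : Program} (hA : IsEfficientAssignment d e 𝒦 A)
    (hG : d + m + k + l + Nat.size n ≤ G) (hM : G ^ e ≤ M) (hW : (G + n) ^ e ≤ W)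
    {y : ℕ → EuclideanSpace ℝ (Fin d)} {w : ℕ → ℕ} {fc : Fin m → Fin l}
    (hw : ∀ p : Fin m, 0 < w p) (hsum : ∑ p : Fin m, w p = n)
    (hc : IsColorConstraint (fun p : Fin m => w p) fc 𝒦) :
    Oracle (ExecPlain M W A) (G ^ e) m y w fc 𝒦 := by
  intro s c hs
  obtain ⟨t, s', hrun, ht, hopt⟩ := hA m _ _ fc c s hw hc hs
  have hsize : inputSize d k l (fun p : Fin m => w p) ≤ G := by rw [inputSize, hsum]; exact hG
  rw [hsum] at hrun
  exact ⟨t, s', hrun.mono ((Nat.pow_le_pow_left hsize _).trans hM)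
    ((Nat.pow_le_pow_left (by omega) _).trans hW) fun _ _ _ h => h,
    ht.trans (Nat.pow_le_pow_left hsize _), hopt⟩

/-- The exponent in the bounds. -/
def boundExp (d e : ℕ) : ℕ := (magnitudeExp d + 8) * (e + 17)

section

variable {d k l n e : ℕ} {ε : ℝ}

theorem magnitude_pow_le (hd : 1 ≤ d) (hk : 1 ≤ k) (hl : 1 ≤ l) (hε : 0 < ε) (hε1 : ε < 1)
    (r : ℕ) : (magnitude d k l n ε : ℝ) ^ r ≤ base d k l n ε ^ (magnitudeExp d * r) := by
  rw [pow_mul]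
  gcongr
  exact magnitude_le hd hk hl hε hε1

theorem cells_le (hd : 1 ≤ d) (hk : 1 ≤ k) (hl : 1 ≤ l) (hε : 0 < ε) (hε1 : ε < 1) :
    ((magnitude d k l n ε ^ (e + 5) : ℕ) : ℝ) ≤ base d k l n ε ^ boundExp d e := by
  have h1 := (base_bounds (n := n) hd hk hl hε hε1).1
  push_cast
  refine (magnitude_pow_le hd hk hl hε hε1 _).trans (pow_le_pow_right₀ h1 ?_)
  exact Nat.mul_le_mul (by omega) (by omega)

theorem word_le (hd : 1 ≤ d) (hk : 1 ≤ k) (hl : 1 ≤ l) (hε : 0 < ε) (hε1 : ε < 1) :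
    (((magnitude d k l n ε + n) ^ (e + 5) : ℕ) : ℝ) ≤
      (((n : ℝ) + 1) * base d k l n ε) ^ boundExp d e := by
  obtain ⟨h1, -, -, -, -, h2⟩ := base_bounds (n := n) hd hk hl hε hε1
  have hm := magnitude_le (n := n) hd hk hl hε hε1
  set B := base d k l n ε
  have hn : (0 : ℝ) ≤ n := Nat.cast_nonneg n
  have hBD : B ≤ (n + 1) * B := le_mul_of_one_le_left (by linarith) (by linarith)
  have hnD : (n : ℝ) ≤ (n + 1) * B :=
    (le_add_of_nonneg_right zero_le_one).trans (le_mul_of_one_le_right (by linarith) h1)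
  set D := ((n : ℝ) + 1) * B
  have hD1 : 1 ≤ D := h1.trans hBD
  have h₁ : B ^ magnitudeExp d ≤ D ^ magnitudeExp d := by gcongr
  have h₂ : D ≤ D ^ magnitudeExp d := le_self_pow₀ hD1 (by unfold magnitudeExp; omega)
  have h₃ : (2 : ℝ) ≤ D ^ 8 := h2.trans (by gcongr)
  have h₄ : (magnitude d k l n ε : ℝ) + n ≤ D ^ (magnitudeExp d + 8) := by
    calc (magnitude d k l n ε : ℝ) + n ≤ D ^ magnitudeExp d * 2 := by linarith
      _ ≤ D ^ magnitudeExp d * D ^ 8 := by gcongr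
      _ = _ := (pow_add _ _ _).symm
  push_cast
  calc ((magnitude d k l n ε : ℝ) + n) ^ (e + 5) ≤ (D ^ (magnitudeExp d + 8)) ^ (e + 5) := by
        gcongr
    _ = D ^ ((magnitudeExp d + 8) * (e + 5)) := (pow_mul _ _ _).symm
    _ ≤ _ := pow_le_pow_right₀ hD1 (Nat.mul_le_mul le_rfl (by omega))

theorem passTime_le (hd : 1 ≤ d) (hk : 1 ≤ k) (hl : 1 ≤ l) (hε : 0 < ε) (hε1 : ε < 1) :
    (((n + 1) * magnitude d k l n ε ^ 3 : ℕ) : ℝ) ≤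
      ((n : ℝ) + 1) * base d k l n ε ^ (boundExp d e * k) := by
  have h1 := (base_bounds (n := n) hd hk hl hε hε1).1
  push_cast
  gcongr
  refine (magnitude_pow_le hd hk hl hε hε1 _).trans (pow_le_pow_right₀ h1 ?_)
  calc magnitudeExp d * 3 ≤ boundExp d e := Nat.mul_le_mul (by omega) (by omega)
    _ ≤ _ := Nat.le_mul_of_pos_right _ hk

theorem searchTime_le (hd : 1 ≤ d) (hk : 1 ≤ k) (hl : 1 ≤ l) (hε : 0 < ε) (hε1 : ε < 1) :
    ((magnitude d k l n ε ^ (k * ⌈8 / ε⌉₊ + e + 6) : ℕ) : ℝ) ≤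
      base d k l n ε ^ ((boundExp d e : ℝ) * k / ε) := by
  have h1 := (base_bounds (n := n) hd hk hl hε hε1).1
  have hk' : (1 : ℝ) ≤ k := by exact_mod_cast hk
  push_cast
  refine (magnitude_pow_le hd hk hl hε hε1 _).trans ?_
  rw [← Real.rpow_natCast]
  refine Real.rpow_le_rpow_of_exponent_le h1 ?_
  have hi : 1 ≤ 1 / ε := one_le_one_div hε hε1.le
  have hq : (⌈8 / ε⌉₊ : ℝ) ≤ 9 * (1 / ε) := by
    have := Nat.ceil_lt_add_one (show 0 ≤ 8 / ε by positivity)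
    have e₁ : 8 / ε = 8 * (1 / ε) := by ring
    linarith
  have hki : 1 ≤ k * (1 / ε) := one_le_mul_of_one_le_of_one_le hk' hi
  unfold boundExp
  push_cast
  calc (magnitudeExp d : ℝ) * (k * ⌈8 / ε⌉₊ + e + 6)
      ≤ magnitudeExp d * (k * (9 * (1 / ε)) + e * (k * (1 / ε)) + 6 * (k * (1 / ε))) := by
        gcongr
        · exact le_mul_of_one_le_right (Nat.cast_nonneg e) hki
        · linarith
    _ = magnitudeExp d * (e + 15) * (k * (1 / ε)) := by ring
    _ ≤ (magnitudeExp d + 8) * (e + 17) * (k * (1 / ε)) := by gcongr <;> norm_num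
    _ = _ := by ring

end

end ColorKMeans

theorem mainTheorem3 (d : ℕ) (hd : 1 ≤ d) :
    ∃ P : StreamProgram, ∀ e : ℕ, ∃ C : ℕ,
      ∀ (k l : ℕ) (ε : ℝ), 1 ≤ k → 1 ≤ l → 0 < ε → ε < 1 →
      ∀ (n : ℕ) (x : Fin n → EuclideanSpace ℝ (Fin d)) (f : Fin n → Fin l)
        (𝒦 : Set (Matrix (Fin k) (Fin l) ℕ)),
        𝒦.Nonempty → IsColorConstraint (fun _ => 1) f 𝒦 →
      ∀ A : Program, IsEfficientAssignment d e 𝒦 A →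
      ∃ (M W t₀ t₁ t₂ : ℕ) (s₀ s₁ s₂ : State),
        -- the run: before, during and after the pass over the stream
        ExecWith A M W P.start (initialState k l ε) t₀ s₀ ∧
        StreamRun (ExecWith A M W) P.update (stream x f) s₀ t₁ s₁ ∧
        ExecWith A M W P.finish s₁ t₂ s₂ ∧
        -- memory cells, size of the stored integers
        (M : ℝ) ≤ base d k l n ε ^ C ∧
        (W : ℝ) ≤ (((n : ℝ) + 1) * base d k l n ε) ^ C ∧
        -- running time of the pass, and running time after the pass
        ((t₀ + t₁ : ℕ) : ℝ) ≤ ((n : ℝ) + 1) * base d k l n ε ^ (C * k) ∧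
        (t₂ : ℝ) ≤ base d k l n ε ^ ((C : ℝ) * k / ε) ∧
        -- the computed centers are a `(1 + ε)`-approximation
        (∃ α, Satisfies f 𝒦 α) ∧
        ∀ c : Fin k → EuclideanSpace ℝ (Fin d),
          colorCost x f 𝒦 (outputCenters d k s₂) ≤ (1 + ε) * colorCost x f 𝒦 c := by
  refine ⟨⟨startProg, updateProg d, finishProg d⟩, fun e => ⟨boundExp d e, ?_⟩⟩
  intro k l ε hk hl hε hε1 n x f 𝒦 hK hc A hA
  set G := magnitude d k l n ε with hGdef
  set mx := slots d k l n ε with hmxdef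
  have hG : 10 ≤ G := ten_le_magnitude hd hk hl hε hε1
  have hGsum : G = d + k + l + ⌈8 / ε⌉₊ + mx + Nat.size n := rfl
  set q := ⌈8 / ε⌉₊ with hq
  have hM : 1000 * (G * G) ≤ G ^ (e + 5) := thousand_mul_sq_le hG
  have hMW : G ^ (e + 5) ≤ (G + n) ^ (e + 5) := Nat.pow_le_pow_left (by omega) _
  have hGG : G * 10 ≤ G * G := Nat.mul_le_mul_left _ hG
  have hW : 2 * (n + 1) + l ≤ (G + n) ^ (e + 5) := by
    have := thousand_mul_sq_le (G := G + n) (e := e) (by omega)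
    have : (G + n) * 10 ≤ (G + n) * (G + n) := Nat.mul_le_mul_left _ (by omega)
    omega
  have hWA : (G + n) ^ e ≤ (G + n) ^ (e + 5) := Nat.pow_le_pow_right (by omega) (by omega)
  have hMA : G ^ e ≤ G ^ (e + 5) := Nat.pow_le_pow_right (by omega) (by omega)
  generalize hMdef : G ^ (e + 5) = M at *
  generalize hWdef : (G + n) ^ (e + 5) = W at *
  have hfits : Fits d mx M W := fits_of_le hG (by omega) (by omega) hM hMW
  obtain ⟨t₀, s₀, hrun₀, ht₀, hinv₀⟩ := startProg_runs (sub := ExecPlain M W A) (k := k) (l := l)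
    (x := x) (f := fun p => (f p : ℕ)) (M := M) (W := W) hε (by omega) (by omega)
  -- The bound on the number of points is `n + 1`, since the invariant at the end of the stream
  -- refers to an epoch that may begin only with the next point.
  obtain ⟨t₁, s₁, hrun₁, ht₁, j, T, F, L, done, cur, hinv₁, hpts⟩ :=
    streamRun_update (sub := ExecPlain M W A) (n := n + 1) hd hk hl hε hε1 hfits hW
      (fun j hj => cap_add_two_le_slots hε hj) (fun p => (f p).2) (List.finRange n) hinv₀
      (by simp)
  simp only [List.append_nil, List.nil_append] at hpts
  have hm : F.length + L.length ≤ mx := by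
    have hj : 2 ^ j ≤ n + 1 := by
      have h₁ := hinv₁.done_length
      have h₂ := congrArg List.length hpts
      simp only [List.length_append, List.length_finRange] at h₂
      omega
    have h₁ := cap_add_two_le_slots (d := d) (k := k) (l := l) hε hj
    have h₂ := hinv₁.frozen_length
    have h₃ := hinv₁.summary.length_le
    have : (F.length : ℝ) + L.length ≤ mx := by linarith
    exact_mod_cast this
  obtain ⟨t₂, s₂, hrun₂, ht₂, hopt⟩ := hinv₁.finish (sub := ExecPlain M W A) (tA := G ^ e) hε hε1 hk
    hpts (room_of_le hG (by omega) (by omega) (by omega) (by omega) hM hMW) (by omega) (by omega)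
    hK hc fun y w fc hw hsum hcon => hA.oracle (by omega) hMA hWA hw hsum hcon
  refine ⟨M, W, t₀, t₁, t₂, s₀, s₁, s₂, hrun₀, ?_, hrun₂, ?_, ?_, ?_, ?_, exists_satisfies hK hc,
    hopt⟩
  · rw [stream, List.ofFn_eq_map]
    exact hrun₁
  · rw [← hMdef]
    exact cells_le hd hk hl hε hε1
  · rw [← hWdef]
    exact word_le hd hk hl hε hε1
  · refine le_trans ?_ (passTime_le hd hk hl hε hε1)
    rw [List.length_finRange] at ht₁
    exact_mod_cast (Nat.add_le_add ht₀ ht₁).trans (updateTime_le hG (by omega) (by omega) n)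
  · refine le_trans ?_ (searchTime_le hd hk hl hε hε1)
    exact_mod_cast ht₂.trans (finishTime_le hG (by omega) (by omega) (by omega) (by omega))
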